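/- Let $\mathbb T^\infty=\mathbb T\times\mathbb T\times\cdots$ be the countably infinite torus with product topology and normalized Haar (product) measure $m$, written $d\theta$; its points are $e^{i\theta}=(e^{i\theta_1},e^{i\theta_2},\dots)$. Let $\mathbb Z_0^\infty$ be the set of integer sequences $\nu=(\nu_1,\nu_2,\dots)$ with only finitely many non-zero entries, and $\mathbb N_0^\infty\subset\mathbb Z_0^\infty$ the subset of those with all $\nu_j\ge 0$. For a finite (complex) Borel measure $\mu$ on $\mathbb T^\infty$, with total variation norm $\|\mu\|_{TV}$, put $\widehat\mu(\nu)=\int e^{-i\nu\cdot\theta}\,d\mu$, and for $\xi=re^{it}$ with $0\le r<1$ define the function on $\mathbb T^\infty$ $$\mu_\xi(e^{i\theta})=\sum_{\nu\in\mathbb Z_0^\infty}\widehat\mu(\nu)\,r^{|\nu_1|+2|\nu_2|+3|\nu_3|+\cdots}\,e^{it(\nu_1+2\nu_2+3\nu_3+\cdots)}\,e^{i\nu\cdot\theta}$$ (an absolutely convergent series), and the radial maximal function $M\mu(e^{i\theta})=\sup_{0<r<1}|\mu_r(e^{i\theta})|$. For $f\in L^1(\mathbb T^\infty)$ let $\widehat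 f(\nu)=\int f(e^{i\theta})e^{-i\nu\cdot\theta}\,d\theta$, and let $f_\xi$ and $Mf$ be defined by the same formulas with $\widehat f$ in place of $\widehat\mu$ (that is, identify $f$ with the measure $f\,dm$). The (Fourier) spectrum of $\mu$ or $f$ is the set of $\nu$ where the Fourier coefficient is non-zero; $H^1(\mathbb T^\infty)$ is the space of $f\in L^1(\mathbb T^\infty)$ with spectrum contained in $\mathbb N_0^\infty$, with the norm of $L^1$; and a finite Borel measure is called analytic if its spectrum is contained in $\mathbb N_0^\infty$. Then: (i) For every finite Borel measure $\mu$ on $\mathbb T^\infty$, $\int_{\mathbb T^\infty}|\mu_\xi(e^{i\theta})|\,d\theta\le\|\mu\|_{TV}$ for all $\xi\in\mathbb C$ with $|\xi|<1$, and $\mu_r\to\mu$ weak-$*$ as $r\nearrow1$, i.e. $\int g\,\mu_r\,d\theta\to\int g\,d\mu$ for every continuous $g:\mathbb T^\infty\to\mathbb C$. (ii) There is $C<\infty$ such that for every finite Borel measure $\mu$ on $\mathbb T^\infty$ with spectrum contained in $\mathbb N_0^\infty\cup(-\mathbb N_0^\infty)$ and every $\lambda>0$, $$m\big(\{e^{i\theta}: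 M\mu(e^{i\theta})>\lambda\}\big)\le\frac{C\|\mu\|_{TV}}{\lambda}.$$ Moreover, for every such $\mu$ the finite radial limit $\lim_{r\to1^-}\mu_r(e^{i\theta})$ exists for almost every $e^{i\theta}\in\mathbb T^\infty$. (iii) For every $f\in L^1(\mathbb T^\infty)$ with spectrum contained in $\mathbb N_0^\infty\cup(-\mathbb N_0^\infty)$, one has $\lim_{r\to1^-}f_r(e^{i\theta})=f(e^{i\theta})$ for almost every $e^{i\theta}\in\mathbb T^\infty$, and $\|f_r-f\|_1\to0$ as $r\nearrow1$. (iv) There is $C<\infty$ such that $\|Mf\|_1\le C\|f\|_{H^1(\mathbb T^\infty)}$ for every $f\in H^1(\mathbb T^\infty)$; likewise there is $C<\infty$ such that $\|M\mu\|_1\le C\|\mu\|_{TV}$ for every analytic measure $\mu$ on $\mathbb T^\infty$. -/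

import Mathlib

open MeasureTheory Filter Topology
open scoped ENNReal NNReal

noncomputable section

namespace InfTorus

/-- The infinite torus `𝕋^∞`, with coordinates `θ = (θ₁, θ₂, …)`, `θ_j ∈ ℝ / 2πℤ`; it carries the
product topology and the product (equivalently, Borel) `σ`-algebra. The coordinate with index
`j : ℕ` is the `(j+1)`-st variable `θ_{j+1}`. -/
abbrev Torus : Type := ℕ → AddCircle (2 * Real.pi)

instance instFactTwoPiPos : Fact (0 < 2 * Real.pi) := ⟨Real.two_pi_pos⟩

/-- The normalized Haar measure `m` of `𝕋^∞` (denoted `dθ`): the infinite product of the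
normalized arc-length measures. -/
def haar : Measure Torus :=
  Measure.infinitePi fun _ : ℕ => (AddCircle.haarAddCircle : Measure (AddCircle (2 * Real.pi)))

/-- The character `e^{iν·θ} = ∏_j e^{i ν_j θ_j}`, for `ν ∈ ℤ_0^∞` (finitely supported). -/
def char (ν : ℕ →₀ ℤ) (θ : Torus) : ℂ :=
  ν.prod fun j n => fourier n (θ j)

/-- The total variation norm `‖μ‖_TV` of a complex Borel measure. -/
def tvNorm (μ : ComplexMeasure Torus) : ℝ≥0∞ :=
  μ.variation Set.univ

/-- The integral `∫ g dμ` of a complex function against a complex Borel measure. -/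
def cintegral (μ : ComplexMeasure Torus) (g : Torus → ℂ) : ℂ :=
  μ.integral g (ContinuousLinearMap.mul ℝ ℂ)

/-- The Fourier coefficients `μ̂(ν) = ∫ e^{-iν·θ} dμ(θ)` of a complex Borel measure. -/
def measureCoeff (μ : ComplexMeasure Torus) (ν : ℕ →₀ ℤ) : ℂ :=
  cintegral μ (char (-ν))

/-- The Fourier coefficients `f̂(ν) = ∫ f(θ) e^{-iν·θ} dm(θ)` of a function. -/
def funCoeff (f : Torus → ℂ) (ν : ℕ →₀ ℤ) : ℂ :=
  ∫ θ, f θ * char (-ν) θ ∂haar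

/-- `|ν*|₁ = |ν₁| + 2|ν₂| + 3|ν₃| + ⋯`. -/
def weight (ν : ℕ →₀ ℤ) : ℕ :=
  ν.sum fun j n => (j + 1) * n.natAbs

/-- `ν₁ + 2ν₂ + 3ν₃ + ⋯`. -/
def twist (ν : ℕ →₀ ℤ) : ℤ :=
  ν.sum fun j n => ((j : ℤ) + 1) * n

/-- For a family `a` of Fourier coefficients and `ξ = r e^{it}`, the sum
`∑_ν a_ν r^{|ν*|₁} e^{it(ν₁ + 2ν₂ + ⋯)} e^{iν·θ}`. The series converges absolutely for `|ξ| < 1`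
when `a` is bounded; at `ξ = 0` only `ν = 0` contributes, so the choice of `t` is immaterial. -/
def extension (a : (ℕ →₀ ℤ) → ℂ) (ξ : ℂ) (θ : Torus) : ℂ :=
  ∑' ν : ℕ →₀ ℤ,
    a ν * (‖ξ‖ : ℂ) ^ weight ν * Complex.exp (Complex.I * (ξ.arg : ℂ) * (twist ν : ℂ)) * char ν θ

/-- `μ_ξ(e^{iθ})` for a complex Borel measure `μ`. -/
def measureExt (μ : ComplexMeasure Torus) (ξ : ℂ) (θ : Torus) : ℂ :=
  extension (measureCoeff μ) ξ θ

/-- `f_ξ(e^{iθ})` for an integrable function `f`. -/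
def funExt (f : Torus → ℂ) (ξ : ℂ) (θ : Torus) : ℂ :=
  extension (funCoeff f) ξ θ

/-- The radial maximal function `Mμ(e^{iθ}) = sup_{0 < r < 1} |μ_r(e^{iθ})|`. -/
def measureMax (μ : ComplexMeasure Torus) (θ : Torus) : ℝ≥0∞ :=
  ⨆ r ∈ Set.Ioo (0 : ℝ) 1, ‖measureExt μ (r : ℂ) θ‖ₑ

/-- The radial maximal function `Mf(e^{iθ}) = sup_{0 < r < 1} |f_r(e^{iθ})|`. -/
def funMax (f : Torus → ℂ) (θ : Torus) : ℝ≥0∞ :=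
  ⨆ r ∈ Set.Ioo (0 : ℝ) 1, ‖funExt f (r : ℂ) θ‖ₑ

/-- The family `a` is supported on `ℕ_0^∞`. -/
def AnalyticSpectrum (a : (ℕ →₀ ℤ) → ℂ) : Prop :=
  ∀ ν : ℕ →₀ ℤ, a ν ≠ 0 → ∀ j, 0 ≤ ν j

/-- The family `a` is supported on `ℕ_0^∞ ∪ (-ℕ_0^∞)`. -/
def HarmonicSpectrum (a : (ℕ →₀ ℤ) → ℂ) : Prop :=
  ∀ ν : ℕ →₀ ℤ, a ν ≠ 0 → (∀ j, 0 ≤ ν j) ∨ (∀ j, ν j ≤ 0)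

/-- `f ∈ H¹(𝕋^∞)`. -/
def MemHardyOne (f : Torus → ℂ) : Prop :=
  Integrable f haar ∧ AnalyticSpectrum (funCoeff f)

/-- The norm `‖f‖₁ = ∫ |f| dm`. -/
def normOne (f : Torus → ℂ) : ℝ≥0∞ :=
  ∫⁻ θ, ‖f θ‖ₑ ∂haar

end InfTorus

end

noncomputable section

namespace InfTorus

/-! ### Characters and the Kronecker flow -/

/-! The Kronecker flow `flow t`, which adds `(j + 1) • t` to the coordinate of index `j`, preserves
`haar` and multiplies the character of `ν` by `fourier (twist ν) t`. When all entries of `ν` have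
one sign, `|twist ν| = weight ν` (`natAbs_twist`). Hence, for a spectrum in the two opposite cones,
the radial extension restricted to an orbit of the flow is a classical harmonic function on the
disc: passing from radius `s` to `s * r` is Poisson integration in the orbit variable
(`extension_mul_flow`). Theorems on the circle then transfer to the torus by integrating over orbits
(`lintegral_flow`, `lintegral_arc_flow`, `ae_of_ae_flow`). At a radius `s < 1` everything is a
continuous, absolutely convergent series (`summable_pow_weight`), and the supremum over all radii is
recovered by monotone exhaustion (`iSup_dilate`).

The contraction property needs no spectral condition. The kernel of the torus is a limit of finite
products of circle Poisson kernels, so it is nonnegative with integral one (`kernel_nonneg`,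
`lintegral_kernel`). Testing the functional behind the coefficients against translates of this
kernel gives the `L¹` bound. Measures and integrable functions are treated together through
`Dominated`. The contraction and the density of trigonometric polynomials give weak-* and `L¹`
convergence.

Three facts on the circle are transferred. The weak type bound comes from a Vitali covering and the
dyadic domination of the Poisson kernel. The `H¹` bound comes from subharmonicity of `|F|^{1/2}`,
proved with square roots of outer majorants of polynomials, and the `L²` maximal inequality applied
to `√|F|`. Fatou's theorem goes from square summable coefficients to bounded analytic functions,
then to nonnegative harmonic functions through `exp (-F)`, then to general ones by splitting into
positive and negative parts and extracting limits. An individual orbit need not carry a uniform `L¹`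
bound, but Fatou's lemma gives one along a sequence of radii on almost every orbit, which suffices
(`ae_hasRadialLimit_extension`). The limit for a function is identified by an almost everywhere
convergent subsequence of the `L¹` convergence. -/

lemma fourier_add_arg {T : ℝ} (n : ℤ) (x y : AddCircle T) :
    fourier n (x + y) = fourier n x * fourier n y := by
  simp [fourier_apply, smul_add, AddCircle.toCircle_add]

lemma norm_fourier_apply {T : ℝ} (n : ℤ) (x : AddCircle T) : ‖fourier n x‖ = 1 :=
  Circle.norm_coe _

@[simp] lemma char_zero (θ : Torus) : char 0 θ = 1 := by simp [char]

lemma char_add (ν ν' : ℕ →₀ ℤ) (θ : Torus) : char (ν + ν') θ = char ν θ * char ν' θ := by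
  classical
  exact Finsupp.prod_add_index' (fun _ => fourier_zero) (fun _ _ _ => fourier_add)

lemma char_neg (ν : ℕ →₀ ℤ) (θ : Torus) : char (-ν) θ = (starRingEnd ℂ) (char ν θ) := by
  rw [char, Finsupp.prod_neg_index (h := fun j n => fourier n (θ j)) (fun _ => fourier_zero), char,
    Finsupp.prod, Finsupp.prod,
    map_prod]
  exact Finset.prod_congr rfl fun _ _ => fourier_neg

lemma char_add_arg (ν : ℕ →₀ ℤ) (θ φ : Torus) : char ν (θ + φ) = char ν θ * char ν φ := by
  simp only [char, Finsupp.prod, ← Finset.prod_mul_distrib]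
  exact Finset.prod_congr rfl fun _ _ => fourier_add_arg _ _ _

@[simp] lemma norm_char (ν : ℕ →₀ ℤ) (θ : Torus) : ‖char ν θ‖ = 1 := by
  rw [char, Finsupp.prod, norm_prod]
  exact Finset.prod_eq_one fun _ _ => norm_fourier_apply _ _

lemma char_neg_arg (ν : ℕ →₀ ℤ) (θ : Torus) : char ν (-θ) = char (-ν) θ := by
  have h1 : char ν (-θ) * char ν θ = 1 := by
    rw [← char_add_arg, neg_add_cancel]
    exact Finset.prod_eq_one fun j _ => by simp
  have h2 : char (-ν) θ * char ν θ = 1 := by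
    rw [← char_add, neg_add_cancel, char_zero]
  have h3 : char ν θ ≠ 0 := by
    rw [← norm_ne_zero_iff, norm_char]; exact one_ne_zero
  exact mul_right_cancel₀ h3 (h1.trans h2.symm)

@[fun_prop] lemma continuous_char (ν : ℕ →₀ ℤ) : Continuous (char ν) := by
  unfold char Finsupp.prod
  exact continuous_finsetProd _ fun j _ => (fourier _).continuous.comp (continuous_apply j)

/-- The character as a bundled continuous map. -/
def charC (ν : ℕ →₀ ℤ) : C(Torus, ℂ) := ⟨char ν, continuous_char ν⟩

@[simp] lemma charC_apply (ν : ℕ →₀ ℤ) (θ : Torus) : charC ν θ = char ν θ := rfl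

/-- The Kronecker flow `θ ↦ (θ₁ + t, θ₂ + 2t, θ₃ + 3t, …)`. -/
def flow (t : AddCircle (2 * Real.pi)) (θ : Torus) : Torus := θ + fun j => (j + 1) • t

lemma char_flow (ν : ℕ →₀ ℤ) (t : AddCircle (2 * Real.pi)) (θ : Torus) :
    char ν (flow t θ) = char ν θ * fourier (twist ν) t := by
  rw [flow, char_add_arg]
  congr 1
  rw [char, twist, Finsupp.prod, Finsupp.sum]
  have key : ∀ s : Finset ℕ, ∏ a ∈ s, fourier (ν a) ((a + 1) • t)
      = fourier (∑ a ∈ s, ((a : ℤ) + 1) * ν a) t := by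
    intro s
    induction s using Finset.cons_induction with
    | empty => simp
    | cons a s ha ih =>
      rw [Finset.prod_cons, Finset.sum_cons, ih, fourier_add]
      congr 1
      simp only [fourier_apply]
      congr 2
      rw [mul_comm ((a : ℤ) + 1), mul_smul]
      congr 1
  exact key _

lemma continuous_flow : Continuous fun p : AddCircle (2 * Real.pi) × Torus => flow p.1 p.2 := by
  unfold flow
  refine continuous_snd.add (continuous_pi fun j => ?_)
  exact (continuous_nsmul (j + 1)).comp continuous_fst

/-! ### Invariance of Haar measure and orthogonality of characters. -/

instance : IsProbabilityMeasure haar := by unfold haar; infer_instance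

instance : haar.IsAddLeftInvariant := by
  constructor
  intro φ
  have h := Measure.infinitePi_map_pi
    (fun _ : ℕ => (AddCircle.haarAddCircle : Measure (AddCircle (2 * Real.pi))))
    (f := fun j x => φ j + x) (fun j => measurable_const_add (φ j))
  simp only [map_add_left_eq_self] at h
  exact h

lemma measurePreserving_flow (t : AddCircle (2 * Real.pi)) :
    MeasurePreserving (flow t) haar haar :=
  measurePreserving_add_right haar _

lemma continuous_integrable {g : Torus → ℂ} (hg : Continuous g) {ρ : Measure Torus}
    [IsFiniteMeasure ρ] : Integrable g ρ :=
  (BoundedContinuousFunction.mkOfCompact ⟨g, hg⟩).integrable ρ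

/-- Translation by a point where the character is not `1` multiplies the integral by a factor other
than `1` while leaving it unchanged. -/
lemma integral_char {ν : ℕ →₀ ℤ} (hν : ν ≠ 0) : ∫ θ, char ν θ ∂haar = 0 := by
  obtain ⟨j, hj⟩ : ∃ j, ν j ≠ 0 := by
    by_contra! h
    exact hν (Finsupp.ext h)
  have hφ : ∃ φ : Torus, char ν φ ≠ 1 := by
    classical
    -- Moving the single coordinate `j` by `π / ν j` makes the character equal to `e^{iπ} = -1`.
    refine ⟨Pi.single j ((Real.pi / (ν j) : ℝ) : AddCircle (2 * Real.pi)), ?_⟩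
    have : char ν (Pi.single j ((Real.pi / (ν j) : ℝ) : AddCircle (2 * Real.pi)))
        = fourier (ν j) ((Real.pi / (ν j) : ℝ) : AddCircle (2 * Real.pi)) := by
      rw [char, Finsupp.prod, Finset.prod_eq_single j]
      · simp
      · intro b _ hb
        simp [Pi.single_eq_of_ne hb]
      · intro h
        simp [Finsupp.notMem_support_iff.1 h]
    have e : (2 * (Real.pi : ℂ) * Complex.I * (ν j : ℂ) * ((Real.pi / (ν j) : ℝ) : ℂ)
        / ((2 * Real.pi : ℝ) : ℂ)) = Real.pi * Complex.I := by
      have h1 : (Real.pi : ℂ) ≠ 0 := by exact_mod_cast Real.pi_ne_zero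
      have h2 : (ν j : ℂ) ≠ 0 := by exact_mod_cast hj
      push_cast
      field_simp
    rw [this, fourier_coe_apply, e, Complex.exp_pi_mul_I]
    norm_num
  obtain ⟨φ, hφ⟩ := hφ
  have h := integral_add_right_eq_self (μ := haar) (fun θ => char ν θ) φ
  simp only [char_add_arg, integral_mul_const] at h
  have : (∫ θ, char ν θ ∂haar) * (char ν φ - 1) = 0 := by rw [mul_sub, h]; ring
  exact (mul_eq_zero.1 this).resolve_right (sub_ne_zero.2 hφ)

/-! ### Summability of the weights -/

@[simp] lemma weight_zero : weight 0 = 0 := by simp [weight]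

@[simp] lemma weight_neg (ν : ℕ →₀ ℤ) : weight (-ν) = weight ν := by
  rw [weight, Finsupp.sum_neg_index (fun _ => by simp), weight]
  simp

lemma pow_weight_eq_prod {R : Type*} [CommMonoid R] (r : R) (ν : ℕ →₀ ℤ) :
    r ^ weight ν = ν.prod fun j n => r ^ ((j + 1) * n.natAbs) := by
  rw [weight, Finsupp.sum, Finsupp.prod, Finset.prod_pow_eq_pow_sum]

/-- Sums over boxes of finitely supported sequences factor. -/
lemma sum_finsupp_prod {R : Type*} [CommRing R] (s : Finset ℕ) (t : ℕ → Finset ℤ)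
    (b : ℕ → ℤ → R) (hb : ∀ j, b j 0 = 1) :
    ∑ ν ∈ s.finsupp t, ν.prod b = ∏ j ∈ s, ∑ n ∈ t j, b j n := by
  classical
  rw [Finset.prod_sum, Finset.finsupp, Finset.sum_map]
  refine Finset.sum_congr (by congr; exact Subsingleton.elim _ _) fun p hp => ?_
  simp only [Function.Embedding.coeFn_mk]
  rw [Finsupp.prod_of_support_subset _ (Finsupp.support_indicator_subset _ _) _ (fun j _ => hb j),
    ← Finset.prod_attach]
  exact Finset.prod_congr rfl fun j _ => by
    rw [Finsupp.indicator_of_mem j.2]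

/-- The box of sequences supported in `{0, …, N - 1}` with entries bounded by `M`. -/
def box (N M : ℕ) : Finset (ℕ →₀ ℤ) :=
  (Finset.range N).finsupp fun _ => Finset.Icc (-(M : ℤ)) M

lemma mem_box {N M : ℕ} {ν : ℕ →₀ ℤ} :
    ν ∈ box N M ↔ ν.support ⊆ Finset.range N ∧ ∀ j < N, |ν j| ≤ M := by
  simp [box, Finset.mem_finsupp_iff, abs_le]

lemma box_mono {N N' M M' : ℕ} (hN : N ≤ N') (hM : M ≤ M') : box N M ⊆ box N' M' := by
  intro ν hν
  rw [mem_box] at hν ⊢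
  refine ⟨hν.1.trans (Finset.range_mono hN), fun j _ => ?_⟩
  by_cases h : j < N
  · exact (hν.2 j h).trans (by exact_mod_cast hM)
  · have : ν j = 0 := by
      by_contra h0
      exact h (Finset.mem_range.1 (hν.1 (Finsupp.mem_support_iff.2 h0)))
    simp [this]

lemma exists_mem_box (ν : ℕ →₀ ℤ) : ∃ N, ∀ M, N ≤ M → ν ∈ box M M := by
  refine ⟨(ν.support.sup id + 1) + ν.support.sup (fun j => (ν j).natAbs), fun M hM => ?_⟩
  rw [mem_box]
  refine ⟨fun j hj => ?_, fun j _ => ?_⟩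
  · have := Finset.le_sup (f := id) hj
    simp only [id] at this
    rw [Finset.mem_range]; omega
  · by_cases hj : j ∈ ν.support
    · have := Finset.le_sup (f := fun j => (ν j).natAbs) hj
      rw [Int.abs_eq_natAbs]
      exact_mod_cast (by omega : (ν j).natAbs ≤ M)
    · simp [Finsupp.notMem_support_iff.1 hj]

lemma hasSum_pow_natAbs {q : ℝ} (h0 : 0 ≤ q) (h1 : q < 1) :
    HasSum (fun n : ℤ => q ^ n.natAbs) (1 + 2 * (q / (1 - q))) := by
  have hg := hasSum_geometric_of_lt_one h0 h1
  have hg' : HasSum (fun n : ℕ => q ^ (n + 1)) ((1 - q)⁻¹ * q) := by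
    have := hg.mul_right q
    simpa only [← pow_succ] using this
  have h := HasSum.of_nat_of_neg_add_one (f := fun n : ℤ => q ^ n.natAbs) (m := (1 - q)⁻¹)
    (m' := (1 - q)⁻¹ * q) (by simpa using hg)
    hg'
  convert! h using 1
  have : 1 - q ≠ 0 := by linarith
  field_simp
  ring

/-- Over a box the sum factors into one sum per coordinate. Each factor is at most `1 + 2 r^{j+1} /
(1 - r^{j+1}) ≤ exp (2 r^j / (1 - r))`, so the growing weights `j + 1` keep the product bounded
uniformly in the box. -/
lemma summable_pow_weight {r : ℝ} (h0 : 0 ≤ r) (h1 : r < 1) :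
    Summable fun ν : ℕ →₀ ℤ => r ^ weight ν := by
  refine summable_of_sum_le (c := Real.exp (2 * (1 - r)⁻¹ ^ 2)) (fun ν => by positivity) fun u => ?_
  obtain ⟨N, hN⟩ : ∃ N, u ⊆ box N N := by
    choose N hN using exists_mem_box
    exact ⟨u.sup N, fun ν hν => hN ν _ (Finset.le_sup hν)⟩
  have hr : 0 < 1 - r := by linarith
  have step : ∀ j : ℕ, ∑ n ∈ Finset.Icc (-(N : ℤ)) N, r ^ ((j + 1) * n.natAbs)
      ≤ Real.exp (2 * (r ^ j * (1 - r)⁻¹)) := by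
    intro j
    have hq0 : 0 ≤ r ^ (j + 1) := by positivity
    have hq1 : r ^ (j + 1) ≤ r := by
      simpa using pow_le_pow_of_le_one h0 h1.le (Nat.succ_le_succ (Nat.zero_le j))
    have hs := hasSum_pow_natAbs hq0 (lt_of_le_of_lt hq1 h1)
    have h2 : ∑ n ∈ Finset.Icc (-(N : ℤ)) N, r ^ ((j + 1) * n.natAbs)
        ≤ 1 + 2 * (r ^ (j + 1) / (1 - r ^ (j + 1))) := by
      simp only [pow_mul]
      exact sum_le_hasSum _ (fun n _ => by positivity) hs
    have h3 : r ^ (j + 1) / (1 - r ^ (j + 1)) ≤ r ^ j * (1 - r)⁻¹ := by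
      rw [div_eq_mul_inv]
      exact mul_le_mul (pow_le_pow_of_le_one h0 h1.le (Nat.le_succ j))
        (inv_anti₀ hr (by linarith)) (by rw [inv_nonneg]; linarith) (by positivity)
    have h4 := Real.add_one_le_exp (2 * (r ^ j * (1 - r)⁻¹))
    linarith
  calc ∑ ν ∈ u, r ^ weight ν ≤ ∑ ν ∈ box N N, r ^ weight ν :=
        Finset.sum_le_sum_of_subset_of_nonneg hN fun _ _ _ => by positivity
    _ = ∏ j ∈ Finset.range N, ∑ n ∈ Finset.Icc (-(N : ℤ)) N, r ^ ((j + 1) * n.natAbs) := by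
        simp only [pow_weight_eq_prod, box]
        exact sum_finsupp_prod _ _ (fun j n => r ^ ((j + 1) * n.natAbs)) (by simp)
    _ ≤ ∏ j ∈ Finset.range N, Real.exp (2 * (r ^ j * (1 - r)⁻¹)) :=
        Finset.prod_le_prod (fun j _ => Finset.sum_nonneg fun _ _ => by positivity)
          fun j _ => step j
    _ = Real.exp (∑ j ∈ Finset.range N, 2 * (r ^ j * (1 - r)⁻¹)) := (Real.exp_sum _ _).symm
    _ ≤ Real.exp (2 * (1 - r)⁻¹ ^ 2) := by
        rw [Real.exp_le_exp, ← Finset.mul_sum, ← Finset.sum_mul, sq]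
        have : ∑ j ∈ Finset.range N, r ^ j ≤ (1 - r)⁻¹ :=
          sum_le_hasSum _ (fun j _ => by positivity) (hasSum_geometric_of_lt_one h0 h1)
        gcongr

/-! ### The extension operator -/

/-- A family of coefficients bounded by `A`. -/
def CoeffBound (a : (ℕ →₀ ℤ) → ℂ) (A : ℝ) : Prop := ∀ ν, ‖a ν‖ ≤ A

lemma CoeffBound.nonneg {a : (ℕ →₀ ℤ) → ℂ} {A : ℝ} (ha : CoeffBound a A) : 0 ≤ A :=
  (norm_nonneg _).trans (ha 0)

lemma extension_ofReal {r : ℝ} (hr : 0 ≤ r) (a : (ℕ →₀ ℤ) → ℂ) (θ : Torus) :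
    extension a r θ = ∑' ν, a ν * (r : ℂ) ^ weight ν * char ν θ := by
  simp [extension, Complex.arg_ofReal_of_nonneg hr, abs_of_nonneg hr]

/-- The argument of `ξ` acts only by a measure preserving translation, so `L¹` norms depend on `‖ξ‖`
alone. -/
lemma extension_eq_flow (a : (ℕ →₀ ℤ) → ℂ) (ξ : ℂ) (θ : Torus) :
    extension a ξ θ = extension a (‖ξ‖ : ℂ) (flow (ξ.arg : AddCircle (2 * Real.pi)) θ) := by
  rw [extension_ofReal (norm_nonneg _), extension]
  refine tsum_congr fun ν => ?_
  rw [char_flow, fourier_coe_apply]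
  have : 2 * (Real.pi : ℂ) * Complex.I * (twist ν : ℂ) * (ξ.arg : ℂ) / ((2 * Real.pi : ℝ) : ℂ)
      = Complex.I * ξ.arg * twist ν := by
    have h1 : (Real.pi : ℂ) ≠ 0 := by exact_mod_cast Real.pi_ne_zero
    push_cast
    field_simp
  rw [this]
  ring

lemma norm_extension_term {a : (ℕ →₀ ℤ) → ℂ} {A r : ℝ} (ha : CoeffBound a A) (hr : 0 ≤ r)
    (ν : ℕ →₀ ℤ) (θ : Torus) : ‖a ν * (r : ℂ) ^ weight ν * char ν θ‖ ≤ A * r ^ weight ν := by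
  rw [norm_mul, norm_mul, norm_char, mul_one, norm_pow, Complex.norm_real,
    Real.norm_of_nonneg hr]
  exact mul_le_mul_of_nonneg_right (ha ν) (by positivity)

lemma summable_extension {a : (ℕ →₀ ℤ) → ℂ} {A r : ℝ} (ha : CoeffBound a A) (h0 : 0 ≤ r)
    (h1 : r < 1) (θ : Torus) : Summable fun ν => a ν * (r : ℂ) ^ weight ν * char ν θ :=
  .of_norm_bounded ((summable_pow_weight h0 h1).mul_left A)
    fun ν => norm_extension_term ha h0 ν θ

/-- Joint continuity of the extension in the radius and the point. -/
lemma continuousOn_extension {a : (ℕ →₀ ℤ) → ℂ} {A : ℝ} (ha : CoeffBound a A) {s : ℝ}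
    (h0 : 0 ≤ s) (h1 : s < 1) :
    ContinuousOn (fun p : ℝ × Torus => extension a (p.1 : ℂ) p.2) (Set.Icc 0 s ×ˢ Set.univ) := by
  have : ContinuousOn (fun p : ℝ × Torus => ∑' ν, a ν * (p.1 : ℂ) ^ weight ν * char ν p.2)
      (Set.Icc 0 s ×ˢ Set.univ) := by
    refine continuousOn_tsum (fun ν => Continuous.continuousOn (by fun_prop))
      ((summable_pow_weight h0 h1).mul_left A) fun ν p hp => ?_
    refine (norm_extension_term ha hp.1.1 ν p.2).trans ?_
    exact mul_le_mul_of_nonneg_left (pow_le_pow_left₀ hp.1.1 hp.1.2 _) ha.nonneg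
  exact this.congr fun p hp => extension_ofReal hp.1.1 a p.2

lemma continuous_extension {a : (ℕ →₀ ℤ) → ℂ} {A r : ℝ} (ha : CoeffBound a A) (h0 : 0 ≤ r)
    (h1 : r < 1) : Continuous (extension a (r : ℂ)) := by
  have h := continuousOn_extension ha h0 h1
  have : ContinuousOn (fun θ : Torus => extension a (r : ℂ) θ) Set.univ :=
    h.comp (f := fun θ : Torus => (r, θ)) (Continuous.continuousOn (by fun_prop))
      (fun θ _ => ⟨⟨h0, le_rfl⟩, trivial⟩)
  exact continuousOn_univ.1 this

lemma continuousOn_extension_radius {a : (ℕ →₀ ℤ) → ℂ} {A : ℝ} (ha : CoeffBound a A)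
    (θ : Torus) : ContinuousOn (fun r : ℝ => extension a (r : ℂ) θ) (Set.Ioo 0 1) := by
  intro r hr
  have h := continuousOn_extension ha (s := (r + 1) / 2) (by linarith [hr.1]) (by linarith [hr.2])
  have h2 : ContinuousOn (fun r : ℝ => extension a (r : ℂ) θ) (Set.Icc 0 ((r + 1) / 2)) :=
    h.comp (f := fun r : ℝ => (r, θ)) (Continuous.continuousOn (by fun_prop))
      (fun r hr => ⟨hr, trivial⟩)
  exact (h2.continuousAt (Icc_mem_nhds hr.1 (by linarith [hr.2]))).continuousWithinAt

/-! ### The Poisson kernel on the circle -/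

/-- The circle `ℝ / 2πℤ`. -/
abbrev Circ : Type := AddCircle (2 * Real.pi)

/-- The normalized arc-length measure on the circle. -/
abbrev arc : Measure Circ := AddCircle.haarAddCircle

/-- The Poisson kernel `(1 - r²) / |1 - r e^{it}|²`. -/
def poisson (r : ℝ) (t : Circ) : ℝ := (1 - r ^ 2) / ‖1 - (r : ℂ) * fourier 1 t‖ ^ 2

lemma norm_mul_fourier {r : ℝ} (h0 : 0 ≤ r) (n : ℤ) (t : Circ) :
    ‖(r : ℂ) * fourier n t‖ = r := by
  rw [norm_mul, norm_fourier_apply, mul_one, Complex.norm_real, Real.norm_of_nonneg h0]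

lemma one_sub_le_norm {r : ℝ} (h0 : 0 ≤ r) (t : Circ) :
    1 - r ≤ ‖1 - (r : ℂ) * fourier 1 t‖ := by
  have := norm_sub_norm_le (1 : ℂ) ((r : ℂ) * fourier 1 t)
  rwa [norm_mul_fourier h0, norm_one] at this

lemma poisson_nonneg {r : ℝ} (h0 : 0 ≤ r) (h1 : r < 1) (t : Circ) : 0 ≤ poisson r t := by
  unfold poisson
  have : r ^ 2 ≤ 1 := pow_le_one₀ h0 h1.le
  exact div_nonneg (by linarith) (by positivity)

lemma continuous_poisson {r : ℝ} (h0 : 0 ≤ r) (h1 : r < 1) : Continuous (poisson r) := by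
  unfold poisson
  refine continuous_const.div (by fun_prop) fun t => ?_
  have := one_sub_le_norm h0 t
  have : 0 < ‖1 - (r : ℂ) * fourier 1 t‖ := by linarith
  positivity

lemma fourier_natCast (n : ℕ) (t : Circ) : fourier (n : ℤ) t = fourier 1 t ^ n := by
  induction n with
  | zero => simp
  | succ n ih => rw [Nat.cast_succ, fourier_add, ih, pow_succ]

lemma hasSum_poisson {r : ℝ} (h0 : 0 ≤ r) (h1 : r < 1) (t : Circ) :
    HasSum (fun n : ℤ => (r : ℂ) ^ n.natAbs * fourier n t) (poisson r t) := by
  obtain ⟨w, hw⟩ : ∃ w, w = (r : ℂ) * fourier 1 t := ⟨_, rfl⟩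
  have hwn : ‖w‖ < 1 := by rw [hw, norm_mul_fourier h0]; exact h1
  have hcn : ‖(starRingEnd ℂ) w‖ < 1 := by rwa [RCLike.norm_conj]
  have hA : HasSum (fun n : ℕ => (r : ℂ) ^ (n : ℤ).natAbs * fourier (n : ℤ) t) (1 - w)⁻¹ := by
    simpa only [Int.natAbs_natCast, fourier_natCast, ← mul_pow, ← hw]
      using hasSum_geometric_of_norm_lt_one hwn
  have hB : HasSum (fun n : ℕ => (r : ℂ) ^ (-((n : ℤ) + 1)).natAbs * fourier (-((n : ℤ) + 1)) t)
      ((1 - (starRingEnd ℂ) w)⁻¹ * (starRingEnd ℂ) w) := by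
    have e : ∀ n : ℕ, (r : ℂ) ^ (-((n : ℤ) + 1)).natAbs * fourier (-((n : ℤ) + 1)) t
        = (starRingEnd ℂ) w ^ (n + 1) := by
      intro n
      have h1 : (-((n : ℤ) + 1)).natAbs = n + 1 := by omega
      have h2 := fourier_natCast (n + 1) t
      push_cast at h2
      rw [h1, fourier_neg, h2, hw, map_mul, Complex.conj_ofReal, mul_pow, map_pow]
    have h := (hasSum_geometric_of_norm_lt_one hcn).mul_right ((starRingEnd ℂ) w)
    simp only [← pow_succ] at h
    simpa only [e] using h
  have hAB := HasSum.of_nat_of_neg_add_one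
    (f := fun n : ℤ => (r : ℂ) ^ n.natAbs * fourier n t) hA hB
  have hne : 1 - w ≠ 0 := by
    intro h
    have := one_sub_le_norm h0 t
    rw [← hw, h, norm_zero] at this
    linarith
  have hne' : 1 - (starRingEnd ℂ) w ≠ 0 := by
    intro h
    apply hne
    have := congrArg (starRingEnd ℂ) h
    simpa using this
  have hn : ((‖1 - w‖ : ℂ)) ^ 2 = (1 - w) * (1 - (starRingEnd ℂ) w) := by
    rw [← Complex.mul_conj']; simp
  have hr : w * (starRingEnd ℂ) w = (r : ℂ) ^ 2 := by
    rw [Complex.mul_conj', hw, norm_mul_fourier h0]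
  have hv : ((poisson r t : ℝ) : ℂ)
      = (1 - w)⁻¹ + (1 - (starRingEnd ℂ) w)⁻¹ * (starRingEnd ℂ) w := by
    rw [poisson, ← hw]
    push_cast
    rw [hn, ← hr]
    field_simp
    ring
  rw [hv]
  exact hAB

lemma integral_fourier (n : ℤ) : ∫ t, fourier n t ∂arc = if n = 0 then 1 else 0 := by
  split_ifs with h
  · subst h; simp
  · have hi := integral_add_right_eq_self (μ := arc) (fun t => fourier n t)
      ((2 * Real.pi / 2 / n : ℝ) : Circ)
    simp only [fourier_add_half_inv_index h Real.two_pi_pos, integral_neg] at hi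
    exact self_eq_neg.1 hi.symm

lemma continuous_circ_integrable {E : Type*} [NormedAddCommGroup E]
    [SecondCountableTopology E] [MeasurableSpace E] [BorelSpace E] {g : Circ → E}
    (hg : Continuous g) : Integrable g arc :=
  (BoundedContinuousFunction.mkOfCompact ⟨g, hg⟩).integrable arc

/-- The Poisson integral of a function on the circle. -/
def pint (r : ℝ) (F : Circ → ℂ) (t : Circ) : ℂ := ∫ τ, (poisson r (t - τ) : ℂ) * F τ ∂arc

lemma pint_eq {r : ℝ} (F : Circ → ℂ) (t : Circ) :
    pint r F t = ∫ τ, (poisson r τ : ℂ) * F (t - τ) ∂arc := by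
  rw [pint, ← integral_sub_left_eq_self _ arc t]
  simp

lemma integral_poisson_mul_fourier {r : ℝ} (h0 : 0 ≤ r) (h1 : r < 1) (k : ℤ) :
    ∫ τ, (poisson r τ : ℂ) * fourier k τ ∂arc = (r : ℂ) ^ k.natAbs := by
  have hF : ∀ τ, HasSum (fun n : ℤ => (r : ℂ) ^ n.natAbs * fourier (n + k) τ)
      ((poisson r τ : ℂ) * fourier k τ) := by
    intro τ
    simpa only [fourier_add, mul_assoc] using (hasSum_poisson h0 h1 τ).mul_right (fourier k τ)
  have hint := hasSum_integral_of_summable_integral_norm (μ := arc)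
    (F := fun (n : ℤ) τ => (r : ℂ) ^ n.natAbs * fourier (n + k) τ)
    (fun n => continuous_circ_integrable (by fun_prop)) (by
      simp only [norm_mul, norm_fourier_apply, norm_pow, Complex.norm_real,
        Real.norm_of_nonneg h0, mul_one, integral_const, probReal_univ, smul_eq_mul, one_mul]
      exact (hasSum_pow_natAbs h0 h1).summable)
  simp only [(hF _).tsum_eq, integral_const_mul, integral_fourier] at hint
  refine hint.unique ?_
  have h2 := hasSum_single (f := fun n : ℤ => (r : ℂ) ^ n.natAbs * if n + k = 0 then 1 else 0) (-k)
    fun n hn => by rw [if_neg (by omega), mul_zero]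
  simpa using h2

lemma pint_fourier {r : ℝ} (h0 : 0 ≤ r) (h1 : r < 1) (k : ℤ) (t : Circ) :
    pint r (fourier k) t = (r : ℂ) ^ k.natAbs * fourier k t := by
  have e : ∀ τ : Circ, (poisson r τ : ℂ) * fourier k (t - τ)
      = ((poisson r τ : ℂ) * fourier (-k) τ) * fourier k t := by
    intro τ
    rw [sub_eq_add_neg, fourier_add_arg]
    have : fourier k (-τ) = fourier (-k) τ := by simp [fourier_apply]
    rw [this]; ring
  rw [pint_eq]
  simp only [e, integral_mul_const, integral_poisson_mul_fourier h0 h1, Int.natAbs_neg]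

lemma integral_poisson {r : ℝ} (h0 : 0 ≤ r) (h1 : r < 1) : ∫ τ, poisson r τ ∂arc = 1 := by
  have := integral_poisson_mul_fourier h0 h1 0
  simp only [fourier_zero, mul_one, Int.natAbs_zero, pow_zero, integral_complex_ofReal] at this
  exact_mod_cast this

/-- Poisson integrals of absolutely convergent trigonometric series. -/
lemma pint_hasSum {ι : Type*} [Countable ι] {r : ℝ} (h0 : 0 ≤ r) (h1 : r < 1) {b : ι → ℂ}
    {k : ι → ℤ} (hb : Summable fun i => ‖b i‖) {F : Circ → ℂ}
    (hF : ∀ τ, HasSum (fun i => b i * fourier (k i) τ) (F τ)) (t : Circ) :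
    HasSum (fun i => b i * ((r : ℂ) ^ (k i).natAbs * fourier (k i) t)) (pint r F t) := by
  obtain ⟨B, hB⟩ : ∃ B, ∀ τ : Circ, ‖poisson r τ‖ ≤ B := by
    obtain ⟨B, hB⟩ := isCompact_univ.exists_bound_of_continuousOn (f := poisson r)
      (continuous_poisson h0 h1).continuousOn
    exact ⟨B, fun τ => hB τ trivial⟩
  have hpc : Continuous fun τ : Circ => ((poisson r (t - τ) : ℝ) : ℂ) :=
    Complex.continuous_ofReal.comp ((continuous_poisson h0 h1).comp (by fun_prop))
  have hint := hasSum_integral_of_summable_integral_norm (μ := arc)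
    (F := fun i τ => (poisson r (t - τ) : ℂ) * (b i * fourier (k i) τ))
    (fun i => continuous_circ_integrable (by fun_prop)) (by
      refine .of_nonneg_of_le (fun i => integral_nonneg fun τ => norm_nonneg _) (fun i => ?_)
        (hb.mul_left B)
      calc ∫ τ, ‖(poisson r (t - τ) : ℂ) * (b i * fourier (k i) τ)‖ ∂arc
          ≤ ∫ τ, B * ‖b i‖ ∂arc := by
            refine integral_mono (continuous_circ_integrable (by fun_prop))
              (integrable_const _) fun τ => ?_
            simp only [norm_mul, norm_fourier_apply, mul_one, Complex.norm_real]
            exact mul_le_mul_of_nonneg_right (hB _) (norm_nonneg _)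
        _ = B * ‖b i‖ := by simp)
  have e : ∀ i, ∫ τ, (poisson r (t - τ) : ℂ) * (b i * fourier (k i) τ) ∂arc
      = b i * ((r : ℂ) ^ (k i).natAbs * fourier (k i) t) := by
    intro i
    rw [← pint_fourier h0 h1, pint, ← integral_const_mul]
    exact integral_congr_ae (.of_forall fun τ => by ring)
  simp only [e] at hint
  convert! hint using 1
  rw [pint]
  refine integral_congr_ae (.of_forall fun τ => ?_)
  exact (((hF τ).mul_left _).tsum_eq).symm

/-! ### The Poisson kernel of the infinite torus and the contraction property -/

/-- The Poisson kernel `∑_ν r^{|ν*|} e^{iν·θ}` of the infinite torus. -/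
def kernel (r : ℝ) (θ : Torus) : ℂ := extension (fun _ => 1) r θ

lemma coeffBound_one : CoeffBound (fun _ => 1) 1 := fun _ => by simp

lemma hasSum_kernel {r : ℝ} (h0 : 0 ≤ r) (h1 : r < 1) (θ : Torus) :
    HasSum (fun ν => (r : ℂ) ^ weight ν * char ν θ) (kernel r θ) := by
  have := (summable_extension coeffBound_one h0 h1 θ).hasSum
  rw [← extension_ofReal h0] at this
  simp only [one_mul] at this
  exact this

lemma continuous_kernel {r : ℝ} (h0 : 0 ≤ r) (h1 : r < 1) : Continuous (kernel r) :=
  continuous_extension coeffBound_one h0 h1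

/-- With the number of variables fixed, box sums are products of symmetric partial sums of circle
Poisson kernels with radii `r ^ (j + 1)`. -/
lemma tendsto_sum_box {r : ℝ} (h0 : 0 ≤ r) (h1 : r < 1) (N : ℕ) (θ : Torus) :
    Tendsto (fun M => ∑ ν ∈ box N M, (r : ℂ) ^ weight ν * char ν θ) atTop
      (𝓝 (∏ j ∈ Finset.range N, poisson (r ^ (j + 1)) (θ j) : ℝ)) := by
  have e : ∀ M, ∑ ν ∈ box N M, (r : ℂ) ^ weight ν * char ν θ
      = ∏ j ∈ Finset.range N, ∑ n ∈ Finset.Icc (-(M : ℤ)) M,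
        (((r ^ (j + 1) : ℝ) : ℂ) ^ n.natAbs * fourier n (θ j)) := by
    intro M
    rw [box, ← sum_finsupp_prod _ _
      (fun j n => (((r ^ (j + 1) : ℝ) : ℂ) ^ n.natAbs * fourier n (θ j))) (by simp)]
    refine Finset.sum_congr rfl fun ν _ => ?_
    rw [pow_weight_eq_prod, char, ← Finsupp.prod_mul]
    refine Finsupp.prod_congr fun j _ => ?_
    push_cast
    rw [pow_mul]
  simp only [e]
  push_cast
  refine tendsto_finsetProd _ fun j _ => ?_
  have h := hasSum_poisson (r := r ^ (j + 1)) (by positivity)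
    (pow_lt_one₀ h0 h1 (Nat.succ_ne_zero j)) (θ j)
  push_cast at h
  have h' : Tendsto (fun s : Finset ℤ => ∑ n ∈ s, ((r : ℂ) ^ (j + 1)) ^ n.natAbs *
      fourier n (θ j)) atTop (𝓝 (poisson (r ^ (j + 1)) (θ j))) := h
  exact h'.comp (Finset.tendsto_Icc_neg (R := ℤ))

lemma kernel_nonneg {r : ℝ} (h0 : 0 ≤ r) (h1 : r < 1) (θ : Torus) :
    0 ≤ (kernel r θ).re ∧ (kernel r θ).im = 0 := by
  set p : ℕ → ℝ := fun N => ∏ j ∈ Finset.range N, poisson (r ^ (j + 1)) (θ j) with hp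
  have hp0 : ∀ N, 0 ≤ p N := fun N => Finset.prod_nonneg fun j _ =>
    poisson_nonneg (by positivity) (pow_lt_one₀ h0 h1 (Nat.succ_ne_zero j)) _
  -- A diagonal choice: each `M N` makes the box sum close to the product of `N` kernels, and `M N ≥
  -- N` makes the boxes exhaust all frequencies. The nonnegative products then converge to the full
  -- kernel without any tail estimate.
  have hex : ∀ N, ∃ M, N ≤ M ∧
      dist (∑ ν ∈ box N M, (r : ℂ) ^ weight ν * char ν θ) (p N : ℂ) < 1 / ((N : ℝ) + 1) := by
    intro N
    have h := Metric.tendsto_nhds.1 (tendsto_sum_box h0 h1 N θ) (1 / ((N : ℝ) + 1))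
      (by positivity)
    obtain ⟨M, hM⟩ := ((eventually_ge_atTop N).and h).exists
    exact ⟨M, hM.1, hM.2⟩
  choose M hM1 hM2 using hex
  have hbox : Tendsto (fun N => box N (M N)) atTop atTop := by
    rw [tendsto_atTop]
    intro u
    choose K hK using exists_mem_box
    filter_upwards [eventually_ge_atTop (u.sup K)] with N hN ν hν
    exact box_mono le_rfl (hM1 N) (hK ν N ((Finset.le_sup hν).trans hN))
  have hlim : Tendsto (fun N => (p N : ℂ)) atTop (𝓝 (kernel r θ)) := by
    have h := Tendsto.comp (hasSum_kernel h0 h1 θ) hbox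
    refine (tendsto_iff_of_dist ?_).1 h
    exact squeeze_zero (fun _ => dist_nonneg) (fun N => (hM2 N).le)
      tendsto_one_div_add_atTop_nhds_zero_nat
  constructor
  · refine ge_of_tendsto (Complex.continuous_re.continuousAt.tendsto.comp hlim)
      (.of_forall fun N => ?_)
    simpa using hp0 N
  · refine tendsto_nhds_unique (Complex.continuous_im.continuousAt.tendsto.comp hlim) ?_
    simp [Function.comp_def]

lemma integral_extension_mul_char {a : (ℕ →₀ ℤ) → ℂ} {A r : ℝ} (ha : CoeffBound a A) (h0 : 0 ≤ r)
    (h1 : r < 1) (ν : ℕ →₀ ℤ) :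
    ∫ θ, extension a r θ * char ν θ ∂haar = a (-ν) * (r : ℂ) ^ weight ν := by
  have hint := hasSum_integral_of_summable_integral_norm (μ := haar)
    (F := fun ν' θ => a ν' * (r : ℂ) ^ weight ν' * char ν' θ * char ν θ)
    (fun ν' => continuous_integrable (by fun_prop)) (by
      refine .of_nonneg_of_le (fun ν' => integral_nonneg fun τ => norm_nonneg _) (fun ν' => ?_)
        ((summable_pow_weight h0 h1).mul_left A)
      calc ∫ θ, ‖a ν' * (r : ℂ) ^ weight ν' * char ν' θ * char ν θ‖ ∂haar
          ≤ ∫ θ, A * r ^ weight ν' ∂haar := by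
            refine integral_mono (continuous_integrable (by fun_prop)).norm
              (integrable_const _) fun θ => ?_
            simp only [norm_mul _ (char ν θ), norm_char, mul_one]
            exact norm_extension_term ha h0 ν' θ
        _ = A * r ^ weight ν' := by simp)
  have e : ∀ θ, ∑' ν', a ν' * (r : ℂ) ^ weight ν' * char ν' θ * char ν θ
      = extension a r θ * char ν θ := by
    intro θ
    rw [extension_ofReal h0, tsum_mul_right]
  simp only [e] at hint
  refine hint.unique ?_
  have h2 := hasSum_single (f := fun ν' : ℕ →₀ ℤ =>
    ∫ θ, a ν' * (r : ℂ) ^ weight ν' * char ν' θ * char ν θ ∂haar) (-ν) fun ν' hν' => by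
      simp only [mul_assoc, ← char_add, integral_const_mul]
      rw [integral_char (fun h => hν' (eq_neg_of_add_eq_zero_left h)), mul_zero, mul_zero]
  simp only [mul_assoc, ← char_add, integral_const_mul] at h2 ⊢
  simpa using h2

/-- By nonnegativity the `L¹` norm is the zeroth Fourier coefficient. -/
lemma lintegral_kernel {r : ℝ} (h0 : 0 ≤ r) (h1 : r < 1) : ∫⁻ θ, ‖kernel r θ‖ₑ ∂haar = 1 := by
  have hint : Integrable (kernel r) haar := continuous_integrable (continuous_kernel h0 h1)
  have e : ∀ θ, ‖kernel r θ‖ = (kernel r θ).re := fun θ => by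
    obtain ⟨h2, h3⟩ := kernel_nonneg h0 h1 θ
    have : kernel r θ = ((kernel r θ).re : ℂ) := Complex.ext (by simp) (by simp [h3])
    rw [this, Complex.norm_real, Real.norm_of_nonneg h2]; simp
  rw [← ofReal_integral_norm_eq_lintegral_enorm hint]
  simp only [e]
  have h2 := integral_extension_mul_char coeffBound_one h0 h1 0
  simp only [char_zero, mul_one, weight_zero, pow_zero] at h2
  have h3 := integral_re (μ := haar) hint
  simp only [RCLike.re_eq_complex_re] at h3
  rw [h3, show ∫ θ, kernel r θ ∂haar = 1 from h2]
  simp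

/-- The family `a` is given by a functional on continuous functions dominated by a finite
measure of total mass `B`. -/
def Dominated (a : (ℕ →₀ ℤ) → ℂ) (ρ : Measure Torus) : Prop :=
  ∃ Λ : C(Torus, ℂ) →ₗ[ℂ] ℂ, (∀ g, ‖Λ g‖ₑ ≤ ∫⁻ θ, ‖g θ‖ₑ ∂ρ) ∧ ∀ ν, a ν = Λ (charC (-ν))

lemma enorm_functional_le_sup {Λ : C(Torus, ℂ) →ₗ[ℂ] ℂ} {ρ : Measure Torus} [IsFiniteMeasure ρ]
    (h : ∀ g, ‖Λ g‖ₑ ≤ ∫⁻ θ, ‖g θ‖ₑ ∂ρ) (g : C(Torus, ℂ)) : ‖Λ g‖ ≤ ρ.real Set.univ * ‖g‖ := by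
  have h2 : ‖Λ g‖ₑ ≤ ENNReal.ofReal (ρ.real Set.univ * ‖g‖) := by
    refine (h g).trans ?_
    calc ∫⁻ θ, ‖g θ‖ₑ ∂ρ ≤ ∫⁻ θ, ENNReal.ofReal ‖g‖ ∂ρ := by
          refine lintegral_mono fun θ => ?_
          rw [← ofReal_norm]
          exact ENNReal.ofReal_le_ofReal (g.norm_coe_le_norm θ)
      _ = ENNReal.ofReal (ρ.real Set.univ * ‖g‖) := by
          rw [lintegral_const, mul_comm, ENNReal.ofReal_mul measureReal_nonneg,
            ofReal_measureReal]
  rw [← ofReal_norm] at h2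
  exact (ENNReal.ofReal_le_ofReal_iff (by positivity)).1 h2

lemma Dominated.coeffBound {a : (ℕ →₀ ℤ) → ℂ} {ρ : Measure Torus} [IsFiniteMeasure ρ]
    (h : Dominated a ρ) : CoeffBound a (ρ.real Set.univ) := by
  obtain ⟨Λ, hΛ, ha⟩ := h
  intro ν
  rw [ha]
  refine (enorm_functional_le_sup hΛ _).trans ?_
  refine mul_le_of_le_one_right measureReal_nonneg ?_
  exact (ContinuousMap.norm_le _ zero_le_one).2 fun θ => by simp

/-- The contraction property `‖μ_ξ‖₁ ≤ ‖μ‖`. -/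
lemma Dominated.normOne_extension_le {a : (ℕ →₀ ℤ) → ℂ} {ρ : Measure Torus} [IsFiniteMeasure ρ]
    (h : Dominated a ρ) {ξ : ℂ} (hξ : ‖ξ‖ < 1) : normOne (extension a ξ) ≤ ρ Set.univ := by
  have hcb := h.coeffBound
  obtain ⟨Λ, hΛ, ha⟩ := h
  set r := ‖ξ‖
  have h0 : 0 ≤ r := norm_nonneg _
  have hflow : normOne (extension a ξ) = ∫⁻ θ, ‖extension a r θ‖ₑ ∂haar := by
    rw [normOne]
    simp only [extension_eq_flow a ξ]
    exact (measurePreserving_flow (ξ.arg : Circ)).lintegral_comp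
      (f := fun θ => ‖extension a r θ‖ₑ) (continuous_extension hcb h0 hξ).enorm.measurable
  have hK := continuous_kernel h0 hξ
  -- The extension is a convolution: the functional evaluated on a reflected translate of the
  -- kernel. The kernel series converges in the uniform norm, so the continuous functional may be
  -- applied term by term.
  have hrep : ∀ θ, extension a r θ
      = Λ ⟨fun φ => kernel r (θ - φ), hK.comp (by fun_prop)⟩ := by
    intro θ
    let Λc : C(Torus, ℂ) →L[ℂ] ℂ := Λ.mkContinuous _ (enorm_functional_le_sup hΛ)
    have hs : Summable fun ν : ℕ →₀ ℤ => ((r : ℂ) ^ weight ν * char ν θ) • charC (-ν) := by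
      refine .of_norm_bounded (summable_pow_weight h0 hξ) fun ν => ?_
      rw [norm_smul, norm_mul, norm_char, mul_one, norm_pow, Complex.norm_real,
        Real.norm_of_nonneg h0]
      refine mul_le_of_le_one_right (by positivity) ?_
      exact (ContinuousMap.norm_le _ zero_le_one).2 fun θ => by simp
    have hsum : ∑' ν : ℕ →₀ ℤ, ((r : ℂ) ^ weight ν * char ν θ) • charC (-ν)
        = ⟨fun φ => kernel r (θ - φ), hK.comp (by fun_prop)⟩ := by
      ext φ
      refine (ContinuousMap.tsum_apply hs φ).symm.trans (HasSum.tsum_eq ?_)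
      have := hasSum_kernel h0 hξ (θ - φ)
      simpa only [sub_eq_add_neg, char_add_arg, char_neg_arg, ContinuousMap.smul_apply,
        charC_apply, ContinuousMap.coe_mk, smul_eq_mul, mul_assoc] using this
    rw [← hsum, extension_ofReal h0]
    change _ = Λc _
    rw [Λc.map_tsum hs]
    refine tsum_congr fun ν => ?_
    rw [map_smul, ha]
    change _ = _ • Λ _
    rw [smul_eq_mul]; ring
  rw [hflow]
  calc ∫⁻ θ, ‖extension a r θ‖ₑ ∂haar
      ≤ ∫⁻ θ, ∫⁻ φ, ‖kernel r (θ - φ)‖ₑ ∂ρ ∂haar := by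
        refine lintegral_mono fun θ => ?_
        rw [hrep θ]
        exact hΛ _
    _ = ∫⁻ φ, ∫⁻ θ, ‖kernel r (θ - φ)‖ₑ ∂haar ∂ρ := by
        refine lintegral_lintegral_swap ?_
        have : Continuous (Function.uncurry fun θ φ : Torus => ‖kernel r (θ - φ)‖ₑ) :=
          (hK.comp (continuous_fst.sub continuous_snd)).enorm
        exact this.measurable.aemeasurable
    _ = ∫⁻ _, 1 ∂ρ := by
        refine lintegral_congr fun φ => ?_
        rw [lintegral_sub_right_eq_self (μ := haar) (fun θ => ‖kernel r θ‖ₑ) φ,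
          lintegral_kernel h0 hξ]
    _ = ρ Set.univ := by simp

/-! ### The Hardy–Littlewood maximal function on the circle -/

lemma arc_closedBall (t : Circ) (δ : ℝ) :
    arc (Metric.closedBall t δ) = ENNReal.ofReal (min 1 (δ / Real.pi)) := by
  have h := AddCircle.volume_closedBall (2 * Real.pi) (x := t) δ
  rw [AddCircle.volume_eq_smul_haarAddCircle, Measure.smul_apply, smul_eq_mul] at h
  have hpi := Real.pi_pos
  have e : ENNReal.ofReal (min (2 * Real.pi) (2 * δ))
      = ENNReal.ofReal (2 * Real.pi) * ENNReal.ofReal (min 1 (δ / Real.pi)) := by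
    rw [← ENNReal.ofReal_mul (by positivity), mul_min_of_nonneg _ _ (by positivity)]
    congr 2
    · ring
    · field_simp
  rw [e] at h
  exact (ENNReal.mul_right_inj (by simpa using hpi)
    ENNReal.ofReal_ne_top).1 h

lemma circ_norm_le_pi (x : Circ) : ‖x‖ ≤ Real.pi := by
  have h := AddCircle.norm_le_half_period (2 * Real.pi) (x := x) Real.two_pi_pos.ne'
  rwa [abs_of_pos Real.two_pi_pos, mul_div_cancel_left₀ _ two_ne_zero] at h

lemma closedBall_min_pi (t : Circ) (δ : ℝ) :
    Metric.closedBall t (min δ Real.pi) = Metric.closedBall t δ := by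
  ext x
  simp only [Metric.mem_closedBall, le_min_iff, and_iff_left_iff_imp]
  intro _
  rw [dist_eq_norm]
  exact circ_norm_le_pi _

/-- The Hardy–Littlewood maximal function of `φ` on the circle. -/
def maximal (φ : Circ → ℝ≥0∞) (t : Circ) : ℝ≥0∞ :=
  ⨆ (δ : ℝ) (_ : 0 < δ), (∫⁻ τ in Metric.closedBall t δ, φ τ ∂arc) / arc (Metric.closedBall t δ)

lemma arc_closedBall_pos (t : Circ) {δ : ℝ} (hδ : 0 < δ) : 0 < arc (Metric.closedBall t δ) := by
  rw [arc_closedBall, ENNReal.ofReal_pos]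
  exact lt_min one_pos (div_pos hδ Real.pi_pos)

lemma setLIntegral_closedBall_le (φ : Circ → ℝ≥0∞) (t : Circ) {δ : ℝ} (hδ : 0 < δ) :
    ∫⁻ τ in Metric.closedBall t δ, φ τ ∂arc
      ≤ maximal φ t * arc (Metric.closedBall t δ) := by
  rw [← ENNReal.div_le_iff (arc_closedBall_pos t hδ).ne' (measure_ne_top _ _)]
  exact le_iSup₂ (f := fun (δ : ℝ) (_ : 0 < δ) =>
    (∫⁻ τ in Metric.closedBall t δ, φ τ ∂arc) / arc (Metric.closedBall t δ)) δ hδ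

/-- The weak type `(1, 1)` inequality for the Hardy–Littlewood maximal function. -/
lemma mul_arc_maximal_le (φ : Circ → ℝ≥0∞) (c : ℝ≥0∞) :
    c * arc {t | c < maximal φ t} ≤ 5 * ∫⁻ τ, φ τ ∂arc := by
  set E := {t | c < maximal φ t} with hE
  have hex : ∀ t : Circ, ∃ δ : ℝ, 0 < δ ∧ δ ≤ Real.pi ∧ (t ∈ E →
      c * arc (Metric.closedBall t δ) ≤ ∫⁻ τ in Metric.closedBall t δ, φ τ ∂arc) := by
    intro t
    by_cases ht : t ∈ E
    · obtain ⟨δ, hδ, h⟩ : ∃ δ : ℝ, ∃ _ : 0 < δ,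
          c < (∫⁻ τ in Metric.closedBall t δ, φ τ ∂arc) / arc (Metric.closedBall t δ) := by
        simpa only [hE, maximal, Set.mem_ofPred_eq, lt_iSup_iff] using ht
      -- The covering lemma needs bounded radii; capping at `π` does not change the ball, since no
      -- two points of the circle are farther apart.
      refine ⟨min δ Real.pi, lt_min hδ Real.pi_pos, min_le_right _ _, fun _ => ?_⟩
      rw [closedBall_min_pi]
      exact ((ENNReal.lt_div_iff_mul_lt (.inl (arc_closedBall_pos t hδ).ne')
        (.inl (measure_ne_top _ _))).1 h).le
    · exact ⟨Real.pi, Real.pi_pos, le_rfl, fun h => absurd h ht⟩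
  choose δ hδ0 hδ1 hδ using hex
  obtain ⟨u, huE, hdisj, hcov⟩ := Vitali.exists_disjoint_subfamily_covering_enlargement_closedBall
    E id δ Real.pi (fun t _ => hδ1 t) 5 (by norm_num)
  simp only [id] at hdisj hcov
  have hcount : u.Countable := hdisj.countable_of_nonempty_interior fun t _ =>
    ⟨t, mem_interior_iff_mem_nhds.2 (Metric.closedBall_mem_nhds t (hδ0 t))⟩
  have hsub : E ⊆ ⋃ t ∈ u, Metric.closedBall t (5 * δ t) := by
    intro t ht
    obtain ⟨b, hb, h⟩ := hcov t ht
    exact Set.mem_biUnion hb (h (Metric.mem_closedBall_self (hδ0 t).le))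
  have h5 : ∀ t, arc (Metric.closedBall t (5 * δ t)) ≤ 5 * arc (Metric.closedBall t (δ t)) := by
    intro t
    rw [arc_closedBall, arc_closedBall, ← ENNReal.ofReal_ofNat, ← ENNReal.ofReal_mul (by norm_num)]
    apply ENNReal.ofReal_le_ofReal
    rw [mul_min_of_nonneg _ _ (by norm_num), mul_div_assoc]
    exact min_le_min (by norm_num) le_rfl
  calc c * arc E ≤ c * ∑' t : u, arc (Metric.closedBall (t : Circ) (5 * δ t)) := by
        gcongr
        exact (measure_mono hsub).trans (measure_biUnion_le arc hcount _)
    _ ≤ c * ∑' t : u, 5 * arc (Metric.closedBall (t : Circ) (δ t)) := by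
        gcongr
        exact h5 _
    _ = 5 * ∑' t : u, c * arc (Metric.closedBall (t : Circ) (δ t)) := by
        rw [ENNReal.tsum_mul_left, ENNReal.tsum_mul_left]; ring
    _ ≤ 5 * ∑' t : u, ∫⁻ τ in Metric.closedBall (t : Circ) (δ t), φ τ ∂arc := by
        gcongr with t
        exact hδ _ (huE t.2)
    _ = 5 * ∫⁻ τ in ⋃ t ∈ u, Metric.closedBall t (δ t), φ τ ∂arc := by
        rw [lintegral_biUnion hcount (fun _ _ => Metric.isClosed_closedBall.measurableSet) hdisj]
    _ ≤ 5 * ∫⁻ τ, φ τ ∂arc := by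
        gcongr 5 * ?_
        exact setLIntegral_le_lintegral _ _

/-- Where `φ ≤ c` the function adds at most `c` to any average. This reduces the `L²` inequality to
the weak type bound for the large part of `φ`. -/
lemma maximal_le_truncation (φ : Circ → ℝ≥0∞) (c : ℝ≥0∞) (t : Circ) :
    maximal φ t ≤ maximal ({τ | c < φ τ}.indicator φ) t + c := by
  refine iSup₂_le fun δ hδ => ?_
  rw [ENNReal.div_le_iff (arc_closedBall_pos t hδ).ne' (measure_ne_top _ _), add_mul]
  calc ∫⁻ τ in Metric.closedBall t δ, φ τ ∂arc
      ≤ ∫⁻ τ in Metric.closedBall t δ, ({τ | c < φ τ}.indicator φ τ + c) ∂arc := by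
        refine lintegral_mono fun τ => ?_
        by_cases h : c < φ τ
        · simp [Set.indicator, h]
        · simp [Set.indicator, h, not_lt.1 h]
    _ = ∫⁻ τ in Metric.closedBall t δ, {τ | c < φ τ}.indicator φ τ ∂arc
        + c * arc (Metric.closedBall t δ) := by
        rw [lintegral_add_right _ measurable_const, setLIntegral_const]
    _ ≤ _ := by
        gcongr
        exact setLIntegral_closedBall_le _ _ hδ

/-- The strong type `(2, 2)` inequality for functions dominated by a maximal function. -/
lemma lintegral_sq_le_of_le_maximal {G : Circ → ℝ} (hG0 : ∀ t, 0 ≤ G t) (hG : Measurable G)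
    {φ : Circ → ℝ} (hφ0 : ∀ t, 0 ≤ φ t) (hφ : Measurable φ)
    (h : ∀ t, ENNReal.ofReal (G t) ≤ maximal (fun τ => ENNReal.ofReal (φ τ)) t) :
    ∫⁻ t, ENNReal.ofReal (G t ^ 2) ∂arc ≤ 40 * ∫⁻ t, ENNReal.ofReal (φ t ^ 2) ∂arc := by
  have key : ∀ s : ℝ, 0 < s → arc {t | s < G t} * ENNReal.ofReal s
      ≤ 10 * ∫⁻ τ, ENNReal.ofReal (φ τ) * {p : ℝ × Circ | p.1 < 2 * φ p.2}.indicator 1 (s, τ)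
        ∂arc := by
    intro s hs
    set ψ : Circ → ℝ≥0∞ := fun τ => ENNReal.ofReal (φ τ) with hψ
    -- Truncating at half the level leaves the other half for the maximal function of the large
    -- part; the weak type constant `5` thus becomes `10`.
    have hs2 : ENNReal.ofReal s = ENNReal.ofReal (s / 2) + ENNReal.ofReal (s / 2) := by
      rw [← ENNReal.ofReal_add (by positivity) (by positivity)]; congr 1; ring
    have hsub : {t | s < G t}
        ⊆ {t | ENNReal.ofReal (s / 2) < maximal ({τ | ENNReal.ofReal (s / 2) < ψ τ}.indicator ψ) t}
        := by
      intro t ht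
      have h1 : ENNReal.ofReal s < ENNReal.ofReal (G t) :=
        (ENNReal.ofReal_lt_ofReal_iff (hs.trans ht)).2 ht
      have h2 := (h1.trans_le (h t)).trans_le (maximal_le_truncation ψ (ENNReal.ofReal (s / 2)) t)
      rw [hs2] at h2
      exact (ENNReal.add_lt_add_iff_right ENNReal.ofReal_ne_top).1 h2
    calc arc {t | s < G t} * ENNReal.ofReal s
        ≤ arc {t | ENNReal.ofReal (s / 2)
            < maximal ({τ | ENNReal.ofReal (s / 2) < ψ τ}.indicator ψ) t}
          * ENNReal.ofReal s := by gcongr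
      _ = 2 * (ENNReal.ofReal (s / 2) * arc {t | ENNReal.ofReal (s / 2)
            < maximal ({τ | ENNReal.ofReal (s / 2) < ψ τ}.indicator ψ) t}) := by
          rw [hs2, ← two_mul]; ring
      _ ≤ 2 * (5 * ∫⁻ τ, {τ | ENNReal.ofReal (s / 2) < ψ τ}.indicator ψ τ ∂arc) := by
          gcongr 2 * ?_
          exact mul_arc_maximal_le _ _
      _ = 10 * ∫⁻ τ, {τ | ENNReal.ofReal (s / 2) < ψ τ}.indicator ψ τ ∂arc := by
          rw [← mul_assoc]; norm_num
      _ ≤ _ := by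
          gcongr with τ
          by_cases hτ : ENNReal.ofReal (s / 2) < ψ τ
          · have : s < 2 * φ τ := by
              have := (ENNReal.ofReal_lt_ofReal_iff_of_nonneg (by positivity)).1 hτ
              linarith
            rw [Set.indicator_of_mem (by exact hτ)]
            simp [Set.indicator, this, hψ]
          · simp [Set.indicator, hτ]
  have hmeas : Measurable (fun p : ℝ × Circ => ENNReal.ofReal (φ p.2)
      * {p : ℝ × Circ | p.1 < 2 * φ p.2}.indicator 1 p) := by
    refine (hφ.comp measurable_snd).ennreal_ofReal.mul (measurable_one.indicator ?_)
    exact measurableSet_lt measurable_fst ((hφ.comp measurable_snd).const_mul 2)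
  have hlc := lintegral_rpow_eq_lintegral_meas_lt_mul arc (f := G) (.of_forall hG0)
    hG.aemeasurable (p := 2) two_pos
  have e1 : ∀ s : ℝ, s ^ ((2 : ℝ) - 1) = s := fun s => by norm_num
  simp only [Real.rpow_two, e1] at hlc
  rw [hlc]
  calc ENNReal.ofReal 2 * ∫⁻ s in Set.Ioi (0 : ℝ), arc {t | s < G t} * ENNReal.ofReal s
      ≤ 2 * ∫⁻ s in Set.Ioi (0 : ℝ), 10 * ∫⁻ τ, ENNReal.ofReal (φ τ)
          * {p : ℝ × Circ | p.1 < 2 * φ p.2}.indicator 1 (s, τ) ∂arc := by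
        rw [ENNReal.ofReal_ofNat]
        gcongr 2 * ?_
        exact setLIntegral_mono' measurableSet_Ioi fun s hs => key s hs
    _ = 20 * ∫⁻ s in Set.Ioi (0 : ℝ), ∫⁻ τ, ENNReal.ofReal (φ τ)
          * {p : ℝ × Circ | p.1 < 2 * φ p.2}.indicator 1 (s, τ) ∂arc := by
        rw [lintegral_const_mul' _ _ (by simp), ← mul_assoc]; norm_num
    -- After exchanging the integrals, the levels that count for `τ` form the interval `(0, 2 φ τ)`,
    -- whose length supplies the second factor `φ τ`.
    _ = 20 * ∫⁻ τ, (∫⁻ s in Set.Ioi (0 : ℝ), ENNReal.ofReal (φ τ)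
          * {p : ℝ × Circ | p.1 < 2 * φ p.2}.indicator 1 (s, τ)) ∂arc := by
        rw [lintegral_lintegral_swap]
        exact hmeas.aemeasurable
    _ = 20 * ∫⁻ τ, 2 * ENNReal.ofReal (φ τ ^ 2) ∂arc := by
        congr 1
        refine lintegral_congr fun τ => ?_
        rw [lintegral_const_mul' _ _ ENNReal.ofReal_ne_top]
        have : ∀ s : ℝ, {p : ℝ × Circ | p.1 < 2 * φ p.2}.indicator (1 : ℝ × Circ → ℝ≥0∞) (s, τ)
            = (Set.Iio (2 * φ τ)).indicator 1 s := fun s => by simp [Set.indicator]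
        simp only [this]
        rw [lintegral_indicator_one measurableSet_Iio, Measure.restrict_apply measurableSet_Iio,
          Set.inter_comm, Set.Ioi_inter_Iio, Real.volume_Ioo, sub_zero,
          ← ENNReal.ofReal_mul (hφ0 τ), ← ENNReal.ofReal_ofNat (n := 2),
          ← ENNReal.ofReal_mul (by norm_num)]
        congr 1; ring
    _ = 40 * ∫⁻ t, ENNReal.ofReal (φ t ^ 2) ∂arc := by
        rw [lintegral_const_mul' _ _ (by simp), ← mul_assoc]; norm_num

/-! ### Poisson integrals are controlled by the maximal function -/

/-- Jordan's inequality gives `|1 - e^{iy}| ≥ 2|y| / π`, and the triangle inequality with `1 - r ≤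
|1 - r e^{iy}|` gives `|1 - e^{iy}| ≤ 2 |1 - r e^{iy}|`. -/
lemma norm_div_pi_le {r : ℝ} (h0 : 0 ≤ r) (h1 : r ≤ 1) (x : Circ) :
    ‖x‖ / Real.pi ≤ ‖1 - (r : ℂ) * fourier 1 x‖ := by
  have hpi := Real.pi_pos
  obtain ⟨y, rfl, hy⟩ : ∃ y : ℝ, (y : Circ) = x ∧ |y| = ‖x‖ := by
    induction x using QuotientAddGroup.induction_on with
    | H z =>
      refine ⟨z - round ((2 * Real.pi)⁻¹ * z) * (2 * Real.pi), ?_, (AddCircle.norm_eq _).symm⟩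
      have : ((round ((2 * Real.pi)⁻¹ * z) * (2 * Real.pi) : ℝ) : Circ) = 0 := by
        rw [AddCircle.coe_eq_zero_iff]
        exact ⟨round ((2 * Real.pi)⁻¹ * z), by rw [zsmul_eq_mul]⟩
      rw [AddCircle.coe_sub, this, sub_zero]
  have hyl := circ_norm_le_pi (y : Circ)
  rw [← hy] at hyl ⊢
  have h2 : 2 * (|y| / Real.pi) ≤ ‖1 - fourier 1 (y : Circ)‖ := by
    have e : fourier 1 (y : Circ) = Complex.exp (Complex.I * y) := by
      rw [fourier_coe_apply]
      congr 1
      have h1 : (Real.pi : ℂ) ≠ 0 := by exact_mod_cast Real.pi_ne_zero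
      push_cast
      field_simp
    rw [norm_sub_rev, e, Complex.norm_exp_I_mul_ofReal_sub_one, norm_mul, Real.norm_ofNat]
    have h3 := Real.mul_abs_le_abs_sin (x := y / 2) (by rw [abs_div, abs_two]; linarith)
    rw [Real.norm_eq_abs]
    have e2 : 2 / Real.pi * |y / 2| = |y| / Real.pi := by
      rw [abs_div, abs_two]; field_simp
    linarith
  have h3 : ‖1 - fourier 1 (y : Circ)‖ ≤ ‖1 - (r : ℂ) * fourier 1 (y : Circ)‖ + (1 - r) := by
    have e : 1 - fourier 1 (y : Circ) = (1 - (r : ℂ) * fourier 1 (y : Circ))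
        - ((1 - r : ℝ) : ℂ) * fourier 1 (y : Circ) := by push_cast; ring
    rw [e]
    refine (norm_sub_le _ _).trans ?_
    rw [norm_mul_fourier (r := 1 - r) (by linarith)]
  have h4 := one_sub_le_norm h0 (y : Circ)
  linarith

lemma poisson_le_of_le {r q : ℝ} (h1 : r < 1) (hq : 0 < q) {x : Circ}
    (h : q ≤ ‖1 - (r : ℂ) * fourier 1 x‖) : poisson r x ≤ 2 * (1 - r) / q ^ 2 := by
  unfold poisson
  refine div_le_div₀ (by linarith) (by nlinarith) (by positivity) ?_
  exact pow_le_pow_left₀ hq.le h 2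

/-- A dyadic decomposition at scale `π (1 - r)`: each point lies in some ball of radius `2 ^ k`
times that scale on which the kernel has decayed like `4 ^ (-k)`. -/
lemma exists_poisson_le {r : ℝ} (h0 : 0 ≤ r) (h1 : r < 1) (x : Circ) :
    ∃ k : ℕ, ‖x‖ ≤ 2 ^ k * (Real.pi * (1 - r)) ∧ poisson r x ≤ 8 / (4 ^ k * (1 - r)) := by
  have hd : 0 < 1 - r := by linarith
  have hpi := Real.pi_pos
  by_cases hx : ‖x‖ / (Real.pi * (1 - r)) < 1
  · refine ⟨0, by rw [div_lt_one (by positivity)] at hx; linarith, ?_⟩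
    refine (poisson_le_of_le h1 hd (one_sub_le_norm h0 x)).trans ?_
    rw [pow_zero, one_mul, div_le_div_iff₀ (by positivity) hd]
    nlinarith [pow_pos hd 2]
  · obtain ⟨n, hn1, hn2⟩ := exists_nat_pow_near (not_lt.1 hx) one_lt_two
    rw [le_div_iff₀ (by positivity)] at hn1
    rw [div_lt_iff₀ (by positivity)] at hn2
    -- The lower bound on `‖x‖` has exponent `n` and the ball has exponent `n + 1`; this shift turns
    -- the constant `2` into `8`.
    refine ⟨n + 1, hn2.le, ?_⟩
    refine (poisson_le_of_le (q := 2 ^ n * (1 - r)) h1 (by positivity) ?_).trans ?_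
    · refine le_trans ?_ (norm_div_pi_le h0 h1.le x)
      rw [le_div_iff₀ hpi]
      linarith
    · apply le_of_eq
      have : (4 : ℝ) ^ (n + 1) = 4 * (2 ^ n) ^ 2 := by
        rw [pow_succ, ← pow_mul, mul_comm n 2, pow_mul]; norm_num; ring
      rw [this]
      field_simp
      norm_num

/-- The ball of index `k` has measure at most `2 ^ k (1 - r)` and carries the kernel bound `8 / (4 ^
k (1 - r))`, so the contributions form a geometric series `8 ∑ 2^{-k} = 16`, independent of `r`. -/
lemma lintegral_poisson_le_maximal {r : ℝ} (h0 : 0 ≤ r) (h1 : r < 1) {φ : Circ → ℝ≥0∞}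
    (hφ : Measurable φ) (t : Circ) :
    ∫⁻ τ, ENNReal.ofReal (poisson r (t - τ)) * φ τ ∂arc ≤ 16 * maximal φ t := by
  have hd : 0 < 1 - r := by linarith
  have hpi := Real.pi_pos
  have hpt : ∀ τ, ENNReal.ofReal (poisson r (t - τ)) * φ τ
      ≤ ∑' k : ℕ, ENNReal.ofReal (8 / (4 ^ k * (1 - r)))
        * (Metric.closedBall t (2 ^ k * (Real.pi * (1 - r)))).indicator φ τ := by
    intro τ
    obtain ⟨k, hk1, hk2⟩ := exists_poisson_le h0 h1 (t - τ)
    refine le_trans ?_ (ENNReal.le_tsum k)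
    rw [Set.indicator_of_mem (by rwa [Metric.mem_closedBall, dist_comm, dist_eq_norm])]
    gcongr
  calc ∫⁻ τ, ENNReal.ofReal (poisson r (t - τ)) * φ τ ∂arc
      ≤ ∫⁻ τ, ∑' k : ℕ, ENNReal.ofReal (8 / (4 ^ k * (1 - r)))
        * (Metric.closedBall t (2 ^ k * (Real.pi * (1 - r)))).indicator φ τ ∂arc :=
        lintegral_mono hpt
    _ = ∑' k : ℕ, ENNReal.ofReal (8 / (4 ^ k * (1 - r)))
        * ∫⁻ τ in Metric.closedBall t (2 ^ k * (Real.pi * (1 - r))), φ τ ∂arc := by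
        rw [lintegral_tsum fun k => ((hφ.indicator
          Metric.isClosed_closedBall.measurableSet).const_mul _).aemeasurable]
        refine tsum_congr fun k => ?_
        rw [lintegral_const_mul' _ _ ENNReal.ofReal_ne_top,
          lintegral_indicator Metric.isClosed_closedBall.measurableSet]
    _ ≤ ∑' k : ℕ, (2⁻¹ : ℝ≥0∞) ^ k * (8 * maximal φ t) := by
        refine ENNReal.tsum_le_tsum fun k => ?_
        have hδ : 0 < 2 ^ k * (Real.pi * (1 - r)) := by positivity
        calc _ ≤ ENNReal.ofReal (8 / (4 ^ k * (1 - r)))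
              * (maximal φ t * ENNReal.ofReal (2 ^ k * (1 - r))) := by
              gcongr
              refine (setLIntegral_closedBall_le φ t hδ).trans ?_
              rw [arc_closedBall]
              gcongr
              refine (min_le_right _ _).trans (le_of_eq ?_)
              field_simp
          _ = ENNReal.ofReal (8 / (4 ^ k * (1 - r)) * (2 ^ k * (1 - r))) * maximal φ t := by
              rw [ENNReal.ofReal_mul (p := 8 / (4 ^ k * (1 - r))) (by positivity), mul_assoc,
                mul_comm (maximal φ t)]
          _ = (2⁻¹ : ℝ≥0∞) ^ k * (8 * maximal φ t) := by
              have : 8 / (4 ^ k * (1 - r)) * (2 ^ k * (1 - r)) = (2⁻¹ : ℝ) ^ k * 8 := by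
                have h4 : (4 : ℝ) ^ k = 2 ^ k * 2 ^ k := by rw [← mul_pow]; norm_num
                rw [h4, inv_pow]
                field_simp
              rw [this, ENNReal.ofReal_mul (by positivity), ENNReal.ofReal_pow (by positivity),
                ENNReal.ofReal_inv_of_pos two_pos]
              simp [mul_assoc]
    _ = 16 * maximal φ t := by
        rw [ENNReal.tsum_mul_right, ENNReal.tsum_geometric, ENNReal.one_sub_inv_two, inv_inv,
          ← mul_assoc]
        norm_num

/-- The radial maximal function of the Poisson integral of `F`. -/
def radialMax (F : Circ → ℂ) (t : Circ) : ℝ≥0∞ := ⨆ r ∈ Set.Ioo (0 : ℝ) 1, ‖pint r F t‖ₑ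

lemma enorm_pint_le {r : ℝ} (h0 : 0 ≤ r) (h1 : r < 1) (F : Circ → ℂ) (t : Circ) :
    ‖pint r F t‖ₑ ≤ ∫⁻ τ, ENNReal.ofReal (poisson r (t - τ)) * ‖F τ‖ₑ ∂arc := by
  refine (enorm_integral_le_lintegral_enorm _).trans (le_of_eq ?_)
  refine lintegral_congr fun τ => ?_
  rw [enorm_mul, ← ofReal_norm (_ : ℂ), Complex.norm_real,
    Real.norm_of_nonneg (poisson_nonneg h0 h1 _)]

lemma radialMax_le_maximal {F : Circ → ℂ} (hF : Continuous F) (t : Circ) :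
    radialMax F t ≤ 16 * maximal (fun τ => ‖F τ‖ₑ) t :=
  iSup₂_le fun _ hr => (enorm_pint_le hr.1.le hr.2 F t).trans
    (lintegral_poisson_le_maximal hr.1.le hr.2 hF.enorm.measurable t)

/-- Weak type `(1, 1)` of the radial maximal function on the circle. -/
lemma mul_arc_radialMax_le {F : Circ → ℂ} (hF : Continuous F) (c : ℝ≥0∞) :
    c * arc {t | c < radialMax F t} ≤ 80 * ∫⁻ τ, ‖F τ‖ₑ ∂arc := by
  have hsub : {t | c < radialMax F t} ⊆ {t | c / 16 < maximal (fun τ => ‖F τ‖ₑ) t} := by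
    intro t ht
    have := lt_of_lt_of_le ht (radialMax_le_maximal hF t)
    exact ENNReal.div_lt_of_lt_mul' this
  calc c * arc {t | c < radialMax F t}
      ≤ c * arc {t | c / 16 < maximal (fun τ => ‖F τ‖ₑ) t} := by gcongr
    _ = 16 * (c / 16 * arc {t | c / 16 < maximal (fun τ => ‖F τ‖ₑ) t}) := by
        rw [← mul_assoc, ENNReal.mul_div_cancel (by norm_num) (by norm_num)]
    _ ≤ 16 * (5 * ∫⁻ τ, ‖F τ‖ₑ ∂arc) := by
        gcongr 16 * ?_
        exact mul_arc_maximal_le _ _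
    _ = 80 * ∫⁻ τ, ‖F τ‖ₑ ∂arc := by rw [← mul_assoc]; norm_num

/-! ### The maximal theorem for analytic functions on the disc -/

lemma fourier_one_coe (y : ℝ) : fourier 1 (y : Circ) = Complex.exp (y * Complex.I) := by
  rw [fourier_coe_apply]
  congr 1
  have h1 : (Real.pi : ℂ) ≠ 0 := by exact_mod_cast Real.pi_ne_zero
  push_cast
  field_simp

lemma circleAverage_eq_integral_arc (f : ℂ → ℂ) :
    Real.circleAverage f 0 1 = ∫ τ : Circ, f (fourier 1 τ) ∂arc := by
  rw [Real.circleAverage_def, AddCircle.integral_haarAddCircle,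
    ← AddCircle.intervalIntegral_preimage _ 0, zero_add]
  congr 1
  refine intervalIntegral.integral_congr fun θ _ => ?_
  simp only [fourier_one_coe, circleMap, zero_add, Complex.ofReal_one, one_mul]

/-- The Poisson formula for functions analytic in the disc and continuous up to the boundary. -/
lemma pint_of_diffContOnCl {h : ℂ → ℂ} (hh : DiffContOnCl ℂ h (Metric.ball 0 1)) {r : ℝ}
    (h0 : 0 ≤ r) (h1 : r < 1) (t : Circ) :
    pint r (fun τ => h (fourier 1 τ)) t = h (r * fourier 1 t) := by
  have hw : (r : ℂ) * fourier 1 t ∈ Metric.ball (0 : ℂ) 1 := by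
    rwa [mem_ball_zero_iff, norm_mul_fourier h0]
  rw [← hh.circleAverage_poissonKernel_smul hw, circleAverage_eq_integral_arc, pint]
  refine integral_congr_ae (.of_forall fun τ => ?_)
  have e : ‖(fourier 1 τ : ℂ) - r * fourier 1 t‖ = ‖1 - (r : ℂ) * fourier 1 (t - τ)‖ := by
    have h2 : fourier 1 t = fourier 1 (t - τ) * fourier 1 τ := by
      rw [← fourier_add_arg, sub_add_cancel]
    rw [h2, ← mul_assoc, ← one_sub_mul, norm_mul, norm_fourier_apply, mul_one]
  simp only [Pi.smul_apply', poissonKernel_def, sub_zero, norm_mul_fourier h0, norm_fourier_apply,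
    e, poisson, Complex.real_smul, one_pow]

/-- On the closed disc `1 - b z` stays in the closed right half plane, where the principal square
root is continuous, including at a zero on the boundary. -/
lemma diffContOnCl_sqrt_one_sub {b : ℂ} (hb : ‖b‖ ≤ 1) :
    DiffContOnCl ℂ (fun z => (1 - b * z) ^ ((2 : ℕ) : ℂ)⁻¹) (Metric.ball 0 1) := by
  have hre : ∀ z : ℂ, (b * z).re ≤ ‖z‖ := fun z => (Complex.re_le_norm _).trans <| by
    rw [norm_mul]
    exact mul_le_of_le_one_left (norm_nonneg _) hb
  constructor
  · refine DifferentiableOn.cpow_const (by fun_prop) fun z hz => Or.inl ?_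
    have := hre z
    rw [mem_ball_zero_iff] at hz
    simp only [Complex.sub_re, Complex.one_re]
    linarith
  · rw [closure_ball _ one_ne_zero]
    intro z hz
    rw [mem_closedBall_zero_iff] at hz
    have h1 : ContinuousAt (fun x : ℂ => x ^ ((2 : ℕ) : ℂ)⁻¹) (1 - b * z) := by
      refine Complex.continuousAt_cpow_const_of_re_pos (Or.inl ?_) (by norm_num)
      have := hre z
      simp only [Complex.sub_re, Complex.one_re]
      linarith
    exact (ContinuousAt.comp (f := fun z : ℂ => 1 - b * z) h1
      (by fun_prop)).continuousWithinAt

/-- `h` is a square root of an outer majorant of `p`. -/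
def OuterSqrt (p h : ℂ → ℂ) : Prop :=
  DiffContOnCl ℂ h (Metric.ball 0 1) ∧ (∀ z, ‖z‖ ≤ 1 → ‖p z‖ ≤ ‖h z‖ ^ 2) ∧
    ∀ z, ‖z‖ = 1 → ‖p z‖ = ‖h z‖ ^ 2

lemma OuterSqrt.mul {p q h k : ℂ → ℂ} (hp : OuterSqrt p h) (hq : OuterSqrt q k) :
    OuterSqrt (fun z => p z * q z) (fun z => h z * k z) := by
  refine ⟨hp.1.smul hq.1, fun z hz => ?_, fun z hz => ?_⟩
  · rw [norm_mul, norm_mul, mul_pow]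
    exact mul_le_mul (hp.2.1 z hz) (hq.2.1 z hz) (norm_nonneg _) (by positivity)
  · rw [norm_mul, norm_mul, mul_pow, hp.2.2 z hz, hq.2.2 z hz]

lemma exists_outerSqrt_const (c : ℂ) : ∃ h, OuterSqrt (fun _ => c) h := by
  refine ⟨fun _ => c ^ ((2 : ℕ) : ℂ)⁻¹, diffContOnCl_const, fun z _ => ?_, fun z _ => ?_⟩ <;>
  rw [← norm_pow, Complex.cpow_nat_inv_pow c two_ne_zero]

/-- A root inside the disc is reflected: `1 - conj a * z` has no zero in the disc, the same modulus
on the circle and a larger modulus inside. A root with `‖a‖ ≥ 1` needs no reflection, since `z - a =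
-a (1 - a⁻¹ z)`. -/
lemma exists_outerSqrt_linear (a : ℂ) : ∃ h, OuterSqrt (fun z => z - a) h := by
  rcases lt_or_ge ‖a‖ 1 with ha | ha
  · have key : ∀ z : ℂ, ‖1 - (starRingEnd ℂ) a * z‖ ^ 2 - ‖z - a‖ ^ 2
        = (1 - ‖a‖ ^ 2) * (1 - ‖z‖ ^ 2) := by
      intro z
      simp only [← Complex.normSq_eq_norm_sq, Complex.normSq_apply, Complex.sub_re, Complex.sub_im,
        Complex.mul_re, Complex.mul_im, Complex.conj_re, Complex.conj_im, Complex.one_re,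
        Complex.one_im]
      ring
    refine ⟨_, diffContOnCl_sqrt_one_sub (b := (starRingEnd ℂ) a) (by
      rw [RCLike.norm_conj]; exact ha.le), fun z hz => ?_, fun z hz => ?_⟩
    · rw [← norm_pow, Complex.cpow_nat_inv_pow _ two_ne_zero]
      refine (pow_le_pow_iff_left₀ (norm_nonneg _) (norm_nonneg _) two_ne_zero).1 ?_
      have h1 : 0 ≤ (1 - ‖a‖ ^ 2) * (1 - ‖z‖ ^ 2) :=
        mul_nonneg (sub_nonneg.2 (pow_le_one₀ (norm_nonneg _) ha.le))
          (sub_nonneg.2 (pow_le_one₀ (norm_nonneg _) hz))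
      have := key z
      linarith
    · rw [← norm_pow, Complex.cpow_nat_inv_pow _ two_ne_zero]
      have := key z
      rw [hz, one_pow, sub_self, mul_zero, sub_eq_zero] at this
      exact ((pow_left_inj₀ (norm_nonneg _) (norm_nonneg _) two_ne_zero).1 this).symm
  · have ha0 : a ≠ 0 := norm_pos_iff.1 (by linarith)
    obtain ⟨k, hk⟩ := exists_outerSqrt_const (-a)
    have hl : OuterSqrt (fun z => 1 - a⁻¹ * z) (fun z => (1 - a⁻¹ * z) ^ ((2 : ℕ) : ℂ)⁻¹) := by
      refine ⟨diffContOnCl_sqrt_one_sub (by rw [norm_inv]; exact inv_le_one_of_one_le₀ ha),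
        fun z _ => ?_, fun z _ => ?_⟩ <;>
      rw [← norm_pow, Complex.cpow_nat_inv_pow _ two_ne_zero]
    have e : (fun z => z - a) = fun z => -a * (1 - a⁻¹ * z) := by
      funext z; field_simp; ring
    rw [e]
    exact ⟨_, hk.mul hl⟩

/-- The property is multiplicative, so the complete factorization over `ℂ` reduces it to linear
factors and a constant. This replaces the inner-outer factorization. -/
lemma exists_outerSqrt (p : Polynomial ℂ) : ∃ h, OuterSqrt (fun z => p.eval z) h := by
  have hroots : ∀ m : Multiset ℂ, ∃ h, OuterSqrt
      (fun z => ((m.map fun a => Polynomial.X - Polynomial.C a).prod).eval z) h := by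
    intro m
    induction m using Multiset.induction_on with
    | empty => simpa using exists_outerSqrt_const 1
    | cons a m ih =>
      obtain ⟨h, hh⟩ := ih
      obtain ⟨k, hk⟩ := exists_outerSqrt_linear a
      refine ⟨fun z => k z * h z, ?_⟩
      simpa using hk.mul hh
  obtain ⟨h, hh⟩ := hroots p.roots
  obtain ⟨k, hk⟩ := exists_outerSqrt_const p.leadingCoeff
  refine ⟨fun z => k z * h z, ?_⟩
  have := hk.mul hh
  rw [(IsAlgClosed.splits p).eq_prod_roots]
  simpa using this

/-- Subharmonicity of `|p|^{1/2}` for polynomials. -/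
lemma sqrt_norm_eval_le (p : Polynomial ℂ) {r : ℝ} (h0 : 0 ≤ r) (h1 : r < 1) (t : Circ) :
    ENNReal.ofReal √‖p.eval (r * fourier 1 t)‖ ≤ ∫⁻ τ, ENNReal.ofReal (poisson r (t - τ))
      * ENNReal.ofReal √‖p.eval (fourier 1 τ)‖ ∂arc := by
  obtain ⟨h, hd, hle, heq⟩ := exists_outerSqrt p
  have hb : ∀ τ : Circ, √‖p.eval (fourier 1 τ)‖ = ‖h (fourier 1 τ)‖ := fun τ => by
    rw [heq _ (norm_fourier_apply _ _), Real.sqrt_sq (norm_nonneg _)]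
  have hi : √‖p.eval (r * fourier 1 t)‖ ≤ ‖h (r * fourier 1 t)‖ := by
    rw [Real.sqrt_le_left (norm_nonneg _)]
    exact hle _ (by rw [norm_mul_fourier h0]; exact h1.le)
  refine (ENNReal.ofReal_le_ofReal hi).trans ?_
  -- The Poisson formula applies to the analytic majorant; equality of moduli on the circle then
  -- brings back the polynomial.
  rw [ofReal_norm, ← pint_of_diffContOnCl hd h0 h1 t]
  refine (enorm_pint_le h0 h1 _ t).trans (le_of_eq ?_)
  simp only [hb, ofReal_norm]

/-- Subharmonicity of `|F|^{1/2}` for absolutely convergent power series. -/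
lemma sqrt_norm_pint_le {ι : Type*} [Countable ι] {b : ι → ℂ} {k : ι → ℕ}
    (hb : Summable fun i => ‖b i‖) {F : Circ → ℂ}
    (hF : ∀ τ, HasSum (fun i => b i * fourier (k i : ℤ) τ) (F τ)) {r : ℝ} (h0 : 0 ≤ r)
    (h1 : r < 1) (t : Circ) :
    ENNReal.ofReal √‖pint r F t‖ ≤ ∫⁻ τ, ENNReal.ofReal (poisson r (t - τ))
      * ENNReal.ofReal √‖F τ‖ ∂arc := by
  let P : Finset ι → Polynomial ℂ := fun S => ∑ i ∈ S, Polynomial.monomial (k i) (b i)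
  have hP : ∀ S (τ : Circ), (P S).eval (fourier 1 τ : ℂ) = ∑ i ∈ S, b i * fourier (k i : ℤ) τ := by
    intro S τ
    simp only [P, Polynomial.eval_finsetSum, Polynomial.eval_monomial, fourier_natCast]
  have hPr : ∀ S, (P S).eval (r * fourier 1 t : ℂ)
      = ∑ i ∈ S, b i * ((r : ℂ) ^ (k i : ℤ).natAbs * fourier (k i : ℤ) t) := by
    intro S
    simp only [P, Polynomial.eval_finsetSum, Polynomial.eval_monomial, fourier_natCast, mul_pow,
      Int.natAbs_natCast]
  have hl : Tendsto (fun S => ENNReal.ofReal √‖(P S).eval (r * fourier 1 t : ℂ)‖) atTop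
      (𝓝 (ENNReal.ofReal √‖pint r F t‖)) := by
    have h2 : Tendsto (fun S => (P S).eval (r * fourier 1 t : ℂ)) atTop (𝓝 (pint r F t)) := by
      simp only [hPr]
      exact pint_hasSum h0 h1 hb hF t
    exact ENNReal.tendsto_ofReal ((Real.continuous_sqrt.tendsto _).comp h2.norm)
  have hpc : Continuous fun τ : Circ => poisson r (t - τ) :=
    (continuous_poisson h0 h1).comp (by fun_prop)
  have hr : Tendsto (fun S => ∫⁻ τ, ENNReal.ofReal (poisson r (t - τ))
      * ENNReal.ofReal √‖(P S).eval (fourier 1 τ : ℂ)‖ ∂arc) atTop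
      (𝓝 (∫⁻ τ, ENNReal.ofReal (poisson r (t - τ)) * ENNReal.ofReal √‖F τ‖ ∂arc)) := by
    refine tendsto_lintegral_filter_of_dominated_convergence (fun τ =>
      ENNReal.ofReal (poisson r (t - τ)) * ENNReal.ofReal √(∑' i, ‖b i‖)) ?_ ?_ ?_ ?_
    · refine .of_forall fun S => ?_
      refine Measurable.mul hpc.measurable.ennreal_ofReal
        (Measurable.ennreal_ofReal (Continuous.measurable ?_))
      exact Real.continuous_sqrt.comp
        ((Polynomial.continuous _).comp (fourier 1).continuous).norm
    · refine .of_forall fun S => .of_forall fun τ => ?_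
      gcongr
      rw [hP]
      refine (norm_sum_le _ _).trans ?_
      simp only [norm_mul, norm_fourier_apply, mul_one]
      exact hb.sum_le_tsum _ fun _ _ => norm_nonneg _
    · rw [lintegral_mul_const' _ _ ENNReal.ofReal_ne_top]
      refine ENNReal.mul_ne_top ?_ ENNReal.ofReal_ne_top
      exact (continuous_circ_integrable hpc).lintegral_lt_top.ne
    · refine .of_forall fun τ => ENNReal.Tendsto.const_mul ?_ (.inr ENNReal.ofReal_ne_top)
      refine ENNReal.tendsto_ofReal ((Real.continuous_sqrt.tendsto _).comp (Tendsto.norm ?_))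
      simp only [hP]
      exact hF τ
  exact le_of_tendsto_of_tendsto' hl hr fun S => sqrt_norm_eval_le (P S) h0 h1 t

/-! ### Semicontinuity and finiteness of the radial maximal function. -/

lemma continuous_pint {r : ℝ} (h0 : 0 ≤ r) (h1 : r < 1) {F : Circ → ℂ} (hF : Continuous F) :
    Continuous (pint r F) := by
  unfold pint
  have h := continuous_parametric_integral_of_continuous (μ := arc)
    (f := fun t τ : Circ => (poisson r (t - τ) : ℂ) * F τ) (by
      refine Continuous.mul (Complex.continuous_ofReal.comp
        ((continuous_poisson h0 h1).comp ?_)) (hF.comp continuous_snd)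
      exact continuous_fst.sub continuous_snd) isCompact_univ
  simpa only [Measure.restrict_univ] using h

lemma lowerSemicontinuous_radialMax {F : Circ → ℂ} (hF : Continuous F) :
    LowerSemicontinuous (radialMax F) :=
  lowerSemicontinuous_biSup fun _ hr =>
    (continuous_pint hr.1.le hr.2 hF).enorm.lowerSemicontinuous

lemma lintegral_poisson {r : ℝ} (h0 : 0 ≤ r) (h1 : r < 1) (t : Circ) :
    ∫⁻ τ, ENNReal.ofReal (poisson r (t - τ)) ∂arc = 1 := by
  rw [lintegral_sub_left_eq_self (μ := arc) (fun τ => ENNReal.ofReal (poisson r τ)) t,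
    ← ofReal_integral_eq_lintegral_ofReal (continuous_circ_integrable (continuous_poisson h0 h1))
      (.of_forall fun τ => poisson_nonneg h0 h1 τ), integral_poisson h0 h1, ENNReal.ofReal_one]

lemma radialMax_ne_top {F : Circ → ℂ} (hF : Continuous F) (t : Circ) : radialMax F t ≠ ∞ := by
  obtain ⟨B, hB⟩ := isCompact_univ.exists_bound_of_continuousOn (f := F) hF.continuousOn
  refine ne_top_of_le_ne_top (ENNReal.ofReal_ne_top (r := B)) (iSup₂_le fun r hr => ?_)
  refine (enorm_pint_le hr.1.le hr.2 F t).trans ?_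
  calc ∫⁻ τ, ENNReal.ofReal (poisson r (t - τ)) * ‖F τ‖ₑ ∂arc
      ≤ ∫⁻ τ, ENNReal.ofReal (poisson r (t - τ)) * ENNReal.ofReal B ∂arc := by
        gcongr with τ
        rw [← ofReal_norm]
        exact ENNReal.ofReal_le_ofReal (hB τ trivial)
    _ = ENNReal.ofReal B := by
        rw [lintegral_mul_const' _ _ ENNReal.ofReal_ne_top, lintegral_poisson hr.1.le hr.2, one_mul]

/-- The Hardy–Littlewood maximal theorem in `H¹` for absolutely convergent power series. -/
lemma lintegral_radialMax_le {ι : Type*} [Countable ι] {b : ι → ℂ} {k : ι → ℕ}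
    (hb : Summable fun i => ‖b i‖) {F : Circ → ℂ} (hFc : Continuous F)
    (hF : ∀ τ, HasSum (fun i => b i * fourier (k i : ℤ) τ) (F τ)) :
    ∫⁻ t, radialMax F t ∂arc ≤ 10240 * ∫⁻ t, ‖F t‖ₑ ∂arc := by
  have hm : Measurable (radialMax F) := (lowerSemicontinuous_radialMax hFc).measurable
  -- Subharmonicity bounds the square root of the radial maximal function by `16` times the maximal
  -- function of `√|F|`. Squaring gives `256`, and the `L²` constant `40` gives `10240`.
  have hle : ∀ t, ENNReal.ofReal (√(radialMax F t).toReal / 16)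
      ≤ maximal (fun τ => ENNReal.ofReal √‖F τ‖) t := by
    intro t
    rcases eq_or_ne (maximal (fun τ => ENNReal.ofReal √‖F τ‖) t) ∞ with h | h
    · rw [h]; exact le_top
    lift maximal (fun τ => ENNReal.ofReal √‖F τ‖) t to ℝ≥0 using h with M hM
    rw [← ENNReal.ofReal_coe_nnreal]
    refine ENNReal.ofReal_le_ofReal ?_
    rw [div_le_iff₀ (by norm_num), Real.sqrt_le_left (by positivity)]
    refine ENNReal.toReal_le_of_le_ofReal (by positivity) (iSup₂_le fun r hr => ?_)
    rw [← ofReal_norm]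
    refine ENNReal.ofReal_le_ofReal ((Real.sqrt_le_left (by positivity)).1 ?_)
    have h2 := (sqrt_norm_pint_le hb hF hr.1.le hr.2 t).trans
      (lintegral_poisson_le_maximal hr.1.le hr.2
        (Real.continuous_sqrt.comp hFc.norm).measurable.ennreal_ofReal t)
    simp only [Function.comp_apply] at h2
    rw [← hM, ← ENNReal.ofReal_coe_nnreal, ← ENNReal.ofReal_ofNat (n := 16),
      ← ENNReal.ofReal_mul (by norm_num), ENNReal.ofReal_le_ofReal_iff (by positivity)] at h2
    linarith
  have h := lintegral_sq_le_of_le_maximal (fun t => by positivity)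
    (hm.ennreal_toReal.sqrt.div_const 16) (fun t => Real.sqrt_nonneg ‖F t‖)
    (Real.continuous_sqrt.comp hFc.norm).measurable hle
  simp only [div_pow, Real.sq_sqrt ENNReal.toReal_nonneg, Real.sq_sqrt (norm_nonneg _),
    ofReal_norm] at h
  calc ∫⁻ t, radialMax F t ∂arc
      = ∫⁻ t, 256 * ENNReal.ofReal ((radialMax F t).toReal / 16 ^ 2) ∂arc := by
        refine lintegral_congr fun t => ?_
        rw [← ENNReal.ofReal_ofNat (n := 256), ← ENNReal.ofReal_mul (by norm_num)]
        have : 256 * ((radialMax F t).toReal / 16 ^ 2) = (radialMax F t).toReal := by ring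
        rw [this, ENNReal.ofReal_toReal (radialMax_ne_top hFc t)]
    _ = 256 * ∫⁻ t, ENNReal.ofReal ((radialMax F t).toReal / 16 ^ 2) ∂arc :=
        lintegral_const_mul' _ _ (by simp)
    _ ≤ 256 * (40 * ∫⁻ t, ‖F t‖ₑ ∂arc) := by gcongr
    _ = 10240 * ∫⁻ t, ‖F t‖ₑ ∂arc := by rw [← mul_assoc]; norm_num

/-! ### Exhausting the radial supremum -/

/-- A sequence of radii increasing to `1`. -/
def radius (n : ℕ) : ℝ := 1 - 1 / ((n : ℝ) + 2)

lemma radius_mem (n : ℕ) : radius n ∈ Set.Ioo (0 : ℝ) 1 := by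
  have h : 0 < 1 / ((n : ℝ) + 2) := by positivity
  have h2 : 1 / ((n : ℝ) + 2) < 1 := by
    rw [div_lt_one (by positivity)]; linarith [(Nat.cast_nonneg n : (0 : ℝ) ≤ n)]
  exact ⟨by unfold radius; linarith, by unfold radius; linarith⟩

lemma radius_mono : Monotone radius := by
  intro m n h
  have : 1 / ((n : ℝ) + 2) ≤ 1 / ((m : ℝ) + 2) := by gcongr
  unfold radius; linarith

lemma tendsto_radius : Tendsto radius atTop (𝓝 1) := by
  have h := (tendsto_one_div_add_atTop_nhds_zero_nat (𝕜 := ℝ)).comp (tendsto_add_atTop_nat 1)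
  have h2 := h.const_sub 1
  rw [sub_zero] at h2
  refine h2.congr fun n => ?_
  simp only [Function.comp_apply, radius]
  push_cast
  congr 2
  ring

lemma mul_mem_Ioo {s r : ℝ} (hs : s ∈ Set.Ioo (0 : ℝ) 1) (hr : r ∈ Set.Ioo (0 : ℝ) 1) :
    s * r ∈ Set.Ioo (0 : ℝ) 1 :=
  ⟨mul_pos hs.1 hr.1, by nlinarith [hs.1, hs.2, hr.1, hr.2]⟩

/-- A larger dilation factor reaches every earlier radius by rescaling `r` inside `(0, 1)`. Together
with `iSup_dilate` this reduces suprema to data continuous up to the boundary. -/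
lemma monotone_dilate (f : ℝ → ℝ≥0∞) :
    Monotone fun n => ⨆ r ∈ Set.Ioo (0 : ℝ) 1, f (radius n * r) := by
  intro m n h
  refine iSup₂_le fun r hr => ?_
  have hm := radius_mem m
  have hn := radius_mem n
  have e : radius m * r = radius n * (radius m / radius n * r) := by
    rw [← mul_assoc, mul_div_cancel₀ _ hn.1.ne']
  rw [e]
  refine le_iSup₂ (f := fun r (_ : r ∈ Set.Ioo (0 : ℝ) 1) => f (radius n * r)) _ ⟨?_, ?_⟩
  · exact mul_pos (div_pos hm.1 hn.1) hr.1
  · refine lt_of_le_of_lt (mul_le_of_le_one_left hr.1.le ?_) hr.2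
    exact (div_le_one hn.1).2 (radius_mono h)

lemma iSup_dilate (f : ℝ → ℝ≥0∞) :
    ⨆ r ∈ Set.Ioo (0 : ℝ) 1, f r = ⨆ n, ⨆ r ∈ Set.Ioo (0 : ℝ) 1, f (radius n * r) := by
  refine le_antisymm (iSup₂_le fun r hr => ?_) (iSup_le fun n => iSup₂_le fun r hr => ?_)
  · obtain ⟨n, hn⟩ := (tendsto_radius.eventually (lt_mem_nhds hr.2)).exists
    refine le_iSup_of_le n ?_
    have h := radius_mem n
    have e : f r = f (radius n * (r / radius n)) := by rw [mul_div_cancel₀ _ h.1.ne']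
    rw [e]
    exact le_iSup₂ (f := fun r (_ : r ∈ Set.Ioo (0 : ℝ) 1) => f (radius n * r)) _
      ⟨div_pos hr.1 h.1, (div_lt_one h.1).2 hn⟩
  · exact le_iSup₂ (f := fun r (_ : r ∈ Set.Ioo (0 : ℝ) 1) => f r) _ (mul_mem_Ioo (radius_mem n) hr)

lemma mul_measure_dilate_le {X : Type*} [MeasurableSpace X] (μ : Measure X) (f : ℝ → X → ℝ≥0∞)
    {c B : ℝ≥0∞} (h : ∀ s ∈ Set.Ioo (0 : ℝ) 1,
      c * μ {x | c < ⨆ r ∈ Set.Ioo (0 : ℝ) 1, f (s * r) x} ≤ B) :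
    c * μ {x | c < ⨆ r ∈ Set.Ioo (0 : ℝ) 1, f r x} ≤ B := by
  have e : {x | c < ⨆ r ∈ Set.Ioo (0 : ℝ) 1, f r x}
      = ⋃ n, {x | c < ⨆ r ∈ Set.Ioo (0 : ℝ) 1, f (radius n * r) x} := by
    ext x
    simp only [iSup_dilate (fun r => f r x), Set.mem_ofPred_eq, Set.mem_iUnion]
    exact lt_iSup_iff
  have hm : Monotone fun n => {x | c < ⨆ r ∈ Set.Ioo (0 : ℝ) 1, f (radius n * r) x} :=
    fun m n hmn x hx => lt_of_lt_of_le hx (monotone_dilate (fun r => f r x) hmn)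
  -- Continuity from below along increasing unions requires no measurability of the level sets.
  rw [e, hm.measure_iUnion, ENNReal.mul_iSup]
  exact iSup_le fun n => h _ (radius_mem n)

/-! ### Harmonic series on the disc -/

/-- The harmonic function `∑_n c_n r^{|n|} e^{int}` on the disc. -/
def ser (c : ℤ → ℂ) (r : ℝ) (t : Circ) : ℂ := ∑' n : ℤ, c n * ((r : ℂ) ^ n.natAbs * fourier n t)

lemma norm_ser_term {c : ℤ → ℂ} {A : ℝ} (hc : ∀ n, ‖c n‖ ≤ A) {r : ℝ} (h0 : 0 ≤ r) (n : ℤ)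
    (t : Circ) : ‖c n * ((r : ℂ) ^ n.natAbs * fourier n t)‖ ≤ A * r ^ n.natAbs := by
  rw [norm_mul, norm_mul, norm_fourier_apply, mul_one, norm_pow, Complex.norm_real,
    Real.norm_of_nonneg h0]
  exact mul_le_mul_of_nonneg_right (hc n) (by positivity)

lemma hasSum_ser {c : ℤ → ℂ} {A : ℝ} (hc : ∀ n, ‖c n‖ ≤ A) {r : ℝ} (h0 : 0 ≤ r) (h1 : r < 1)
    (t : Circ) : HasSum (fun n : ℤ => c n * ((r : ℂ) ^ n.natAbs * fourier n t)) (ser c r t) :=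
  (Summable.of_norm_bounded ((hasSum_pow_natAbs h0 h1).summable.mul_left A)
    fun n => norm_ser_term hc h0 n t).hasSum

lemma summable_ser_coeff {c : ℤ → ℂ} {A : ℝ} (hc : ∀ n, ‖c n‖ ≤ A) {r : ℝ} (h0 : 0 ≤ r)
    (h1 : r < 1) : Summable fun n : ℤ => ‖c n * (r : ℂ) ^ n.natAbs‖ := by
  refine .of_nonneg_of_le (fun _ => norm_nonneg _) (fun n => ?_)
    ((hasSum_pow_natAbs h0 h1).summable.mul_left A)
  simpa using norm_ser_term hc h0 n 0

lemma continuous_ser {c : ℤ → ℂ} {A : ℝ} (hc : ∀ n, ‖c n‖ ≤ A) {r : ℝ} (h0 : 0 ≤ r)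
    (h1 : r < 1) : Continuous (ser c r) :=
  continuous_tsum (fun n => by fun_prop) ((hasSum_pow_natAbs h0 h1).summable.mul_left A)
    fun n t => norm_ser_term hc h0 n t

lemma ser_mul {c : ℤ → ℂ} {A : ℝ} (hc : ∀ n, ‖c n‖ ≤ A) {s r : ℝ} (hs0 : 0 ≤ s) (hs1 : s < 1)
    (h0 : 0 ≤ r) (h1 : r < 1) (t : Circ) : ser c (s * r) t = pint r (ser c s) t := by
  have h := pint_hasSum h0 h1 (summable_ser_coeff hc hs0 hs1) (k := fun n => n) (F := ser c s)
    (fun τ => by simpa only [mul_assoc] using hasSum_ser hc hs0 hs1 τ) t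
  rw [← h.tsum_eq, ser]
  refine tsum_congr fun n => ?_
  push_cast
  rw [mul_pow]
  ring

lemma mul_arc_iSup_ser_le {c : ℤ → ℂ} {A : ℝ} (hc : ∀ n, ‖c n‖ ≤ A) {B : ℝ≥0∞}
    (hB : ∀ s ∈ Set.Ioo (0 : ℝ) 1, ∫⁻ t, ‖ser c s t‖ₑ ∂arc ≤ B) (b : ℝ≥0∞) :
    b * arc {t | b < ⨆ r ∈ Set.Ioo (0 : ℝ) 1, ‖ser c r t‖ₑ} ≤ 80 * B := by
  refine mul_measure_dilate_le arc (fun r t => ‖ser c r t‖ₑ) fun s hs => ?_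
  refine le_trans (le_of_eq ?_) ((mul_arc_radialMax_le
    (continuous_ser hc hs.1.le hs.2) b).trans (by gcongr; exact hB s hs))
  congr 2
  ext t
  simp only [Set.mem_ofPred_eq, radialMax]
  have : (⨆ r ∈ Set.Ioo (0 : ℝ) 1, ‖ser c (s * r) t‖ₑ)
      = ⨆ r ∈ Set.Ioo (0 : ℝ) 1, ‖pint r (ser c s) t‖ₑ :=
    iSup_congr fun r => iSup_congr fun hr => by rw [ser_mul hc hs.1.le hs.2 hr.1.le hr.2]
  rw [this]

/-! ### Parseval's identity -/

lemma hasSum_sq_fourierCoeff_of_continuous {F : Circ → ℂ} (hF : Continuous F) :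
    HasSum (fun n => ‖fourierCoeff F n‖ ^ 2) (∫ t, ‖F t‖ ^ 2 ∂arc) := by
  have hm : MemLp F 2 arc := by
    obtain ⟨B, hB⟩ := isCompact_univ.exists_bound_of_continuousOn (f := F) hF.continuousOn
    exact MemLp.of_bound hF.aestronglyMeasurable B (.of_forall fun t => hB t trivial)
  have h := hasSum_sq_fourierCoeff (hm.toLp F)
  rw [fourierCoeff_congr_ae hm.coeFn_toLp] at h
  convert h using 1
  exact integral_congr_ae (hm.coeFn_toLp.mono fun t ht => by simp only [ht])

lemma fourierCoeff_of_hasSum {b : ℤ → ℂ} (hb : Summable fun n => ‖b n‖) {F : Circ → ℂ}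
    (hF : ∀ τ, HasSum (fun n => b n * fourier n τ) (F τ)) (m : ℤ) : fourierCoeff F m = b m := by
  have hint := hasSum_integral_of_summable_integral_norm (μ := arc)
    (F := fun (n : ℤ) τ => b n * fourier (n + -m) τ)
    (fun n => continuous_circ_integrable (by fun_prop)) (by
      simpa only [norm_mul, norm_fourier_apply, mul_one, integral_const, probReal_univ,
        smul_eq_mul, one_mul] using hb)
  have e : ∀ τ, ∑' n, b n * fourier (n + -m) τ = fourier (-m) τ • F τ := by
    intro τ
    simp only [fourier_add, ← mul_assoc]
    rw [((hF τ).mul_right _).tsum_eq, smul_eq_mul, mul_comm]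
  simp only [e, integral_const_mul, integral_fourier] at hint
  refine hint.unique ?_
  have h2 := hasSum_single (f := fun n : ℤ => b n * if n + -m = 0 then 1 else 0) m
    fun n hn => by rw [if_neg (by omega), mul_zero]
  simpa using h2

lemma sq_integral_norm_le {F : Circ → ℂ} (hF : Continuous F) :
    (∫ t, ‖F t‖ ∂arc) ^ 2 ≤ ∫ t, ‖F t‖ ^ 2 ∂arc := by
  set m := ∫ t, ‖F t‖ ∂arc
  have h1 : Integrable (fun t => ‖F t‖) arc := continuous_circ_integrable hF.norm
  have h2 : Integrable (fun t => ‖F t‖ ^ 2) arc := continuous_circ_integrable (hF.norm.pow 2)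
  have h : 0 ≤ ∫ t, (‖F t‖ - m) ^ 2 ∂arc := integral_nonneg fun t => sq_nonneg _
  have e : ∀ t, (‖F t‖ - m) ^ 2 = ‖F t‖ ^ 2 - 2 * m * ‖F t‖ + m ^ 2 := fun t => by ring
  simp only [e] at h
  have h3 : Integrable (fun t => ‖F t‖ ^ 2 - 2 * m * ‖F t‖) arc := h2.sub (h1.const_mul _)
  rw [integral_add h3 (integrable_const _), integral_sub h2 (h1.const_mul _),
    integral_const_mul] at h
  simp only [integral_const, probReal_univ, smul_eq_mul, one_mul] at h
  change 0 ≤ _ - 2 * m * m + m ^ 2 at h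
  linarith

/-- Cauchy–Schwarz on a probability space and Parseval; the factors `s ^ |n|` only decrease the
coefficients. -/
lemma lintegral_ser_le {c : ℤ → ℂ} (hc : Summable fun n => ‖c n‖ ^ 2) {A : ℝ}
    (hA : ∀ n, ‖c n‖ ≤ A) {s : ℝ} (h0 : 0 ≤ s) (h1 : s < 1) :
    ∫⁻ t, ‖ser c s t‖ₑ ∂arc ≤ ENNReal.ofReal √(∑' n, ‖c n‖ ^ 2) := by
  have hcont := continuous_ser hA h0 h1
  rw [← ofReal_integral_norm_eq_lintegral_enorm (continuous_circ_integrable hcont)]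
  refine ENNReal.ofReal_le_ofReal (Real.le_sqrt_of_sq_le ((sq_integral_norm_le hcont).trans ?_))
  rw [← (hasSum_sq_fourierCoeff_of_continuous hcont).tsum_eq]
  have e : ∀ n, fourierCoeff (ser c s) n = c n * (s : ℂ) ^ n.natAbs :=
    fourierCoeff_of_hasSum (summable_ser_coeff hA h0 h1)
      (fun τ => by simpa only [mul_assoc] using hasSum_ser hA h0 h1 τ)
  have hle : ∀ n, ‖fourierCoeff (ser c s) n‖ ^ 2 ≤ ‖c n‖ ^ 2 := by
    intro n
    rw [e, norm_mul, norm_pow, Complex.norm_real, Real.norm_of_nonneg h0]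
    exact pow_le_pow_left₀ (by positivity)
      (mul_le_of_le_one_right (norm_nonneg _) (pow_le_one₀ h0 h1.le)) 2
  exact (hasSum_sq_fourierCoeff_of_continuous hcont).summable.tsum_le_tsum hle hc

/-! ### Radial limits -/

/-- The function `g` of the radius has a limit at `1`. -/
def HasRadialLimit (g : ℝ → ℂ) : Prop := ∃ L, Tendsto g (𝓝[<] 1) (𝓝 L)

lemma Ioo_mem_nhdsLT_one : Set.Ioo (0 : ℝ) 1 ∈ 𝓝[<] (1 : ℝ) := Ioo_mem_nhdsLT one_pos

lemma hasRadialLimit_of_approx {g : ℝ → ℂ} (h : ∀ ε > 0, ∃ g₁ : ℝ → ℂ, HasRadialLimit g₁ ∧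
    ∀ r ∈ Set.Ioo (0 : ℝ) 1, ‖g r - g₁ r‖ ≤ ε) : HasRadialLimit g := by
  refine cauchy_map_iff_exists_tendsto.1 (Metric.cauchy_iff.2 ⟨inferInstance, fun ε hε => ?_⟩)
  obtain ⟨g₁, ⟨L, hL⟩, h1⟩ := h (ε / 5) (by positivity)
  refine ⟨g '' {r | r ∈ Set.Ioo (0 : ℝ) 1 ∧ dist (g₁ r) L < ε / 5}, image_mem_map
    (Filter.inter_mem Ioo_mem_nhdsLT_one (hL (Metric.ball_mem_nhds L (by positivity)))), ?_⟩
  rintro _ ⟨r, ⟨hr1, hr2⟩, rfl⟩ _ ⟨r', ⟨hr1', hr2'⟩, rfl⟩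
  have a := h1 r hr1
  have b := h1 r' hr1'
  rw [← dist_eq_norm] at a b
  have := dist_triangle4 (g r) (g₁ r) (g₁ r') (g r')
  have h3 := dist_triangle_right (g₁ r) (g₁ r') L
  rw [dist_comm (g₁ r') (g r')] at this
  linarith

/-- Finite sums clearly have limits, and the weak type inequality makes the maximal function of the
tail small off a set of small measure. Almost every point thus admits uniform approximation in the
radius by finite sums. -/
lemma ae_hasRadialLimit_of_summable_sq {c : ℤ → ℂ} (hc : Summable fun n => ‖c n‖ ^ 2) :
    ∀ᵐ t ∂arc, HasRadialLimit fun r => ser c r t := by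
  have hA : ∀ n, ‖c n‖ ≤ √(∑' n, ‖c n‖ ^ 2) := fun n =>
    Real.le_sqrt_of_sq_le (hc.le_tsum n fun _ _ => by positivity)
  set A := √(∑' n, ‖c n‖ ^ 2)
  have hA0 : 0 ≤ A := Real.sqrt_nonneg _
  let tail : Finset ℤ → ℤ → ℂ := fun S n => if n ∈ S then 0 else c n
  have htA : ∀ S n, ‖tail S n‖ ≤ A := fun S n => by
    simp only [tail]; split_ifs <;> simp [hA0, hA]
  have hsplit : ∀ (S : Finset ℤ) (t : Circ), ∀ r ∈ Set.Ioo (0 : ℝ) 1, ser c r t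
      = ∑ n ∈ S, c n * ((r : ℂ) ^ n.natAbs * fourier n t) + ser (tail S) r t := by
    intro S t r hr
    have h1 := hasSum_ser (htA S) hr.1.le hr.2 t
    have h2 : HasSum (fun n => (if n ∈ S then c n * ((r : ℂ) ^ n.natAbs * fourier n t) else 0))
        (∑ n ∈ S, c n * ((r : ℂ) ^ n.natAbs * fourier n t)) := by
      rw [← Finset.sum_congr rfl fun n hn =>
        if_pos (c := n ∈ S) (e := (0 : ℂ)) hn]
      exact hasSum_sum_of_ne_finset_zero fun n hn => if_neg hn
    refine (hasSum_ser hA hr.1.le hr.2 t).unique ?_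
    convert h2.add h1 using 1
    funext n
    simp only [tail]
    split_ifs <;> simp
  have htail : Tendsto (fun S : Finset ℤ => √(∑' n, ‖tail S n‖ ^ 2)) atTop (𝓝 0) := by
    have h1 := tendsto_tsum_compl_atTop_zero (fun n : ℤ => ‖c n‖ ^ 2)
    rw [← Real.sqrt_zero]
    refine (Real.continuous_sqrt.tendsto 0).comp (h1.congr fun S => ?_)
    refine (tsum_subtype {n | n ∉ S} (fun n => ‖c n‖ ^ 2)).trans (tsum_congr fun n => ?_)
    by_cases h : n ∈ S <;> simp [tail, Set.indicator, h]
  have htsum : ∀ S, Summable fun n => ‖tail S n‖ ^ 2 := fun S => by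
    refine .of_nonneg_of_le (fun n => by positivity) (fun n => ?_) hc
    simp only [tail]
    split_ifs
    · simp
    · exact le_rfl
  have hae : ∀ m : ℕ, ∀ᵐ t ∂arc, ∃ S, ⨆ r ∈ Set.Ioo (0 : ℝ) 1, ‖ser (tail S) r t‖ₑ
      ≤ ENNReal.ofReal (1 / ((m : ℝ) + 1)) := by
    intro m
    set ε := ENNReal.ofReal (1 / ((m : ℝ) + 1)) with hε
    have hε0 : ε ≠ 0 := by rw [hε]; simp; positivity
    -- The bad set does not depend on the outer `S`, so its measure is below bounds that tend to
    -- zero along finite sets.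
    have hb : ∀ S, arc {t | ¬ ∃ S, ⨆ r ∈ Set.Ioo (0 : ℝ) 1, ‖ser (tail S) r t‖ₑ ≤ ε}
        ≤ 80 * ENNReal.ofReal √(∑' n, ‖tail S n‖ ^ 2) / ε := by
      intro S
      rw [ENNReal.le_div_iff_mul_le (.inl hε0) (.inl ENNReal.ofReal_ne_top), mul_comm]
      refine le_trans ?_ (mul_arc_iSup_ser_le (htA S) (fun s hs =>
        lintegral_ser_le (htsum S) (htA S) hs.1.le hs.2) ε)
      gcongr with t
      intro h
      push Not at h
      exact h S
    have hlim := ENNReal.Tendsto.div_const (ENNReal.Tendsto.const_mul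
      (ENNReal.tendsto_ofReal htail) (.inr (by norm_num : (80 : ℝ≥0∞) ≠ ∞))) (.inr hε0)
    simp only [ENNReal.ofReal_zero, mul_zero, ENNReal.zero_div] at hlim
    exact le_antisymm (ge_of_tendsto' hlim hb) zero_le
  filter_upwards [ae_all_iff.2 hae] with t ht
  refine hasRadialLimit_of_approx fun ε hε => ?_
  obtain ⟨m, hm⟩ := exists_nat_one_div_lt hε
  obtain ⟨S, hS⟩ := ht m
  refine ⟨fun r => ∑ n ∈ S, c n * ((r : ℂ) ^ n.natAbs * fourier n t), ?_, fun r hr => ?_⟩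
  · refine ⟨_, Continuous.continuousWithinAt (f := fun r : ℝ =>
      ∑ n ∈ S, c n * ((r : ℂ) ^ n.natAbs * fourier n t)) ?_⟩
    fun_prop
  · rw [hsplit S t r hr, add_sub_cancel_left]
    have h1 := (le_iSup₂ (f := fun r (_ : r ∈ Set.Ioo (0 : ℝ) 1) => ‖ser (tail S) r t‖ₑ) r hr).trans
      hS
    rw [← ofReal_norm, ENNReal.ofReal_le_ofReal_iff (by positivity)] at h1
    linarith

/-- Fatou's theorem for bounded analytic functions. -/
lemma ae_hasRadialLimit_of_bounded {G : ℂ → ℂ} (hG : DifferentiableOn ℂ G (Metric.ball 0 1))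
    (hG1 : ∀ z ∈ Metric.ball (0 : ℂ) 1, ‖G z‖ ≤ 1) :
    ∀ᵐ t : Circ ∂arc, HasRadialLimit fun r => G (r * fourier 1 t) := by
  let a : ℕ → ℂ := fun n => (n.factorial : ℂ)⁻¹ * iteratedDeriv n G 0
  let c : ℤ → ℂ := fun n => if 0 ≤ n then a n.toNat else 0
  have hsum : ∀ z ∈ Metric.ball (0 : ℂ) 1, HasSum (fun n : ℕ => a n * z ^ n) (G z) := by
    intro z hz
    have e : ∀ n : ℕ, a n * z ^ n
        = (n.factorial : ℂ)⁻¹ • (z - 0) ^ n • iteratedDeriv n G 0 := fun n => by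
      simp only [a, sub_zero, smul_eq_mul]; ring
    simpa only [e] using Complex.hasSum_taylorSeries_on_ball (r := 1) (by simpa using hG)
      (by simpa using hz)
  have hmem : ∀ r : ℝ, 0 ≤ r → r < 1 → ∀ t : Circ, (r : ℂ) * fourier 1 t ∈ Metric.ball (0 : ℂ) 1 :=
    fun r h0 h1 t => by rwa [mem_ball_zero_iff, norm_mul_fourier h0]
  have hZ : ∀ r : ℝ, 0 ≤ r → r < 1 → ∀ t : Circ,
      HasSum (fun n : ℤ => c n * (r : ℂ) ^ n.natAbs * fourier n t) (G (r * fourier 1 t)) := by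
    intro r h0 h1 t
    rw [← Function.Injective.hasSum_iff (g := ((↑) : ℕ → ℤ)) Nat.cast_injective]
    · convert hsum _ (hmem r h0 h1 t) using 2 with n
      simp only [c, Function.comp_apply, Nat.cast_nonneg, if_true, Int.toNat_natCast,
        Int.natAbs_natCast, fourier_natCast, mul_pow, mul_assoc]
    · intro n hn
      have : ¬ 0 ≤ n := fun h => hn ⟨n.toNat, Int.toNat_of_nonneg h⟩
      simp [c, this]
  have habs : ∀ r : ℝ, 0 ≤ r → r < 1 → Summable fun n : ℤ => ‖c n * (r : ℂ) ^ n.natAbs‖ := by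
    intro r h0 h1
    have := (hZ r h0 h1 0).summable.norm
    simpa only [norm_mul _ (fourier _ _), norm_fourier_apply, mul_one] using this
  have hpars : ∀ (S : Finset ℤ) (r : ℝ), r ∈ Set.Ioo (0 : ℝ) 1 →
      ∑ n ∈ S, ‖c n * (r : ℂ) ^ n.natAbs‖ ^ 2 ≤ 1 := by
    intro S r hr
    have hcont : Continuous fun t : Circ => G (r * fourier 1 t) :=
      hG.continuousOn.comp_continuous (by fun_prop) (hmem r hr.1.le hr.2)
    have h := hasSum_sq_fourierCoeff_of_continuous hcont
    simp only [fourierCoeff_of_hasSum (habs r hr.1.le hr.2) (hZ r hr.1.le hr.2)] at h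
    refine (sum_le_hasSum S (fun _ _ => by positivity) h).trans ?_
    calc ∫ t : Circ, ‖G (r * fourier 1 t)‖ ^ 2 ∂arc ≤ ∫ t : Circ, 1 ∂arc :=
          integral_mono (continuous_circ_integrable (hcont.norm.pow 2)) (integrable_const _)
            fun t => pow_le_one₀ (norm_nonneg _) (hG1 _ (hmem r hr.1.le hr.2 t))
      _ = 1 := by simp
  -- Parseval on each circle bounds finite partial sums by `1`; letting the radius tend to `1`
  -- bounds the sums of the coefficients themselves.
  have hc : Summable fun n => ‖c n‖ ^ 2 := by
    refine summable_of_sum_le (c := 1) (fun n => by positivity) fun S => ?_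
    have hl : Tendsto (fun r : ℝ => ∑ n ∈ S, ‖c n * (r : ℂ) ^ n.natAbs‖ ^ 2) (𝓝[<] 1)
        (𝓝 (∑ n ∈ S, ‖c n * ((1 : ℝ) : ℂ) ^ n.natAbs‖ ^ 2)) :=
      Continuous.continuousWithinAt (f := fun r : ℝ => ∑ n ∈ S, ‖c n * (r : ℂ) ^ n.natAbs‖ ^ 2)
        (by fun_prop)
    simp only [Complex.ofReal_one, one_pow, mul_one] at hl
    exact le_of_tendsto hl (Filter.mem_of_superset Ioo_mem_nhdsLT_one fun r hr => hpars S r hr)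
  filter_upwards [ae_hasRadialLimit_of_summable_sq hc] with t ht
  obtain ⟨L, hL⟩ := ht
  refine ⟨L, hL.congr' (Filter.mem_of_superset Ioo_mem_nhdsLT_one fun r hr => ?_)⟩
  change ser c r t = G (r * fourier 1 t)
  rw [← (hZ r hr.1.le hr.2 t).tsum_eq, ser]
  simp only [mul_assoc]

/-! ### Fatou's theorem on the circle -/

lemma ae_ne_top_of_weak_type {X : Type*} [MeasurableSpace X] {μ : Measure X} {M : X → ℝ≥0∞}
    {K : ℝ≥0∞} (hK : K ≠ ∞) (h : ∀ b : ℝ≥0∞, b * μ {x | b < M x} ≤ K) : ∀ᵐ x ∂μ, M x ≠ ∞ := by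
  rw [ae_iff]
  by_contra hne
  obtain ⟨n, hn⟩ := ENNReal.exists_nat_mul_gt hne hK
  refine absurd (hn.trans_le (le_trans ?_ (h n))) (lt_irrefl _)
  gcongr with x
  intro hx
  simp only [not_not] at hx
  simp [hx]

/-- The analytic function with real part `∑_n c_n r^{|n|} e^{int}`. -/
def analyticCompletion (c : ℤ → ℂ) (z : ℂ) : ℂ := ∑' n : ℕ, 2 * c n * z ^ n - c 0

lemma norm_completion_term {c : ℤ → ℂ} {A : ℝ} (hc : ∀ n, ‖c n‖ ≤ A) {ρ : ℝ} {z : ℂ}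
    (hz : ‖z‖ ≤ ρ) (n : ℕ) : ‖2 * c n * z ^ n‖ ≤ 2 * A * ρ ^ n := by
  rw [norm_mul, norm_mul, norm_pow, Complex.norm_two]
  have hA : 0 ≤ A := (norm_nonneg _).trans (hc 0)
  gcongr
  exact hc n

lemma differentiableOn_completion {c : ℤ → ℂ} {A : ℝ} (hc : ∀ n, ‖c n‖ ≤ A) :
    DifferentiableOn ℂ (analyticCompletion c) (Metric.ball 0 1) := by
  refine DifferentiableOn.sub_const ?_ _
  intro z hz
  rw [mem_ball_zero_iff] at hz
  obtain ⟨ρ, hρ, hρ1⟩ := exists_between hz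
  have hρ0 : 0 ≤ ρ := (norm_nonneg z).trans hρ.le
  have h := Complex.differentiableOn_tsum_of_summable_norm (U := Metric.ball (0 : ℂ) ρ)
    (F := fun (n : ℕ) z => 2 * c n * z ^ n)
    ((summable_geometric_of_lt_one hρ0 hρ1).mul_left (2 * A)) (fun n => by fun_prop)
    Metric.isOpen_ball fun n w hw => norm_completion_term hc (mem_ball_zero_iff.1 hw).le n
  exact (h.differentiableAt (Metric.isOpen_ball.mem_nhds
    (mem_ball_zero_iff.2 hρ))).differentiableWithinAt

lemma ser_eq_re_completion {c : ℤ → ℂ} {A : ℝ} (hc : ∀ n, ‖c n‖ ≤ A)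
    (hconj : ∀ n, c (-n) = (starRingEnd ℂ) (c n)) {r : ℝ} (h0 : 0 ≤ r) (h1 : r < 1) (t : Circ) :
    ser c r t = ((analyticCompletion c (r * fourier 1 t)).re : ℂ) := by
  set z := (r : ℂ) * fourier 1 t with hz
  have hzn : ‖z‖ = r := norm_mul_fourier h0 1 t
  have hs : HasSum (fun n : ℕ => 2 * c n * z ^ n) (analyticCompletion c z + c 0) := by
    have : Summable fun n : ℕ => 2 * c n * z ^ n :=
      .of_norm_bounded ((summable_geometric_of_lt_one h0 h1).mul_left (2 * A))
        fun n => norm_completion_term hc hzn.le n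
    rw [analyticCompletion, sub_add_cancel]
    exact this.hasSum
  have h := (hasSum_ser hc h0 h1 t).nat_add_neg
  have hre := Complex.hasSum_ofReal.2 (Complex.hasSum_re hs)
  have hc0 : ((c 0).re : ℂ) = c 0 := Complex.conj_eq_iff_re.1 (by simpa using (hconj 0).symm)
  have e : ∀ n : ℕ, c n * ((r : ℂ) ^ (n : ℤ).natAbs * fourier n t)
      + c (-n) * ((r : ℂ) ^ (-(n : ℤ)).natAbs * fourier (-n) t) = ((2 * c n * z ^ n).re : ℂ) := by
    intro n
    rw [Int.natAbs_neg, Int.natAbs_natCast, hconj, fourier_neg, fourier_natCast, hz, mul_pow,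
      mul_assoc 2, ← Complex.conj_ofReal r, ← map_pow, ← map_mul, ← map_mul, map_pow,
      Complex.conj_ofReal, Complex.add_conj]
    simp
  have h2 := h.unique (by simpa only [e] using hre)
  simp only [Int.natAbs_zero, pow_zero, fourier_zero, mul_one, Complex.add_re,
    Complex.ofReal_add, hc0] at h2
  exact add_right_cancel h2

/-- The series is the real part of an analytic `F`, and `exp (-F)` is bounded by one. Its radial
limit is nonzero wherever the radial maximal function is finite, so the logarithm of its modulus
recovers the limit of `Re F`. -/
lemma ae_hasRadialLimit_of_nonneg {c : ℤ → ℂ} {A : ℝ} (hc : ∀ n, ‖c n‖ ≤ A)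
    (hconj : ∀ n, c (-n) = (starRingEnd ℂ) (c n))
    (hpos : ∀ r ∈ Set.Ioo (0 : ℝ) 1, ∀ t, 0 ≤ (ser c r t).re) :
    ∀ᵐ t ∂arc, HasRadialLimit fun r => ser c r t := by
  set F := analyticCompletion c
  have hser : ∀ r ∈ Set.Ioo (0 : ℝ) 1, ∀ t, ser c r t = ((F (r * fourier 1 t)).re : ℂ) :=
    fun r hr t => ser_eq_re_completion hc hconj hr.1.le hr.2 t
  have hFpos : ∀ r ∈ Set.Ioo (0 : ℝ) 1, ∀ t : Circ, 0 ≤ (F (r * fourier 1 t)).re :=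
    fun r hr t => by simpa [hser r hr t] using hpos r hr t
  -- For a nonnegative function the `L¹` norm is the mean, which is the coefficient `c 0` at every
  -- radius.
  have hL1 : ∀ s ∈ Set.Ioo (0 : ℝ) 1, ∫⁻ t, ‖ser c s t‖ₑ ∂arc ≤ ENNReal.ofReal A := by
    intro s hs
    have hcont := continuous_ser hc hs.1.le hs.2
    rw [← ofReal_integral_norm_eq_lintegral_enorm (continuous_circ_integrable hcont)]
    refine ENNReal.ofReal_le_ofReal (le_trans (le_of_eq ?_) ((Complex.re_le_norm _).trans (hc 0)))
    have hmean := fourierCoeff_of_hasSum (summable_ser_coeff hc hs.1.le hs.2)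
      (fun τ => by simpa only [mul_assoc] using hasSum_ser hc hs.1.le hs.2 τ) 0
    simp only [fourierCoeff, neg_zero, fourier_zero, one_smul, Int.natAbs_zero, pow_zero,
      mul_one] at hmean
    rw [← hmean]
    have hre : ∀ t, ‖ser c s t‖ = RCLike.re (ser c s t) := fun t => by
      rw [hser s hs t, Complex.norm_real, Real.norm_of_nonneg (hFpos s hs t)]; simp
    simp only [hre]
    exact integral_re (continuous_circ_integrable hcont)
  have hbdd := ae_ne_top_of_weak_type (ENNReal.mul_ne_top (by norm_num) ENNReal.ofReal_ne_top)
    (mul_arc_iSup_ser_le hc hL1)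
  have hball : ∀ z ∈ Metric.ball (0 : ℂ) 1, z ≠ 0 →
      ∃ r ∈ Set.Ioo (0 : ℝ) 1, ∃ t : Circ, z = r * fourier 1 t := by
    intro z hz hz0
    refine ⟨‖z‖, ⟨norm_pos_iff.2 hz0, mem_ball_zero_iff.1 hz⟩, (z.arg : ℝ), ?_⟩
    rw [fourier_one_coe, Complex.norm_mul_exp_arg_mul_I]
  have hG := ae_hasRadialLimit_of_bounded (G := fun z => Complex.exp (-F z))
    (differentiableOn_completion hc).neg.cexp ?_
  · filter_upwards [hG, hbdd] with t ⟨l, hl⟩ hM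
    set M := (⨆ r ∈ Set.Ioo (0 : ℝ) 1, ‖ser c r t‖ₑ).toReal
    have hle : ∀ r ∈ Set.Ioo (0 : ℝ) 1, (F (r * fourier 1 t)).re ≤ M := by
      intro r hr
      have h := ENNReal.toReal_mono hM
        (le_iSup₂ (f := fun r (_ : r ∈ Set.Ioo (0 : ℝ) 1) => ‖ser c r t‖ₑ) r hr)
      rw [toReal_enorm, hser r hr t, Complex.norm_real] at h
      exact (le_abs_self _).trans h
    have hn := hl.norm
    simp only [Complex.norm_exp, Complex.neg_re] at hn
    have hl0 : Real.exp (-M) ≤ ‖l‖ := ge_of_tendsto hn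
      (Filter.mem_of_superset Ioo_mem_nhdsLT_one fun r hr =>
        Real.exp_le_exp.2 (neg_le_neg (hle r hr)))
    have hlog := (hn.log ((Real.exp_pos _).trans_le hl0).ne').neg
    simp only [Real.log_exp, neg_neg] at hlog
    exact ⟨_, ((Complex.continuous_ofReal.tendsto _).comp hlog).congr'
      (Filter.mem_of_superset Ioo_mem_nhdsLT_one fun r hr => (hser r hr t).symm)⟩
  · intro z hz
    rw [Complex.norm_exp, Real.exp_le_one_iff, Complex.neg_re, neg_nonpos]
    -- Positivity is known only for radii in the open interval, so the centre is reached by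
    -- continuity.
    by_cases hz0 : z = 0
    · subst hz0
      have hcont : ContinuousWithinAt (fun r : ℝ => (F (r * fourier 1 (0 : Circ))).re)
          (Set.Ici 0) 0 := by
        have hd := ((differentiableOn_completion hc).differentiableAt
          (Metric.isOpen_ball.mem_nhds hz)).continuousAt
        refine (Complex.continuous_re.continuousAt.comp
          (ContinuousAt.comp (g := F) (f := fun r : ℝ => (r : ℂ) * fourier 1 (0 : Circ))
            (by simpa using hd) (by fun_prop))).continuousWithinAt
      have h := hcont.mono Set.Ioi_subset_Ici_self
      have := ge_of_tendsto (b := 0) h.tendsto (Filter.mem_of_superset (Ioo_mem_nhdsGT one_pos)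
        fun r hr => hFpos r hr 0)
      simpa using this
    · obtain ⟨r, hr, t, rfl⟩ := hball z hz hz0
      exact hFpos r hr t

lemma norm_fourierCoeff_le (F : Circ → ℂ) (n : ℤ) : ‖fourierCoeff F n‖ ≤ ∫ t, ‖F t‖ ∂arc := by
  refine (norm_integral_le_integral_norm _).trans (le_of_eq ?_)
  simp only [norm_smul, norm_fourier_apply, one_mul]

lemma hasSum_pint {r : ℝ} (h0 : 0 ≤ r) (h1 : r < 1) {F : Circ → ℂ} (hF : Continuous F) (t : Circ) :
    HasSum (fun n : ℤ => fourierCoeff F n * ((r : ℂ) ^ n.natAbs * fourier n t)) (pint r F t) := by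
  have hs : ∀ τ, HasSum (fun n : ℤ => (r : ℂ) ^ n.natAbs * fourier n (t - τ) * F τ)
      ((poisson r (t - τ) : ℂ) * F τ) := fun τ => (hasSum_poisson h0 h1 _).mul_right _
  have hint := hasSum_integral_of_summable_integral_norm (μ := arc)
    (F := fun (n : ℤ) τ => (r : ℂ) ^ n.natAbs * fourier n (t - τ) * F τ)
    (fun n => continuous_circ_integrable (by fun_prop)) (by
      simp only [norm_mul, norm_fourier_apply, norm_pow, Complex.norm_real,
        Real.norm_of_nonneg h0, mul_one, integral_const_mul]
      exact (hasSum_pow_natAbs h0 h1).summable.mul_right _)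
  simp only [(hs _).tsum_eq] at hint
  refine hint.congr_fun fun n => ?_
  rw [fourierCoeff, ← integral_mul_const]
  refine integral_congr_ae (.of_forall fun τ => ?_)
  have : fourier n (-τ) = fourier (-n) τ := by simp [fourier_apply]
  simp only [smul_eq_mul, sub_eq_add_neg, fourier_add_arg, this]
  ring

/-- Compactness of a countable product of discs yields a subsequence along which all Fourier
coefficients converge; this plays the role of weak-* compactness of measures, and dominated
convergence carries it to the Poisson integrals. -/
lemma exists_subseq_tendsto_ser {w : ℕ → Circ → ℂ} (hw : ∀ k, Continuous (w k)) {A : ℝ}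
    (hA : ∀ k, ∫ t, ‖w k t‖ ∂arc ≤ A) :
    ∃ φ : ℕ → ℕ, StrictMono φ ∧ ∃ c : ℤ → ℂ, (∀ n, ‖c n‖ ≤ A) ∧
      (∀ n, Tendsto (fun k => fourierCoeff (w (φ k)) n) atTop (𝓝 (c n))) ∧
      ∀ r ∈ Set.Ioo (0 : ℝ) 1, ∀ t,
        Tendsto (fun k => pint r (w (φ k)) t) atTop (𝓝 (ser c r t)) := by
  have hb : ∀ k n, ‖fourierCoeff (w k) n‖ ≤ A := fun k n => (norm_fourierCoeff_le _ _).trans (hA k)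
  obtain ⟨c, hcmem, φ, hφ, hlim⟩ := (isCompact_univ_pi fun _ : ℤ =>
    isCompact_closedBall (0 : ℂ) A).tendsto_subseq (x := fun k n => fourierCoeff (w k) n)
    fun k n _ => mem_closedBall_zero_iff.2 (hb k n)
  have hlim' : ∀ n, Tendsto (fun k => fourierCoeff (w (φ k)) n) atTop (𝓝 (c n)) :=
    tendsto_pi_nhds.1 hlim
  refine ⟨φ, hφ, c, fun n => mem_closedBall_zero_iff.1 (hcmem n trivial), hlim', ?_⟩
  intro r hr t
  have h := tendsto_tsum_of_dominated_convergence
    ((hasSum_pow_natAbs hr.1.le hr.2).summable.mul_left A)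
    (f := fun k (n : ℤ) => fourierCoeff (w (φ k)) n * ((r : ℂ) ^ n.natAbs * fourier n t))
    (fun n => (hlim' n).mul_const _)
    (.of_forall fun k n => norm_ser_term (hb (φ k)) hr.1.le n t)
  exact h.congr fun k => (hasSum_pint hr.1.le hr.2 (hw _) t).tsum_eq

lemma fourierCoeff_ofReal_neg (w : Circ → ℝ) (n : ℤ) :
    fourierCoeff (fun t => (w t : ℂ)) (-n)
      = (starRingEnd ℂ) (fourierCoeff (fun t => (w t : ℂ)) n) := by
  rw [fourierCoeff, fourierCoeff, ← integral_conj]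
  simp

lemma pint_ofReal (r : ℝ) (w : Circ → ℝ) (t : Circ) :
    pint r (fun τ => (w τ : ℂ)) t = ((∫ τ, poisson r (t - τ) * w τ ∂arc : ℝ) : ℂ) := by
  rw [pint, ← integral_complex_ofReal]
  simp

lemma exists_subseq_tendsto_radial {w : ℕ → Circ → ℝ} (hw : ∀ k, Continuous (w k))
    (hpos : ∀ k t, 0 ≤ w k t) {A : ℝ} (hA : ∀ k, ∫ t, w k t ∂arc ≤ A) :
    ∃ φ : ℕ → ℕ, StrictMono φ ∧ ∃ v : ℝ → Circ → ℂ,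
      (∀ r ∈ Set.Ioo (0 : ℝ) 1, ∀ t,
        Tendsto (fun k => pint r (fun τ => (w (φ k) τ : ℂ)) t) atTop (𝓝 (v r t))) ∧
      ∀ᵐ t ∂arc, HasRadialLimit fun r => v r t := by
  obtain ⟨φ, hφ, c, hc, hlim, hser⟩ := exists_subseq_tendsto_ser
    (w := fun k t => (w k t : ℂ)) (A := A) (fun k => by have := hw k; fun_prop) (fun k => by
      simpa only [Complex.norm_real, Real.norm_of_nonneg (hpos _ _)] using hA k)
  refine ⟨φ, hφ, ser c, hser, ae_hasRadialLimit_of_nonneg hc (fun n => ?_) fun r hr t => ?_⟩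
  · refine tendsto_nhds_unique (hlim (-n)) ?_
    simp only [fourierCoeff_ofReal_neg]
    exact (Complex.continuous_conj.tendsto _).comp (hlim n)
  · refine ge_of_tendsto' ((Complex.continuous_re.tendsto _).comp (hser r hr t)) fun k => ?_
    rw [Function.comp_apply, pint_ofReal, Complex.ofReal_re]
    exact integral_nonneg fun τ => mul_nonneg (poisson_nonneg hr.1.le hr.2 _) (hpos _ _)

lemma HasRadialLimit.sub {f g : ℝ → ℂ} (hf : HasRadialLimit f) (hg : HasRadialLimit g) :
    HasRadialLimit fun r => f r - g r :=
  let ⟨_, h⟩ := hf; let ⟨_, h'⟩ := hg; ⟨_, h.sub h'⟩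

lemma HasRadialLimit.congr {f g : ℝ → ℂ} (hf : HasRadialLimit f)
    (h : ∀ r ∈ Set.Ioo (0 : ℝ) 1, f r = g r) : HasRadialLimit g :=
  let ⟨_, h'⟩ := hf; ⟨_, h'.congr' (Filter.mem_of_superset Ioo_mem_nhdsLT_one h)⟩

/-- Positive and negative parts of the approximants have limits along successive subsequences. The
difference of the two limits must be `V`, so the nonnegative case applies twice. -/
lemma ae_hasRadialLimit_of_tendsto_real {g : ℕ → Circ → ℝ} (hg : ∀ k, Continuous (g k)) {A : ℝ}
    (hA : ∀ k, ∫ t, |g k t| ∂arc ≤ A) {V : ℝ → Circ → ℂ}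
    (hV : ∀ r ∈ Set.Ioo (0 : ℝ) 1, ∀ t,
      Tendsto (fun k => pint r (fun τ => (g k τ : ℂ)) t) atTop (𝓝 (V r t))) :
    ∀ᵐ t ∂arc, HasRadialLimit fun r => V r t := by
  have hint : ∀ k, Integrable (fun t => |g k t|) arc := fun k =>
    continuous_circ_integrable (hg k).abs
  have hp : ∀ k, Continuous fun t => max (g k t) 0 := fun k => (hg k).max continuous_const
  have hn : ∀ k, Continuous fun t => max (-g k t) 0 := fun k => (hg k).neg.max continuous_const
  obtain ⟨φ, hφ, v, hv, hvl⟩ := exists_subseq_tendsto_radial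
    (w := fun k t => max (g k t) 0) hp (fun k t => le_max_right _ _)
    (fun k => (integral_mono (continuous_circ_integrable (hp k)) (hint k)
      fun t => max_le (le_abs_self _) (abs_nonneg _)).trans (hA k))
  obtain ⟨ψ, hψ, v', hv', hvl'⟩ := exists_subseq_tendsto_radial
    (w := fun k t => max (-g (φ k) t) 0) (fun k => hn _) (fun k t => le_max_right _ _)
    (fun k => (integral_mono (continuous_circ_integrable (hn _)) (hint _)
      fun t => max_le (neg_le_abs _) (abs_nonneg _)).trans (hA (φ k)))
  filter_upwards [hvl, hvl'] with t h h'
  refine (h.sub h').congr fun r hr => ?_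
  refine tendsto_nhds_unique ((((hv r hr t).comp hψ.tendsto_atTop)).sub (hv' r hr t))
    (((hV r hr t).comp (hφ.comp hψ).tendsto_atTop).congr fun k => ?_)
  have hi : ∀ {w : Circ → ℝ}, Continuous w →
      Integrable (fun τ => poisson r (t - τ) * w τ) arc := fun hw =>
    continuous_circ_integrable (((continuous_poisson hr.1.le hr.2).comp
      (continuous_const.sub continuous_id)).mul hw)
  simp only [Function.comp_apply, pint_ofReal]
  rw [← Complex.ofReal_sub, ← integral_sub (hi (hp _)) (hi (hn _))]
  congr 2
  funext τ
  rw [← mul_sub]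
  congr 1
  rcases le_total 0 (g (φ (ψ k)) τ) with h | h
  · rw [max_eq_left h, max_eq_right (by linarith), sub_zero]
  · rw [max_eq_right h, max_eq_left (by linarith)]; ring

/-- Fatou's theorem for harmonic functions bounded in mean on a sequence of circles. -/
lemma ae_hasRadialLimit_of_bounded_mean {U : ℝ → Circ → ℂ}
    (hmul : ∀ s ∈ Set.Ioo (0 : ℝ) 1, ∀ r ∈ Set.Ioo (0 : ℝ) 1, ∀ t, U (s * r) t = pint r (U s) t)
    (hcont : ∀ s ∈ Set.Ioo (0 : ℝ) 1, Continuous (U s))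
    (hrad : ∀ t, ContinuousOn (fun r => U r t) (Set.Ioo 0 1))
    {s : ℕ → ℝ} (hs : ∀ k, s k ∈ Set.Ioo (0 : ℝ) 1) (hs1 : Tendsto s atTop (𝓝 1)) {B : ℝ≥0∞}
    (hB : B ≠ ∞) (hle : ∀ k, ∫⁻ t, ‖U (s k) t‖ₑ ∂arc ≤ B) :
    ∀ᵐ t ∂arc, HasRadialLimit fun r => U r t := by
  -- The Poisson integral of `U (s k)` at radius `r` is `U (s k * r)`, and `U` is continuous in the
  -- radius.
  have hlim : ∀ r ∈ Set.Ioo (0 : ℝ) 1, ∀ t,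
      Tendsto (fun k => pint r (U (s k)) t) atTop (𝓝 (U r t)) := by
    intro r hr t
    have h1 : Tendsto (fun k => s k * r) atTop (𝓝 r) := by simpa using hs1.mul_const r
    exact (((hrad t).continuousAt (Ioo_mem_nhds hr.1 hr.2)).tendsto.comp h1).congr fun k =>
      hmul _ (hs k) r hr t
  have hbd : ∀ k, ∫ t, ‖U (s k) t‖ ∂arc ≤ B.toReal := by
    intro k
    rw [integral_norm_eq_lintegral_enorm (hcont _ (hs k)).aestronglyMeasurable]
    exact ENNReal.toReal_mono hB (hle k)
  have hnorm : ∀ k, Integrable (fun t => ‖U (s k) t‖) arc := fun k =>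
    continuous_circ_integrable (hcont _ (hs k)).norm
  have hpi : ∀ r ∈ Set.Ioo (0 : ℝ) 1, ∀ k t,
      Integrable (fun τ => (poisson r (t - τ) : ℂ) * U (s k) τ) arc := fun r hr k t =>
    continuous_circ_integrable ((Complex.continuous_ofReal.comp
      ((continuous_poisson hr.1.le hr.2).comp (continuous_const.sub continuous_id))).mul
      (hcont _ (hs k)))
  have hre := ae_hasRadialLimit_of_tendsto_real (g := fun k t => (U (s k) t).re)
    (V := fun r t => ((U r t).re : ℂ)) (A := B.toReal)
    (fun k => Complex.continuous_re.comp (hcont _ (hs k)))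
    (fun k => (integral_mono (continuous_circ_integrable
      (Complex.continuous_re.comp (hcont _ (hs k))).abs) (hnorm k)
      fun t => Complex.abs_re_le_norm _).trans (hbd k)) fun r hr t => by
      refine ((Complex.continuous_ofReal.comp Complex.continuous_re).tendsto _ |>.comp
        (hlim r hr t)).congr fun k => ?_
      simp only [Function.comp_apply, pint_ofReal]
      congr 1
      refine (integral_re (hpi r hr k t)).symm.trans (integral_congr_ae (.of_forall fun τ => ?_))
      simp
  have him := ae_hasRadialLimit_of_tendsto_real (g := fun k t => (U (s k) t).im)
    (V := fun r t => ((U r t).im : ℂ)) (A := B.toReal)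
    (fun k => Complex.continuous_im.comp (hcont _ (hs k)))
    (fun k => (integral_mono (continuous_circ_integrable
      (Complex.continuous_im.comp (hcont _ (hs k))).abs) (hnorm k)
      fun t => Complex.abs_im_le_norm _).trans (hbd k)) fun r hr t => by
      refine ((Complex.continuous_ofReal.comp Complex.continuous_im).tendsto _ |>.comp
        (hlim r hr t)).congr fun k => ?_
      simp only [Function.comp_apply, pint_ofReal]
      congr 1
      refine (integral_im (hpi r hr k t)).symm.trans (integral_congr_ae (.of_forall fun τ => ?_))
      simp
  filter_upwards [hre, him] with t ⟨a, ha⟩ ⟨b, hb⟩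
  refine ⟨a + b * Complex.I, (ha.add (hb.mul_const Complex.I)).congr fun r => ?_⟩
  exact Complex.re_add_im _

/-! ### Transference along the Kronecker flow -/

lemma lintegral_flow {Φ : Torus → ℝ≥0∞} (hΦ : Measurable Φ) :
    ∫⁻ θ, ∫⁻ t, Φ (flow t θ) ∂arc ∂haar = ∫⁻ θ, Φ θ ∂haar := by
  rw [lintegral_lintegral_swap]
  · simp only [(measurePreserving_flow _).lintegral_comp hΦ, lintegral_const, measure_univ, mul_one]
  · exact (hΦ.comp (continuous_flow.comp continuous_swap).measurable).aemeasurable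

lemma lintegral_arc_flow {E : Set Torus} (hE : MeasurableSet E) :
    ∫⁻ θ, arc {t | flow t θ ∈ E} ∂haar = haar E := by
  rw [← lintegral_indicator_one hE, ← lintegral_flow (measurable_one.indicator hE)]
  refine lintegral_congr fun θ => ?_
  have hm : MeasurableSet {t | flow t θ ∈ E} :=
    (continuous_flow.comp (continuous_id.prodMk continuous_const)).measurable hE
  rw [← lintegral_indicator_one hm]
  rfl

lemma ae_of_ae_flow {E : Set Torus} (hE : MeasurableSet E)
    (h : ∀ᵐ θ ∂haar, ∀ᵐ t ∂arc, flow t θ ∈ E) : ∀ᵐ θ ∂haar, θ ∈ E := by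
  rw [ae_iff]
  change haar Eᶜ = 0
  rw [← lintegral_arc_flow hE.compl]
  refine (lintegral_congr_ae (g := fun _ => 0) (h.mono fun θ hθ => ?_)).trans (by simp)
  exact ae_iff.1 hθ

lemma twist_of_nonneg {ν : ℕ →₀ ℤ} (h : ∀ j, 0 ≤ ν j) : twist ν = weight ν := by
  rw [twist, weight, Finsupp.sum, Finsupp.sum]
  push_cast
  refine Finset.sum_congr rfl fun j _ => ?_
  rw [abs_of_nonneg (h j)]

/-- Without mixed signs there is no cancellation. This is where the spectral hypothesis enters: it
makes the damping by `weight` agree with Poisson damping in the flow variable. -/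
lemma natAbs_twist {ν : ℕ →₀ ℤ} (h : (∀ j, 0 ≤ ν j) ∨ ∀ j, ν j ≤ 0) :
    (twist ν).natAbs = weight ν := by
  rcases h with h | h
  · rw [twist_of_nonneg h, Int.natAbs_natCast]
  · have e : twist ν = -(weight ν : ℤ) := by
      rw [twist, weight, Finsupp.sum, Finsupp.sum]
      push_cast
      rw [← Finset.sum_neg_distrib]
      refine Finset.sum_congr rfl fun j _ => ?_
      rw [abs_of_nonpos (h j)]
      ring
    rw [e, Int.natAbs_neg, Int.natAbs_natCast]

lemma AnalyticSpectrum.harmonicSpectrum {a : (ℕ →₀ ℤ) → ℂ} (h : AnalyticSpectrum a) :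
    HarmonicSpectrum a := fun ν hν => Or.inl (h ν hν)

section Extension

variable {a : (ℕ →₀ ℤ) → ℂ} {A : ℝ}

lemma summable_orbit_coeff (ha : CoeffBound a A) {s : ℝ} (h0 : 0 ≤ s) (h1 : s < 1) (θ : Torus) :
    Summable fun ν => ‖a ν * (s : ℂ) ^ weight ν * char ν θ‖ :=
  .of_nonneg_of_le (fun _ => norm_nonneg _) (fun ν => norm_extension_term ha h0 ν θ)
    ((summable_pow_weight h0 h1).mul_left A)

lemma hasSum_orbit (ha : CoeffBound a A) {s : ℝ} (h0 : 0 ≤ s) (h1 : s < 1) (θ : Torus) (t : Circ) :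
    HasSum (fun ν => a ν * (s : ℂ) ^ weight ν * char ν θ * fourier (twist ν) t)
      (extension a s (flow t θ)) := by
  have h := (summable_extension ha h0 h1 (flow t θ)).hasSum
  rw [← extension_ofReal h0] at h
  simpa only [char_flow, mul_assoc] using h

lemma continuous_orbit (ha : CoeffBound a A) {s : ℝ} (h0 : 0 ≤ s) (h1 : s < 1) (θ : Torus) :
    Continuous fun t : Circ => extension a s (flow t θ) :=
  (continuous_extension ha h0 h1).comp
    (continuous_flow.comp (continuous_id.prodMk continuous_const))

/-- Along each orbit of the flow, the radial extension is the Poisson integral. -/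
lemma extension_mul_flow (ha : CoeffBound a A) (hspec : HarmonicSpectrum a) {s r : ℝ}
    (hs : s ∈ Set.Ioo (0 : ℝ) 1) (hr : r ∈ Set.Ioo (0 : ℝ) 1) (θ : Torus) (t : Circ) :
    extension a ((s * r : ℝ) : ℂ) (flow t θ) = pint r (fun τ => extension a s (flow τ θ)) t := by
  refine (hasSum_orbit ha (mul_mem_Ioo hs hr).1.le (mul_mem_Ioo hs hr).2 θ t).unique ?_
  refine (pint_hasSum hr.1.le hr.2 (summable_orbit_coeff ha hs.1.le hs.2 θ)
    (hasSum_orbit ha hs.1.le hs.2 θ) t).congr_fun fun ν => ?_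
  -- The spectral condition says nothing about frequencies with vanishing coefficient, whose terms
  -- are zero on both sides.
  by_cases h : a ν = 0
  · simp [h]
  · rw [natAbs_twist (hspec ν h)]
    push_cast
    rw [mul_pow]
    ring

lemma radialMax_orbit (ha : CoeffBound a A) (hspec : HarmonicSpectrum a) {s : ℝ}
    (hs : s ∈ Set.Ioo (0 : ℝ) 1) (θ : Torus) (t : Circ) :
    radialMax (fun τ => extension a s (flow τ θ)) t
      = ⨆ r ∈ Set.Ioo (0 : ℝ) 1, ‖extension a ((s * r : ℝ) : ℂ) (flow t θ)‖ₑ :=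
  iSup_congr fun r => iSup_congr fun hr => by rw [extension_mul_flow ha hspec hs hr]

lemma lowerSemicontinuous_dilate (ha : CoeffBound a A) {s : ℝ} (hs : s ∈ Set.Ioo (0 : ℝ) 1) :
    LowerSemicontinuous fun θ =>
      ⨆ r ∈ Set.Ioo (0 : ℝ) 1, ‖extension a ((s * r : ℝ) : ℂ) θ‖ₑ :=
  lowerSemicontinuous_biSup fun _ hr => (continuous_extension ha (mul_mem_Ioo hs hr).1.le
    (mul_mem_Ioo hs hr).2).enorm.lowerSemicontinuous

lemma lintegral_orbit (ha : CoeffBound a A) {s : ℝ} (hs : s ∈ Set.Ioo (0 : ℝ) 1) :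
    ∫⁻ θ, ∫⁻ t, ‖extension a s (flow t θ)‖ₑ ∂arc ∂haar = normOne (extension a s) :=
  lintegral_flow (continuous_extension ha hs.1.le hs.2).enorm.measurable

lemma mul_haar_maximal_le (ha : CoeffBound a A) (hspec : HarmonicSpectrum a) {B : ℝ≥0∞}
    (hB : ∀ s ∈ Set.Ioo (0 : ℝ) 1, normOne (extension a (s : ℂ)) ≤ B) (c : ℝ≥0∞) :
    c * haar {θ | c < ⨆ r ∈ Set.Ioo (0 : ℝ) 1, ‖extension a (r : ℂ) θ‖ₑ} ≤ 80 * B := by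
  refine mul_measure_dilate_le haar (fun r θ => ‖extension a (r : ℂ) θ‖ₑ) fun s hs => ?_
  set E := {θ | c < ⨆ r ∈ Set.Ioo (0 : ℝ) 1, ‖extension a ((s * r : ℝ) : ℂ) θ‖ₑ}
  have hE : MeasurableSet E := ((lowerSemicontinuous_dilate ha hs).isOpen_preimage c).measurableSet
  change c * haar E ≤ 80 * B
  rw [← lintegral_arc_flow hE]
  calc c * ∫⁻ θ, arc {t | flow t θ ∈ E} ∂haar
      ≤ ∫⁻ θ, c * arc {t | flow t θ ∈ E} ∂haar := lintegral_const_mul_le _ _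
    _ ≤ ∫⁻ θ, 80 * ∫⁻ t, ‖extension a s (flow t θ)‖ₑ ∂arc ∂haar := by
        refine lintegral_mono fun θ => ?_
        refine le_trans (le_of_eq ?_) (mul_arc_radialMax_le (continuous_orbit ha hs.1.le hs.2 θ) c)
        simp only [radialMax_orbit ha hspec hs, E, Set.mem_ofPred_eq]
    _ = 80 * normOne (extension a s) := by
        rw [lintegral_const_mul' _ _ (by norm_num), lintegral_orbit ha hs]
    _ ≤ 80 * B := by gcongr; exact hB s hs

/-- For an analytic spectrum each orbit function is a power series in `e^{it}`, so the `H¹` theorem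
on the circle applies orbit by orbit; monotone convergence removes the dilation. -/
lemma lintegral_maximal_le (ha : CoeffBound a A) (hspec : AnalyticSpectrum a) {B : ℝ≥0∞}
    (hB : ∀ s ∈ Set.Ioo (0 : ℝ) 1, normOne (extension a (s : ℂ)) ≤ B) :
    ∫⁻ θ, ⨆ r ∈ Set.Ioo (0 : ℝ) 1, ‖extension a (r : ℂ) θ‖ₑ ∂haar ≤ 10240 * B := by
  have e : ∀ θ, ⨆ r ∈ Set.Ioo (0 : ℝ) 1, ‖extension a (r : ℂ) θ‖ₑ
      = ⨆ n, ⨆ r ∈ Set.Ioo (0 : ℝ) 1, ‖extension a ((radius n * r : ℝ) : ℂ) θ‖ₑ := fun θ =>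
    iSup_dilate fun r => ‖extension a (r : ℂ) θ‖ₑ
  simp only [e]
  rw [lintegral_iSup (fun n => (lowerSemicontinuous_dilate ha (radius_mem n)).measurable)
    fun m n hmn θ => monotone_dilate (fun r => ‖extension a (r : ℂ) θ‖ₑ) hmn]
  refine iSup_le fun n => ?_
  have hs := radius_mem n
  rw [← lintegral_flow (lowerSemicontinuous_dilate ha hs).measurable]
  calc ∫⁻ θ, ∫⁻ t, ⨆ r ∈ Set.Ioo (0 : ℝ) 1,
        ‖extension a ((radius n * r : ℝ) : ℂ) (flow t θ)‖ₑ ∂arc ∂haar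
      ≤ ∫⁻ θ, 10240 * ∫⁻ t, ‖extension a (radius n) (flow t θ)‖ₑ ∂arc ∂haar := by
        refine lintegral_mono fun θ => ?_
        simp only [← radialMax_orbit ha hspec.harmonicSpectrum hs]
        refine lintegral_radialMax_le (k := weight) (summable_orbit_coeff ha hs.1.le hs.2 θ)
          (continuous_orbit ha hs.1.le hs.2 θ) fun τ => ?_
        refine (hasSum_orbit ha hs.1.le hs.2 θ τ).congr_fun fun ν => ?_
        by_cases h : a ν = 0
        · simp [h]
        · rw [twist_of_nonneg (hspec ν h)]
    _ = 10240 * normOne (extension a (radius n)) := by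
        rw [lintegral_const_mul' _ _ (by norm_num), lintegral_orbit ha hs]
    _ ≤ 10240 * B := by gcongr; exact hB _ hs

/-! ### Measurability and existence of radial limits on the torus. -/

lemma hasRadialLimit_iff {g : ℝ → ℂ} : HasRadialLimit g ↔ ∀ m : ℕ, ∃ n : ℕ,
    ∀ r ∈ Set.Ioo (radius n) 1, ∀ s ∈ Set.Ioo (radius n) 1,
      dist (g r) (g s) ≤ 1 / ((m : ℝ) + 1) := by
  constructor
  · rintro ⟨L, hL⟩ m
    obtain ⟨l, hl, hsub⟩ := (mem_nhdsLT_iff_exists_Ioo_subset' (zero_lt_one (α := ℝ))).1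
      (hL (Metric.ball_mem_nhds L (show (0 : ℝ) < 1 / ((m : ℝ) + 1) / 2 by positivity)))
    obtain ⟨n, hn⟩ := (tendsto_radius.eventually (lt_mem_nhds hl)).exists
    refine ⟨n, fun r hr s hs => ?_⟩
    have h1 : dist (g r) L < 1 / ((m : ℝ) + 1) / 2 := hsub ⟨hn.trans hr.1, hr.2⟩
    have h2 : dist (g s) L < 1 / ((m : ℝ) + 1) / 2 := hsub ⟨hn.trans hs.1, hs.2⟩
    linarith [dist_triangle_right (g r) (g s) L]
  · intro h
    refine cauchy_map_iff_exists_tendsto.1 (Metric.cauchy_iff.2 ⟨inferInstance, fun ε hε => ?_⟩)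
    obtain ⟨m, hm⟩ := exists_nat_one_div_lt hε
    obtain ⟨n, hn⟩ := h m
    refine ⟨g '' Set.Ioo (radius n) 1, image_mem_map (Ioo_mem_nhdsLT (radius_mem n).2), ?_⟩
    rintro _ ⟨r, hr, rfl⟩ _ ⟨s, hs, rfl⟩
    exact (hn r hr s hs).trans_lt hm

/-- The Cauchy criterion with countably many thresholds and weak inequalities presents the set
through countable operations on closed sets; measurability is needed to pass from orbits to the
torus. -/
lemma measurableSet_hasRadialLimit (ha : CoeffBound a A) :
    MeasurableSet {θ | HasRadialLimit fun r => extension a (r : ℂ) θ} := by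
  simp only [hasRadialLimit_iff, Set.ofPred_forall, Set.ofPred_exists]
  refine MeasurableSet.iInter fun m => MeasurableSet.iUnion fun n => IsClosed.measurableSet ?_
  refine isClosed_iInter fun r => isClosed_iInter fun hr => isClosed_iInter fun s =>
    isClosed_iInter fun hs => ?_
  have hn := radius_mem n
  exact isClosed_le ((continuous_extension ha (hn.1.trans hr.1).le hr.2).dist
    (continuous_extension ha (hn.1.trans hs.1).le hs.2)) continuous_const

lemma ae_hasRadialLimit_extension (ha : CoeffBound a A) (hspec : HarmonicSpectrum a) {B : ℝ≥0∞}
    (hBtop : B ≠ ∞) (hB : ∀ s ∈ Set.Ioo (0 : ℝ) 1, normOne (extension a (s : ℂ)) ≤ B) :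
    ∀ᵐ θ ∂haar, HasRadialLimit fun r => extension a (r : ℂ) θ := by
  refine ae_of_ae_flow (measurableSet_hasRadialLimit ha) ?_
  let Φ : ℕ → Torus → ℝ≥0∞ := fun k θ => ∫⁻ t, ‖extension a (radius k) (flow t θ)‖ₑ ∂arc
  have hΦ : ∀ k, Measurable (Φ k) := fun k => Measurable.lintegral_prod_right'
    (f := fun p : Torus × Circ => ‖extension a (radius k) (flow p.2 p.1)‖ₑ)
    (((continuous_extension ha (radius_mem k).1.le (radius_mem k).2).comp
      (continuous_flow.comp continuous_swap)).enorm.measurable)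
  -- The orbit means have bounded integral over the torus, so Fatou's lemma makes their lower limit
  -- finite on almost every orbit. Bounded means along a subsequence of radii are then available
  -- there.
  have hfin : ∫⁻ θ, liminf (fun k => Φ k θ) atTop ∂haar ≠ ∞ := by
    refine ne_top_of_le_ne_top hBtop ((lintegral_liminf_le hΦ).trans ?_)
    refine liminf_le_of_le (by isBoundedDefault) fun b hb => ?_
    obtain ⟨k, hk⟩ := hb.exists
    exact hk.trans ((lintegral_orbit ha (radius_mem k)).le.trans (hB _ (radius_mem k)))
  filter_upwards [ae_lt_top (Measurable.liminf hΦ) hfin] with θ hθ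
  obtain ⟨b, hb, hbtop⟩ := exists_between hθ
  obtain ⟨φ, hφ, hlt⟩ := extraction_of_frequently_atTop (frequently_lt_of_liminf_lt
    (by isBoundedDefault) hb)
  exact ae_hasRadialLimit_of_bounded_mean (U := fun r t => extension a (r : ℂ) (flow t θ))
    (fun s hs r hr t => extension_mul_flow ha hspec hs hr θ t)
    (fun s hs => continuous_orbit ha hs.1.le hs.2 θ)
    (fun t => continuousOn_extension_radius ha _) (fun k => radius_mem (φ k))
    (tendsto_radius.comp hφ.tendsto_atTop) hbtop.ne fun k => (hlt k).le

end Extension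

/-! ### Density of trigonometric polynomials -/

/-- The trigonometric polynomials on the infinite torus. -/
def trigPoly : Submodule ℂ C(Torus, ℂ) := Submodule.span ℂ (Set.range charC)

/-- The algebra of trigonometric polynomials. -/
def charSubalgebra : StarSubalgebra ℂ C(Torus, ℂ) where
  toSubalgebra := Algebra.adjoin ℂ (Set.range charC)
  star_mem' := by
    change Algebra.adjoin ℂ (Set.range charC) ≤ star (Algebra.adjoin ℂ (Set.range charC))
    refine Algebra.adjoin_le ?_
    rintro _ ⟨ν, rfl⟩
    refine Algebra.subset_adjoin ⟨-ν, ?_⟩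
    ext θ
    simp [char_neg]

lemma charSubalgebra_coe : charSubalgebra.toSubalgebra.toSubmodule = trigPoly := by
  refine Algebra.adjoin_eq_span_of_subset _ (subset_trans (fun x =>
    Submonoid.closure_induction (fun _ h => h) ⟨0, ?_⟩ ?_) Submodule.subset_span)
  · ext θ
    simp
  · rintro _ _ _ _ ⟨m, rfl⟩ ⟨n, rfl⟩
    refine ⟨m + n, ?_⟩
    ext θ
    simp [char_add]

lemma charSubalgebra_separatesPoints : charSubalgebra.SeparatesPoints := by
  intro x y hxy
  obtain ⟨j, hj⟩ := Function.ne_iff.1 hxy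
  refine ⟨_, ⟨charC (Finsupp.single j 1), Algebra.subset_adjoin ⟨_, rfl⟩, rfl⟩, ?_⟩
  simp only [charC_apply, char, Finsupp.prod_single_index, fourier_zero, fourier_one]
  contrapose hj
  exact AddCircle.injective_toCircle Real.two_pi_pos.ne' (Subtype.coe_injective hj)

lemma exists_trigPoly_near (g : C(Torus, ℂ)) {ε : ℝ} (hε : 0 < ε) :
    ∃ p ∈ trigPoly, ‖g - p‖ < ε := by
  have h : g ∈ (charSubalgebra.topologicalClosure : Set C(Torus, ℂ)) := by
    rw [ContinuousMap.starSubalgebra_topologicalClosure_eq_top_of_separatesPoints _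
      charSubalgebra_separatesPoints]
    trivial
  rw [StarSubalgebra.topologicalClosure_coe] at h
  obtain ⟨p, hp, hd⟩ := Metric.mem_closure_iff.1 h ε hε
  refine ⟨p, ?_, by rwa [← dist_eq_norm]⟩
  rw [← charSubalgebra_coe]
  exact hp

/-! ### Weak-* convergence -/

lemma norm_integral_mul_le {g : C(Torus, ℂ)} {f : Torus → ℂ} (hf : Continuous f) {B : ℝ≥0∞}
    (hB : B ≠ ∞) (hfB : normOne f ≤ B) : ‖∫ θ, g θ * f θ ∂haar‖ ≤ ‖g‖ * B.toReal := by
  have hfi : ∫ θ, ‖f θ‖ ∂haar ≤ B.toReal := by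
    rw [integral_norm_eq_lintegral_enorm hf.aestronglyMeasurable]
    exact ENNReal.toReal_mono hB hfB
  calc ‖∫ θ, g θ * f θ ∂haar‖ ≤ ∫ θ, ‖g‖ * ‖f θ‖ ∂haar := by
        refine norm_integral_le_of_norm_le ((continuous_integrable hf).norm.const_mul _)
          (.of_forall fun θ => ?_)
        rw [norm_mul]
        exact mul_le_mul_of_nonneg_right (g.norm_coe_le_norm θ) (norm_nonneg _)
    _ = ‖g‖ * ∫ θ, ‖f θ‖ ∂haar := integral_const_mul _ _
    _ ≤ ‖g‖ * B.toReal := by gcongr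

lemma tendsto_integral_mul_extension {a : (ℕ →₀ ℤ) → ℂ} {ρ : Measure Torus} [IsFiniteMeasure ρ]
    {Λ : C(Torus, ℂ) →ₗ[ℂ] ℂ} (hΛ : ∀ g, ‖Λ g‖ₑ ≤ ∫⁻ θ, ‖g θ‖ₑ ∂ρ)
    (ha : ∀ ν, a ν = Λ (charC (-ν))) (g : C(Torus, ℂ)) :
    Tendsto (fun r : ℝ => ∫ θ, g θ * extension a r θ ∂haar) (𝓝[<] 1) (𝓝 (Λ g)) := by
  have hdom : Dominated a ρ := ⟨Λ, hΛ, ha⟩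
  have hcb := hdom.coeffBound
  have hmass : ∀ r ∈ Set.Ioo (0 : ℝ) 1, normOne (extension a r) ≤ ρ Set.univ := fun r hr =>
    hdom.normOne_extension_le (by
      rw [Complex.norm_real, Real.norm_of_nonneg hr.1.le]; exact hr.2)
  have hcont : ∀ r ∈ Set.Ioo (0 : ℝ) 1, Continuous (extension a r) := fun r hr =>
    continuous_extension hcb hr.1.le hr.2
  have hint : ∀ r ∈ Set.Ioo (0 : ℝ) 1, ∀ g : C(Torus, ℂ),
      Integrable (fun θ => g θ * extension a r θ) haar := fun r hr g =>
    continuous_integrable (g.continuous.mul (hcont r hr))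
  have hpoly : ∀ p ∈ trigPoly,
      Tendsto (fun r : ℝ => ∫ θ, p θ * extension a r θ ∂haar) (𝓝[<] 1) (𝓝 (Λ p)) := by
    intro p hp
    induction hp using Submodule.span_induction with
    | mem _ h =>
      obtain ⟨ν, rfl⟩ := h
      have h1 : Tendsto (fun r : ℝ => a (-ν) * (r : ℂ) ^ weight ν) (𝓝[<] 1)
          (𝓝 (a (-ν) * ((1 : ℝ) : ℂ) ^ weight ν)) :=
        Continuous.continuousWithinAt (f := fun r : ℝ => a (-ν) * (r : ℂ) ^ weight ν) (by fun_prop)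
      rw [Complex.ofReal_one, one_pow, mul_one] at h1
      rw [show Λ (charC ν) = a (-ν) by rw [ha, neg_neg]]
      refine h1.congr' (Filter.mem_of_superset Ioo_mem_nhdsLT_one fun r hr => ?_)
      have h2 := integral_extension_mul_char hcb hr.1.le hr.2 ν
      simp only [mul_comm _ (char ν _)] at h2
      change a (-ν) * (r : ℂ) ^ weight ν = ∫ θ, char ν θ * extension a r θ ∂haar
      rw [h2]
    | zero => simp
    | add p q _ _ hp hq =>
      rw [map_add]
      refine (hp.add hq).congr' (Filter.mem_of_superset Ioo_mem_nhdsLT_one fun r hr => ?_)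
      change _ = ∫ θ, (p + q) θ * extension a r θ ∂haar
      simp only [ContinuousMap.add_apply, add_mul]
      exact (integral_add (hint r hr p) (hint r hr q)).symm
    | smul c p _ hp =>
      rw [map_smul]
      refine (hp.const_smul c).congr fun r => ?_
      simp only [ContinuousMap.smul_apply, smul_eq_mul, mul_assoc, integral_const_mul]
  set M := ρ.real Set.univ
  have hM : 0 ≤ M := measureReal_nonneg
  rw [Metric.tendsto_nhds]
  intro ε hε
  -- Using `M + 1` avoids division by zero when the dominating measure vanishes.
  obtain ⟨p, hp, hgp⟩ := exists_trigPoly_near g (show 0 < ε / (3 * (M + 1)) by positivity)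
  have hsmall : ‖g - p‖ * M ≤ ε / 3 := by
    calc ‖g - p‖ * M ≤ ε / (3 * (M + 1)) * (M + 1) := by
          gcongr
          linarith
      _ = ε / 3 := by field_simp
  filter_upwards [Metric.tendsto_nhds.1 (hpoly p hp) (ε / 3) (by positivity),
    Ioo_mem_nhdsLT_one] with r h1 hr
  have h2 : dist (∫ θ, g θ * extension a r θ ∂haar) (∫ θ, p θ * extension a r θ ∂haar) ≤ ε / 3 := by
    rw [dist_eq_norm, ← integral_sub (hint r hr g) (hint r hr p)]
    simp only [← sub_mul]
    exact (norm_integral_mul_le (g := g - p) (hcont r hr) (measure_ne_top ρ _)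
      (hmass r hr)).trans hsmall
  have h3 : dist (Λ p) (Λ g) ≤ ε / 3 := by
    rw [dist_comm, dist_eq_norm, ← map_sub]
    refine (enorm_functional_le_sup hΛ _).trans ?_
    rwa [mul_comm]
  calc dist (∫ θ, g θ * extension a r θ ∂haar) (Λ g)
      ≤ _ + _ + _ := dist_triangle4 _ _ _ _
    _ < ε / 3 + ε / 3 + ε / 3 := add_lt_add_of_lt_of_le (add_lt_add_of_le_of_lt h2 h1) h3
    _ = ε := by ring

/-! ### Complex measures -/

instance isFiniteMeasure_variation {X : Type*} [MeasurableSpace X] (μ : ComplexMeasure X) :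
    IsFiniteMeasure μ.variation := by
  -- The variation is the least measure dominating `‖μ E‖`, and the finite total variations of the
  -- real and imaginary parts together do so.
  refine isFiniteMeasure_of_le
    ((ComplexMeasure.re μ).totalVariation + (ComplexMeasure.im μ).totalVariation)
    (VectorMeasure.variation_le_of_forall_enorm_le fun E _ => ?_)
  have hre := (ComplexMeasure.re μ).enorm_le_totalVariation E
  have him := (ComplexMeasure.im μ).enorm_le_totalVariation E
  refine le_trans ?_ (add_le_add hre him)
  have e : μ E = ((ComplexMeasure.re μ E : ℝ) : ℂ) + ((ComplexMeasure.im μ E : ℝ) : ℂ) * Complex.I :=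
    (Complex.re_add_im _).symm
  rw [e]
  refine (enorm_add_le _ _).trans (le_of_eq ?_)
  simp [← ofReal_norm]

/-- Integration against a complex measure, as a functional on the continuous functions. -/
def cintegralₗ (μ : ComplexMeasure Torus) : C(Torus, ℂ) →ₗ[ℂ] ℂ where
  toFun g := cintegral μ g
  map_add' g h := VectorMeasure.integral_add (continuous_integrable g.continuous)
    (continuous_integrable h.continuous)
  map_smul' c g := setToFun_smul _ (fun c s x => mul_assoc c x (μ s)) c g

lemma enorm_cintegralₗ_le (μ : ComplexMeasure Torus) (g : C(Torus, ℂ)) :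
    ‖cintegralₗ μ g‖ₑ ≤ ∫⁻ θ, ‖g θ‖ₑ ∂μ.variation := by
  refine VectorMeasure.enorm_integral_le_lintegral_enorm.trans (le_of_eq ?_)
  rw [← ofReal_norm, ContinuousLinearMap.opNorm_mul, ENNReal.ofReal_one, one_mul]

lemma dominated_measureCoeff (μ : ComplexMeasure Torus) :
    Dominated (measureCoeff μ) μ.variation :=
  ⟨cintegralₗ μ, enorm_cintegralₗ_le μ, fun _ => rfl⟩

/-! ### Integrable functions -/

lemma integrable_mul_continuous {f : Torus → ℂ} (hf : Integrable f haar) (g : C(Torus, ℂ)) :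
    Integrable (fun θ => f θ * g θ) haar :=
  hf.mul_bdd g.continuous.aestronglyMeasurable (.of_forall g.norm_coe_le_norm)

lemma withDensity_univ_enorm (f : Torus → ℂ) :
    haar.withDensity (fun θ => ‖f θ‖ₑ) Set.univ = normOne f := by
  rw [withDensity_apply _ MeasurableSet.univ, Measure.restrict_univ, normOne]

lemma normOne_ne_top {f : Torus → ℂ} (hf : Integrable f haar) : normOne f ≠ ∞ := hf.2.ne

lemma isFiniteMeasure_withDensity_enorm {f : Torus → ℂ} (hf : Integrable f haar) :
    IsFiniteMeasure (haar.withDensity fun θ => ‖f θ‖ₑ) :=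
  ⟨by rw [withDensity_univ_enorm]; exact hf.2⟩

lemma dominated_funCoeff {f : Torus → ℂ} (hf : Integrable f haar) :
    Dominated (funCoeff f) (haar.withDensity fun θ => ‖f θ‖ₑ) := by
  refine ⟨⟨⟨fun g => ∫ θ, f θ * g θ ∂haar, fun g h => ?_⟩, fun c g => ?_⟩, fun g => ?_, fun ν => rfl⟩
  · simp only [ContinuousMap.add_apply, mul_add]
    exact integral_add (integrable_mul_continuous hf g) (integrable_mul_continuous hf h)
  · simp only [ContinuousMap.smul_apply, smul_eq_mul, mul_left_comm _ c, integral_const_mul,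
      RingHom.id_apply]
  · refine (enorm_integral_le_lintegral_enorm _).trans (le_of_eq ?_)
    rw [lintegral_withDensity_eq_lintegral_mul₀ hf.1.enorm g.continuous.enorm.aemeasurable]
    simp only [enorm_mul, Pi.mul_apply]

lemma coeffBound_funCoeff {f : Torus → ℂ} (hf : Integrable f haar) :
    CoeffBound (funCoeff f) (normOne f).toReal := by
  have := isFiniteMeasure_withDensity_enorm hf
  have h := (dominated_funCoeff hf).coeffBound
  rwa [measureReal_def, withDensity_univ_enorm] at h

lemma normOne_funExt_le {f : Torus → ℂ} (hf : Integrable f haar) {r : ℝ}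
    (hr : r ∈ Set.Ioo (0 : ℝ) 1) : normOne (funExt f r) ≤ normOne f := by
  have := isFiniteMeasure_withDensity_enorm hf
  rw [← withDensity_univ_enorm f]
  exact (dominated_funCoeff hf).normOne_extension_le (by
    rw [Complex.norm_real, Real.norm_of_nonneg hr.1.le]; exact hr.2)

lemma continuous_funExt {f : Torus → ℂ} (hf : Integrable f haar) {r : ℝ}
    (hr : r ∈ Set.Ioo (0 : ℝ) 1) : Continuous (funExt f r) :=
  continuous_extension (coeffBound_funCoeff hf) hr.1.le hr.2

/-! ### Linearity of the extension and `L¹` approximation by trigonometric polynomials. -/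

lemma funExt_add {f g : Torus → ℂ} (hf : Integrable f haar) (hg : Integrable g haar) {r : ℝ}
    (hr : r ∈ Set.Ioo (0 : ℝ) 1) (θ : Torus) :
    funExt (f + g) r θ = funExt f r θ + funExt g r θ := by
  have e : ∀ ν, funCoeff (f + g) ν = funCoeff f ν + funCoeff g ν := fun ν => by
    simp only [funCoeff, Pi.add_apply, add_mul]
    exact integral_add (integrable_mul_continuous hf (charC (-ν)))
      (integrable_mul_continuous hg (charC (-ν)))
  simp only [funExt, extension_ofReal hr.1.le, e, add_mul]
  exact (summable_extension (coeffBound_funCoeff hf) hr.1.le hr.2 θ).tsum_add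
    (summable_extension (coeffBound_funCoeff hg) hr.1.le hr.2 θ)

lemma funExt_const_smul (c : ℂ) (f : Torus → ℂ) {r : ℝ} (hr : 0 ≤ r) (θ : Torus) :
    funExt (c • f) r θ = c * funExt f r θ := by
  have e : ∀ ν, funCoeff (c • f) ν = c * funCoeff f ν := fun ν => by
    simp only [funCoeff, Pi.smul_apply, smul_eq_mul, mul_assoc, integral_const_mul]
  simp only [funExt, extension_ofReal hr, e, mul_assoc, tsum_mul_left]

lemma funExt_char (ν : ℕ →₀ ℤ) {r : ℝ} (hr : 0 ≤ r) (θ : Torus) :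
    funExt (char ν) r θ = (r : ℂ) ^ weight ν * char ν θ := by
  have e : ∀ ν', funCoeff (char ν) ν' = if ν' = ν then 1 else 0 := fun ν' => by
    simp only [funCoeff, ← char_add]
    split_ifs with h
    · simp [h]
    · exact integral_char fun h' => h (by rw [← sub_eq_add_neg, sub_eq_zero] at h'; exact h'.symm)
  rw [funExt, extension_ofReal hr, tsum_eq_single ν fun ν' h => by rw [e, if_neg h]; simp, e,
    if_pos rfl, one_mul]

lemma normOne_add_le {f g : Torus → ℂ} (hf : AEStronglyMeasurable f haar) :
    normOne (f + g) ≤ normOne f + normOne g := by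
  rw [normOne, normOne, normOne, ← lintegral_add_left' hf.enorm]
  exact lintegral_mono fun θ => enorm_add_le _ _

lemma normOne_const_smul (c : ℂ) (f : Torus → ℂ) : normOne (c • f) = ‖c‖ₑ * normOne f := by
  simp only [normOne, Pi.smul_apply, enorm_smul]
  exact lintegral_const_mul' _ _ enorm_ne_top

lemma tendsto_normOne_trigPoly {p : C(Torus, ℂ)} (hp : p ∈ trigPoly) :
    Tendsto (fun r : ℝ => normOne (funExt p r - p)) (𝓝[<] 1) (𝓝 0) := by
  have hi : ∀ p : C(Torus, ℂ), Integrable p haar := fun p => continuous_integrable p.continuous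
  induction hp using Submodule.span_induction with
  | mem _ h =>
    obtain ⟨ν, rfl⟩ := h
    have h1 : Tendsto (fun r : ℝ => ‖(r : ℂ) ^ weight ν - 1‖ₑ) (𝓝[<] 1)
        (𝓝 ‖((1 : ℝ) : ℂ) ^ weight ν - 1‖ₑ) :=
      Continuous.continuousWithinAt (f := fun r : ℝ => ‖(r : ℂ) ^ weight ν - 1‖ₑ) (by fun_prop)
    rw [Complex.ofReal_one, one_pow, sub_self, enorm_zero] at h1
    refine h1.congr' (Filter.mem_of_superset Ioo_mem_nhdsLT_one fun r hr => ?_)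
    have e : funExt (charC ν) r - charC ν = ((r : ℂ) ^ weight ν - 1) • char ν := by
      funext θ
      change funExt (char ν) r θ - char ν θ = _
      rw [funExt_char ν hr.1.le, Pi.smul_apply, smul_eq_mul]
      ring
    have hn : normOne (char ν) = 1 := by simp [normOne, ← ofReal_norm]
    change _ = normOne _
    rw [e, normOne_const_smul, hn, mul_one]
  | zero =>
    refine tendsto_const_nhds.congr' (Filter.mem_of_superset Ioo_mem_nhdsLT_one fun r hr => ?_)
    have h0 : ∀ θ, funExt (0 : Torus → ℂ) r θ = 0 := fun θ => by
      have := funExt_const_smul 0 (0 : Torus → ℂ) hr.1.le θ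
      rwa [zero_smul, zero_mul] at this
    change 0 = normOne _
    simp [normOne, h0]
  | add p q _ _ hp hq =>
    have hpq := hp.add hq
    rw [add_zero] at hpq
    refine tendsto_of_tendsto_of_tendsto_of_le_of_le' tendsto_const_nhds hpq
      (.of_forall fun _ => zero_le) (Filter.mem_of_superset Ioo_mem_nhdsLT_one fun r hr => ?_)
    have e : funExt (p + q : C(Torus, ℂ)) r - (p + q : C(Torus, ℂ))
        = (funExt p r - p) + (funExt q r - q) := by
      funext θ
      have := funExt_add (hi p) (hi q) hr θ
      change funExt (p + q) r θ - (p θ + q θ) = _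
      rw [this]
      simp only [Pi.add_apply, Pi.sub_apply]
      ring
    change normOne _ ≤ _
    rw [e]
    exact normOne_add_le (((continuous_funExt (hi p) hr).sub p.continuous).aestronglyMeasurable)
  | smul c p _ hp =>
    have hcp := ENNReal.Tendsto.const_mul (a := ‖c‖ₑ) hp (.inr enorm_ne_top)
    rw [mul_zero] at hcp
    refine hcp.congr' (Filter.mem_of_superset Ioo_mem_nhdsLT_one fun r hr => ?_)
    have e : funExt (c • p : C(Torus, ℂ)) r - (c • p : C(Torus, ℂ)) = c • (funExt p r - p) := by
      funext θ
      have := funExt_const_smul c p hr.1.le θ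
      change funExt (c • p) r θ - c * p θ = _
      rw [this]
      simp only [Pi.smul_apply, Pi.sub_apply, smul_eq_mul]
      ring
    change _ = normOne _
    rw [e, normOne_const_smul]

lemma exists_trigPoly_normOne_le {f : Torus → ℂ} (hf : Integrable f haar) {ε : ℝ≥0∞}
    (hε : ε ≠ 0) : ∃ p ∈ trigPoly, normOne (f - p) ≤ ε := by
  have h2 : ε / 2 ≠ 0 := by simpa using hε
  obtain ⟨g, hg, -⟩ := hf.exists_boundedContinuous_lintegral_sub_le h2
  obtain ⟨δ, hδ0, hδ⟩ := ENNReal.lt_iff_exists_real_btwn.1 (pos_iff_ne_zero.2 h2)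
  obtain ⟨p, hp, hgp⟩ := exists_trigPoly_near g.toContinuousMap
    (ENNReal.ofReal_pos.1 hδ.1)
  refine ⟨p, hp, ?_⟩
  have e : f - p = (f - g) + (⇑g - ⇑p) := by simp
  rw [e, ← ENNReal.add_halves ε]
  refine (normOne_add_le (hf.1.sub g.continuous.aestronglyMeasurable)).trans (add_le_add hg ?_)
  calc normOne (⇑g - ⇑p) ≤ ∫⁻ _, ENNReal.ofReal δ ∂haar := by
        refine lintegral_mono fun θ => ?_
        rw [← ofReal_norm]
        exact ENNReal.ofReal_le_ofReal
          (((g.toContinuousMap - p).norm_coe_le_norm θ).trans hgp.le)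
    _ ≤ ε / 2 := by simpa using hδ.2.le

/-- Trigonometric polynomials are dense in `L¹` and the extension contracts the norm, so a
three-term estimate suffices; the spectrum plays no role. -/
lemma tendsto_normOne_funExt_sub {f : Torus → ℂ} (hf : Integrable f haar) :
    Tendsto (fun r : ℝ => normOne (fun θ => funExt f r θ - f θ)) (𝓝[<] 1) (𝓝 0) := by
  rw [ENNReal.tendsto_nhds_zero]
  intro ε hε
  have h3 : ε / 3 ≠ 0 := by simpa using hε.ne'
  obtain ⟨p, hp, hfp⟩ := exists_trigPoly_normOne_le hf h3
  have hpi : Integrable p haar := continuous_integrable p.continuous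
  filter_upwards [ENNReal.tendsto_nhds_zero.1 (tendsto_normOne_trigPoly hp) (ε / 3)
    (pos_iff_ne_zero.2 h3), Ioo_mem_nhdsLT_one] with r h1 hr
  have e : (fun θ => funExt f r θ - f θ)
      = (funExt (f - p) r + (funExt p r - p)) + (-1 : ℂ) • (f - p) := by
    funext θ
    have := funExt_add (hf.sub hpi) hpi hr θ
    rw [sub_add_cancel] at this
    rw [this]
    simp only [Pi.add_apply, Pi.sub_apply, Pi.smul_apply, smul_eq_mul]
    ring
  have hc1 := continuous_funExt (hf.sub hpi) hr
  have hc2 := (continuous_funExt hpi hr).sub p.continuous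
  rw [e, ← ENNReal.add_thirds ε]
  refine (normOne_add_le (hc1.add hc2).aestronglyMeasurable).trans
    (add_le_add ((normOne_add_le hc1.aestronglyMeasurable).trans (add_le_add ?_ h1)) ?_)
  · exact (normOne_funExt_le (hf.sub hpi) hr).trans hfp
  · rw [normOne_const_smul]
    simpa using hfp

/-- Existence of the limit comes from the flow argument; its value comes from `L¹` convergence,
which forces convergence to `f` almost everywhere along some subsequence of radii. -/
lemma ae_tendsto_funExt {f : Torus → ℂ} (hf : Integrable f haar)
    (hspec : HarmonicSpectrum (funCoeff f)) :
    ∀ᵐ θ ∂haar, Tendsto (fun r : ℝ => funExt f r θ) (𝓝[<] 1) (𝓝 (f θ)) := by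
  have hlim := ae_hasRadialLimit_extension (coeffBound_funCoeff hf) hspec (normOne_ne_top hf)
    fun s hs => normOne_funExt_le hf hs
  have hrad : Tendsto radius atTop (𝓝[<] 1) :=
    tendsto_nhdsWithin_iff.2 ⟨tendsto_radius, .of_forall fun n => (radius_mem n).2⟩
  have hmeas := tendstoInMeasure_of_tendsto_eLpNorm (p := 1) (μ := haar) (g := f)
    (f := fun n => funExt f (radius n)) one_ne_zero
    (fun n => (continuous_funExt hf (radius_mem n)).aestronglyMeasurable) hf.1 (by
      simp only [eLpNorm_one_eq_lintegral_enorm]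
      exact (tendsto_normOne_funExt_sub hf).comp hrad)
  obtain ⟨φ, hφ, hae⟩ := hmeas.exists_seq_tendsto_ae
  filter_upwards [hlim, hae] with θ ⟨L, hL⟩ h
  rwa [tendsto_nhds_unique h (hL.comp (hrad.comp hφ.tendsto_atTop))]

lemma normOne_measureExt_le (μ : ComplexMeasure Torus) {ξ : ℂ} (hξ : ‖ξ‖ < 1) :
    normOne (measureExt μ ξ) ≤ tvNorm μ :=
  (dominated_measureCoeff μ).normOne_extension_le hξ

lemma normOne_measureExt_ofReal_le (μ : ComplexMeasure Torus) :
    ∀ s ∈ Set.Ioo (0 : ℝ) 1, normOne (extension (measureCoeff μ) (s : ℂ)) ≤ tvNorm μ :=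
  fun s hs => normOne_measureExt_le μ (by
    rw [Complex.norm_real, Real.norm_of_nonneg hs.1.le]; exact hs.2)

end InfTorus

end

theorem mainTheorem1 :
    -- (i)
    (∀ μ : ComplexMeasure InfTorus.Torus,
      (∀ ξ : ℂ, ‖ξ‖ < 1 → InfTorus.normOne (InfTorus.measureExt μ ξ) ≤ InfTorus.tvNorm μ) ∧
      (∀ g : C(InfTorus.Torus, ℂ),
        Tendsto (fun r : ℝ => ∫ θ, g θ * InfTorus.measureExt μ (r : ℂ) θ ∂InfTorus.haar)
          (𝓝[<] 1) (𝓝 (InfTorus.cintegral μ g)))) ∧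
    -- (ii)
    ((∃ C : ℝ≥0, ∀ μ : ComplexMeasure InfTorus.Torus,
        InfTorus.HarmonicSpectrum (InfTorus.measureCoeff μ) →
        ∀ t : ℝ, 0 < t →
          InfTorus.haar {θ | ENNReal.ofReal t < InfTorus.measureMax μ θ} ≤
            C * InfTorus.tvNorm μ / ENNReal.ofReal t) ∧
      (∀ μ : ComplexMeasure InfTorus.Torus,
        InfTorus.HarmonicSpectrum (InfTorus.measureCoeff μ) →
        ∀ᵐ θ ∂InfTorus.haar, ∃ L : ℂ,
          Tendsto (fun r : ℝ => InfTorus.measureExt μ (r : ℂ) θ) (𝓝[<] 1) (𝓝 L))) ∧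
    -- (iii)
    (∀ f : InfTorus.Torus → ℂ, Integrable f InfTorus.haar →
      InfTorus.HarmonicSpectrum (InfTorus.funCoeff f) →
      (∀ᵐ θ ∂InfTorus.haar,
        Tendsto (fun r : ℝ => InfTorus.funExt f (r : ℂ) θ) (𝓝[<] 1) (𝓝 (f θ))) ∧
      Tendsto (fun r : ℝ => InfTorus.normOne (fun θ => InfTorus.funExt f (r : ℂ) θ - f θ))
        (𝓝[<] 1) (𝓝 0)) ∧
    -- (iv)
    ((∃ C : ℝ≥0, ∀ f : InfTorus.Torus → ℂ, InfTorus.MemHardyOne f →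
        ∫⁻ θ, InfTorus.funMax f θ ∂InfTorus.haar ≤ C * InfTorus.normOne f) ∧
      (∃ C : ℝ≥0, ∀ μ : ComplexMeasure InfTorus.Torus,
        InfTorus.AnalyticSpectrum (InfTorus.measureCoeff μ) →
        ∫⁻ θ, InfTorus.measureMax μ θ ∂InfTorus.haar ≤ C * InfTorus.tvNorm μ)) := by
  refine ⟨fun μ => ⟨fun ξ hξ => InfTorus.normOne_measureExt_le μ hξ, fun g =>
    InfTorus.tendsto_integral_mul_extension (InfTorus.enorm_cintegralₗ_le μ) (fun _ => rfl) g⟩,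
    ⟨⟨80, fun μ hμ t ht => ?_⟩, fun μ hμ => ?_⟩, fun f hf hspec =>
    ⟨InfTorus.ae_tendsto_funExt hf hspec, InfTorus.tendsto_normOne_funExt_sub hf⟩,
    ⟨10240, fun f hf => ?_⟩, ⟨10240, fun μ hμ => ?_⟩⟩
  · rw [ENNReal.le_div_iff_mul_le (.inl (ENNReal.ofReal_pos.2 ht).ne') (.inl ENNReal.ofReal_ne_top),
      mul_comm]
    exact InfTorus.mul_haar_maximal_le (InfTorus.dominated_measureCoeff μ).coeffBound hμ
      (InfTorus.normOne_measureExt_ofReal_le μ) _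
  · exact InfTorus.ae_hasRadialLimit_extension (InfTorus.dominated_measureCoeff μ).coeffBound hμ
      (measure_ne_top μ.variation Set.univ) (InfTorus.normOne_measureExt_ofReal_le μ)
  · exact InfTorus.lintegral_maximal_le (InfTorus.coeffBound_funCoeff hf.1) hf.2
      fun s hs => InfTorus.normOne_funExt_le hf.1 hs
  · exact InfTorus.lintegral_maximal_le (InfTorus.dominated_measureCoeff μ).coeffBound hμ
      (InfTorus.normOne_measureExt_ofReal_le μ)
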